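/- Let $K=U(2)$ act on $\mathbb C^2$, and let $V_n$ ($n\ge 0$) be the space of homogeneous polynomials of degree $n$ in $z=(z_1,z_2)$ with the representation $[\tau_n(k)p](z)=p(k^{-1}z)$ and orthonormal basis $e^j=\binom nj^{1/2}z_1^jz_2^{n-j}$, $0\le j\le n$; identify $\mathrm{End}(V_n)$ with $(n+1)\times(n+1)$ matrices, with the Hilbert–Schmidt norm. Under $A\mapsto\tau_n(k)A\tau_n(k)^{-1}$ one has $\mathrm{End}(V_n)=\bigoplus_{\ell=0}^n W_n^\ell$ with $W_n^\ell$ irreducible of dimension $2\ell+1$. A function $F:\mathbb C^2\to\mathrm{End}(V_n)$ is $K$-equivariant if $F(kz)=\tau_n(k)F(z)\tau_n(k)^{-1}$ for all $k\in K$, $z\in\mathbb C^2$. Let $X_1=\begin{bmatrix}i&0\\0&-i\end{bmatrix}$, $X_2=\begin{bmatrix}0&1\\-1&0\end{bmatrix}$, $X_3=\begin{bmatrix}0&i\\i&0\end{bmatrix}$ and $B_n^1=i\,d\tau_n(X_1)=\mathrm{diag}(-n,-n+2,\dots,n)$. For $0\le\ell\le n$ let $q_n^\ell(t)=\sum_{k=0}^{\ell}a_k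 t^k$ be the monic polynomial of degree $\ell$ such that the diagonal matrices in $W_n^\ell$ are exactly the scalar multiples of $B_n^\ell=q_n^\ell(B_n^1)$ (such a polynomial exists). Let $Q_n^\ell$ be the $\mathrm{End}(V_n)$-valued polynomial $$Q_n^\ell(z)=|z|^{2\ell}\,\tau_n(k_{z'})B_n^\ell\,\tau_n(k_{z'})^*,\qquad z=|z|z',\quad k_{z'}=\begin{bmatrix}\bar z_2'&z_1'\\-\bar z_1'&z_2'\end{bmatrix}.$$ Let $\widehat u(\zeta)=\int_{\mathbb C^2}u(z)e^{-i\langle z,\zeta\rangle}dz$ with $\langle z,\zeta\rangle=\mathrm{Re}\sum_j z_j\bar\zeta_j$, and let $Q_n^\ell(\partial)$ be the operator with $\widehat{Q_n^\ell(\partial)u}=Q_n^\ell\,\widehat u$. Put $\Delta_{z_j}=-4\partial_{z_j}\partial_{\bar z_j}$, $\Delta_z=\Delta_{z_1}+\Delta_{z_2}$, $$\mathbf D_n=i(\Delta_{z_2}-\Delta_{z_1})\,d\tau_n(X_1)-4(\partial_{\bar z_1}\partial_{z_2}-\partial_{z_1}\partial_{\bar z_2})\,d\tau_n(X_2)+4i(\partial_{z_1}\partial_{\bar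 z_2}+\partial_{\bar z_1}\partial_{z_2})\,d\tau_n(X_3).$$ For $M\in\mathbb N$ put $\|F\|_{(M)}=\max_{0\le q\le M}\|(1+|\cdot|^2)^M\Delta_z^qF\|_{L^2(\mathbb C^2)}$, and for functions $g$ on $\mathbb R$ put $\|g\|_{(M)}=\max_{0\le q\le M}\|(1+t^2)^M(-d^2/dt^2)^q g\|_{L^2(\mathbb R)}$. **Proposition.** Let $0\le\ell\le n$. There are numbers $M'=M'(M)\ge M+\ell$ and $C_M\ge 0$ ($M\in\mathbb N$), depending on $n,\ell,M$ only, such that the following holds. For every $K$-equivariant Schwartz function $F:\mathbb C^2\to \mathrm{End}(V_n)$ with values in $W_n^\ell$ there are a scalar Schwartz function $g_0$ on $\mathbb C^2$ and a complex-valued Schwartz function $g$ on $\mathbb R$ with $g_0(z)=g(|z|^2)$ for all $z$ (so that $g_0$ is radial, hence $K$-invariant), with $$F=Q_n^\ell(\partial)g_0=\sum_{k=0}^{\ell}a_k\,\mathbf D_n^k\,\Delta_z^{\ell-k}(g_0I),$$ and with $\|g\|_{(M)}\le C_M\|F\|_{(M')}$ for every $M\in\mathbb N$. -/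

import Mathlib

open MeasureTheory Matrix SchwartzMap
open scoped ENNReal ComplexConjugate

attribute [local instance] Matrix.frobeniusNormedAddCommGroup Matrix.frobeniusNormedSpace

namespace MotionGroup

/-- The space `ℂ²` with its Hermitian norm `|z|² = |z₁|² + |z₂|²`. -/
abbrev C2 : Type := EuclideanSpace ℂ (Fin 2)

/-- `End(V_n)`, where `V_n` is the space of homogeneous polynomials of degree `n` in two complex
variables; an endomorphism is represented by its matrix in the orthonormal basis
`e^j = binom(n,j)^{1/2} z₁^j z₂^{n-j}`, `j = 0, …, n`. Its norm is the Frobenius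
(= Hilbert-Schmidt) norm. -/
abbrev EndV (n : ℕ) : Type := Matrix (Fin (n + 1)) (Fin (n + 1)) ℂ

noncomputable section

/-! ### The representation of `U(2)` on `V_n` -/

/-- The exponent of the monomial `z₁^j z₂^{n-j}`. -/
def expo (n : ℕ) (j : Fin (n + 1)) : Fin 2 →₀ ℕ :=
  Finsupp.single 0 (j : ℕ) + Finsupp.single 1 (n - (j : ℕ))

/-- The basis polynomial `e^j = binom(n,j)^{1/2} z₁^j z₂^{n-j}`. -/
def basisPoly (n : ℕ) (j : Fin (n + 1)) : MvPolynomial (Fin 2) ℂ :=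
  MvPolynomial.monomial (expo n j) ((Real.sqrt (n.choose j) : ℝ) : ℂ)

/-- The matrix, in the basis `e^0, …, e^n`, of a linear operator on polynomials which preserves
the homogeneous polynomials of degree `n`. -/
def polyMatrix (n : ℕ) (T : MvPolynomial (Fin 2) ℂ →ₗ[ℂ] MvPolynomial (Fin 2) ℂ) : EndV n :=
  Matrix.of fun i j =>
    MvPolynomial.coeff (expo n i) (T (basisPoly n j)) / ((Real.sqrt (n.choose i) : ℝ) : ℂ)

/-- The representation `τ_n` on `V_n`: `(τ_n(k) p)(z) = p(k⁻¹ z)` for `k ∈ U(2)`. -/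
def tau (n : ℕ) (k : Matrix (Fin 2) (Fin 2) ℂ) : EndV n :=
  polyMatrix n
    (MvPolynomial.aeval
      (fun i => ∑ j, MvPolynomial.C (k⁻¹ i j) * MvPolynomial.X j :
        Fin 2 → MvPolynomial (Fin 2) ℂ)).toLinearMap

/-- The derived representation
`(dτ_n(X) p)(z) = d/dt|_{t=0} p(exp(-tX) z) = - ∑_{i,j} X_{ij} z_j ∂p/∂z_i`. -/
def dtau (n : ℕ) (X : Matrix (Fin 2) (Fin 2) ℂ) : EndV n :=
  polyMatrix n
    (-∑ i, ∑ j, X i j •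
      (LinearMap.mulLeft ℂ (MvPolynomial.X j : MvPolynomial (Fin 2) ℂ) ∘ₗ
        (MvPolynomial.pderiv i).toLinearMap))

/-- The basis of `su(2)`. -/
def X1 : Matrix (Fin 2) (Fin 2) ℂ := !![Complex.I, 0; 0, -Complex.I]
/-- The basis of `su(2)`. -/
def X2 : Matrix (Fin 2) (Fin 2) ℂ := !![0, 1; -1, 0]
/-- The basis of `su(2)`. -/
def X3 : Matrix (Fin 2) (Fin 2) ℂ := !![0, Complex.I; Complex.I, 0]

/-! ### The decomposition of `End(V_n)` -/

/-- A subspace of `End(V_n)` is invariant if it is stable under `A ↦ τ_n(k) A τ_n(k)⁻¹`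
for all `k ∈ U(2)`. -/
def IsInvariant {n : ℕ} (W : Submodule ℂ (EndV n)) : Prop :=
  ∀ k ∈ Matrix.unitaryGroup (Fin 2) ℂ, ∀ A ∈ W, tau n k * A * tau n k⁻¹ ∈ W

/-- Irreducible invariant subspaces of `End(V_n)`. -/
def IsIrred {n : ℕ} (W : Submodule ℂ (EndV n)) : Prop :=
  IsInvariant W ∧ W ≠ ⊥ ∧ ∀ U : Submodule ℂ (EndV n), IsInvariant U → U ≤ W → U = ⊥ ∨ U = W

/-- The irreducible summand `W_n^ℓ` of `End(V_n) = W_n^n ⊕ ⋯ ⊕ W_n^0`, `dim W_n^ℓ = 2ℓ+1`.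
The summands have pairwise different dimensions, so `W_n^ℓ` is the only irreducible invariant
subspace of dimension `2ℓ+1`; the supremum has one member. -/
def W (n l : ℕ) : Submodule ℂ (EndV n) :=
  sSup {U | IsIrred U ∧ Module.finrank ℂ U = 2 * l + 1}

/-- `B_n^1 = i dτ_n(X₁) = diag(-n, -n+2, …, n)`. -/
def B1 (n : ℕ) : EndV n := Complex.I • dtau n X1

/-- `q` is monic of degree `ℓ` and the diagonal matrices in `W_n^ℓ` are exactly the scalar
multiples of `q(B_n^1)`. -/
def IsDiagPoly (n l : ℕ) (q : Polynomial ℂ) : Prop :=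
  q.Monic ∧ q.natDegree = l ∧
    ∀ A : EndV n, (A.IsDiag ∧ A ∈ W n l) ↔ ∃ c : ℂ, A = c • Polynomial.aeval (B1 n) q

/-- The polynomial `q_n^ℓ`: the monic polynomial of degree `ℓ` such that the diagonal matrices in
`W_n^ℓ` are exactly the scalar multiples of `q_n^ℓ(B_n^1)`. It exists and is unique for
`ℓ ≤ n`. -/
def qPoly (n l : ℕ) : Polynomial ℂ := Classical.epsilon (IsDiagPoly n l)

/-- The diagonal matrix `B_n^ℓ = q_n^ℓ(B_n^1)`. -/
def B (n l : ℕ) : EndV n := Polynomial.aeval (B1 n) (qPoly n l)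

/-! ### The equivariant polynomials `Q_n^ℓ` -/

/-- The action of `2 × 2` matrices on `ℂ²`. -/
def act (k : Matrix (Fin 2) (Fin 2) ℂ) (z : C2) : C2 := WithLp.toLp 2 (k *ᵥ WithLp.ofLp z)

/-- For `z ≠ 0` and `z' = z/|z|` this is the element `k_{z'}` of `SU(2)` that maps `(0,1)` to `z'`;
at `z = 0` it is the identity. -/
def sphereMatrix (z : C2) : Matrix (Fin 2) (Fin 2) ℂ :=
  if z = 0 then 1
  else ((‖z‖⁻¹ : ℝ) : ℂ) • !![conj (z 1), z 0; -conj (z 0), z 1]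

/-- `Q_A^d(z) = |z|^{2d} τ_n(k_{z'}) A τ_n(k_{z'})^*`. -/
def QB {n : ℕ} (d : ℕ) (A : EndV n) (z : C2) : EndV n :=
  ((‖z‖ ^ (2 * d) : ℝ) : ℂ) • (tau n (sphereMatrix z) * A * (tau n (sphereMatrix z))ᴴ)

/-- The polynomial `Q_n^ℓ = Q^ℓ_A` with `A = B_n^ℓ`. -/
def Q (n l : ℕ) (z : C2) : EndV n := QB l (B n l) z

/-! ### Fourier multipliers and differential operators -/

/-- Lebesgue measure on `ℂ² = ℝ⁴`. -/
def leb : Measure C2 := (volume : Measure (Fin 2 → ℂ)).map (WithLp.toLp 2)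

/-- The real scalar product `⟨z, ζ⟩ = Re (z₁ ζ̄₁ + z₂ ζ̄₂)`. -/
def rdot (z w : C2) : ℝ := (∑ j, z j * conj (w j)).re

/-- The Fourier transform `û(ζ) = ∫ u(z) e^{-i⟨z,ζ⟩} dz`. -/
def fourier (u : C2 → ℂ) (w : C2) : ℂ :=
  ∫ z, u z * Complex.exp (-(Complex.I * (rdot z w : ℂ))) ∂leb

/-- The operator `P(∂)` with symbol `P`, applied to a scalar function `u`; it is defined by the
rule that the Fourier transform of `P(∂)u` is `P û`, that is,
`(P(∂)u)(z) = (2π)^{-4} ∫ e^{i⟨z,ζ⟩} û(ζ) P(ζ) dζ`. -/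
def multiplier {n : ℕ} (P : C2 → EndV n) (u : C2 → ℂ) (z : C2) : EndV n :=
  (((2 * Real.pi) ^ 4 : ℝ) : ℂ)⁻¹ •
    ∫ w, (Complex.exp (Complex.I * (rdot z w : ℂ)) * fourier u w) • P w ∂leb

section Operators

variable {E : Type*} [NormedAddCommGroup E] [NormedSpace ℝ E] [NormedSpace ℂ E]

/-- `∂_{z_j} = (∂_{x_j} - i ∂_{y_j})/2`, where `z_j = x_j + i y_j`. -/
def dz (j : Fin 2) (u : C2 → E) (z : C2) : E :=
  (1 / 2 : ℂ) • (fderiv ℝ u z (EuclideanSpace.single j 1) -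
    Complex.I • fderiv ℝ u z (EuclideanSpace.single j Complex.I))

/-- `∂_{z̄_j} = (∂_{x_j} + i ∂_{y_j})/2`, where `z_j = x_j + i y_j`. -/
def dzbar (j : Fin 2) (u : C2 → E) (z : C2) : E :=
  (1 / 2 : ℂ) • (fderiv ℝ u z (EuclideanSpace.single j 1) +
    Complex.I • fderiv ℝ u z (EuclideanSpace.single j Complex.I))

/-- The positive Laplacian in the variable `z_j`, `Δ_{z_j} = -4 ∂_{z_j} ∂_{z̄_j}`. -/
def lap1 (j : Fin 2) (u : C2 → E) (z : C2) : E := (-4 : ℂ) • dz j (dzbar j u) z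

/-- The positive Laplacian `Δ_z = Δ_{z₁} + Δ_{z₂}` on `ℂ²`. -/
def lap (u : C2 → E) (z : C2) : E := lap1 0 u z + lap1 1 u z

/-- The norms `‖u‖_(M) = max_{0 ≤ q ≤ M} ‖(1+|z|²)^M Δ_z^q u‖_{L²}` for functions on `ℂ²`. -/
def normC2 (M : ℕ) (u : C2 → E) : ℝ≥0∞ :=
  (Finset.range (M + 1)).sup fun q =>
    eLpNorm (fun z => (((1 + ‖z‖ ^ 2) ^ M : ℝ) : ℂ) • lap^[q] u z) 2 leb

/-- The norms `‖g‖_(M) = max_{0 ≤ q ≤ M} ‖(1+t²)^M (-d²/dt²)^q g‖_{L²}` for functions on `ℝ`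
(the sign does not affect the norm). -/
def normR (M : ℕ) (g : ℝ → E) : ℝ≥0∞ :=
  (Finset.range (M + 1)).sup fun q =>
    eLpNorm (fun t : ℝ => (((1 + t ^ 2) ^ M : ℝ) : ℂ) • iteratedDeriv (2 * q) g t) 2 volume

end Operators

/-- The operator `𝐃_n` on `End(V_n)`-valued functions,
`i (Δ_{z₂} - Δ_{z₁}) dτ_n(X₁) - 4 (∂_{z̄₁}∂_{z₂} - ∂_{z₁}∂_{z̄₂}) dτ_n(X₂)
  + 4i (∂_{z₁}∂_{z̄₂} + ∂_{z̄₁}∂_{z₂}) dτ_n(X₃)`. -/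
def Dop (n : ℕ) (u : C2 → EndV n) (z : C2) : EndV n :=
  Complex.I • (dtau n X1 * (lap1 1 u z - lap1 0 u z))
    - (4 : ℂ) • (dtau n X2 * (dzbar 0 (dz 1 u) z - dz 0 (dzbar 1 u) z))
    + (4 * Complex.I) • (dtau n X3 * (dz 0 (dzbar 1 u) z + dzbar 0 (dz 1 u) z))

/-- For `q(t) = ∑_{k ≤ ℓ} a_k t^k`, the operator `∑_{k ≤ ℓ} a_k 𝐃_n^k Δ_z^{ℓ-k}`, which is `q(𝐃_n)`
made homogeneous of degree `ℓ` with the help of `Δ_z`, applied to the scalar function `u`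
(identified with `u I`). -/
def homOp (n l : ℕ) (q : Polynomial ℂ) (u : C2 → ℂ) (z : C2) : EndV n :=
  ∑ k ∈ Finset.range (l + 1),
    q.coeff k • (Dop n)^[k] (lap^[l - k] (fun w => u w • (1 : EndV n))) z

/-- `F` is `K`-equivariant, `K = U(2)`: `F(kz) = τ_n(k) F(z) τ_n(k)⁻¹`. -/
def IsEquivariant {n : ℕ} (F : C2 → EndV n) : Prop :=
  ∀ k ∈ Matrix.unitaryGroup (Fin 2) ℂ, ∀ z, F (act k z) = tau n k * F z * tau n k⁻¹

end

end MotionGroup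

/-! ### One-variable analysis: division by the coordinate, and even functions as functions of the
square. -/

namespace MotionGroup
open scoped FourierTransform ContDiff

noncomputable section

/-! ### Schwartz functions on the line -/

/-! U(2) is transitive on spheres, so an equivariant F is determined by its values on the axis (0,
r). The matrices diag(a, 1) fix the axis, so these values are diagonal; lying in W_n^ℓ, they are
multiples φ(r)B_n^ℓ, whence |z|^{2ℓ} F(z) = φ(|z|) Q(z). The Fourier transform preserves
equivariance and W-valuedness, so the same holds for F̂, and the theorem becomes a division problem:
write F̂ = h(|·|²) Q with h Schwartz on ℝ. Up to a power of 2π, g₀ is then the inverse transform of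
h(|·|²).

Division. The profile φ of F̂ is even because -1 ∈ U(2), and it must vanish to order 2ℓ at 0
(`iteratedDeriv_profile_zero`). One corner entry of Q is κ(z₁ z̄₂)^ℓ with κ ≠ 0, so on the line t(x,
1) that entry of F̂ times (1+x²)^ℓ equals κ x^ℓ φ(√(1+x²) t). The 2j-th t-derivative of the entry at
0 is a polynomial in x. For j < ℓ, cancelling (1+x²)^j leaves a factor 1+x² on the left, and x = i
gives φ^{(2j)}(0) = 0. So φ = r^{2ℓ}ψ with ψ even and Schwartz (`divX`), and ψ(r) = h(r²)
(`whitney_sq`). A second use of `whitney` turns the radial g₀ into g(|z|²).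

The operator `whitney` rests on Fourier inversion: an even f is ∫ f̂(ξ) cos(2πxξ) dξ, and cos(2πx) =
C(x²) for a smooth C with bounded derivatives, so s ↦ ∫ f̂(ξ) C(sξ²) dξ, cut off on the left, is the
function sought.

Algebra. W_n^ℓ is the span of dτ(X)^ℓ over nilpotent X (`W_eq`), with the 𝔰𝔩₂-ladder ad(F)^j E^ℓ as
a basis; its weight-zero member is a polynomial of degree ℓ in B_n^1 (`exists_ladder_poly`). Since
|z|² τ(k_{z'}) B_n^1 τ(k_{z'})⁻¹ is, up to 4π², the symbol of 𝐃_n, as |z|² is that of Δ, `Q_eq_sum`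
identifies Q(∂) with the differential operator.

Norms. The map φ ↦ g is continuous between Schwartz spaces, so it is enough to bound Schwartz
seminorms of φ (`normBounded_profile`). On the Fourier side r² corresponds to Δ and d/dr to
multiplication by a coordinate, and the supremum of a Fourier transform is bounded by a weighted L²
norm. -/

/-- The derivative on `𝓢(ℝ, ℂ)`. -/
abbrev sderiv : 𝓢(ℝ, ℂ) →L[ℂ] 𝓢(ℝ, ℂ) := derivCLM ℂ ℂ

lemma hasDerivAt_sderiv (f : 𝓢(ℝ, ℂ)) (x : ℝ) : HasDerivAt f (sderiv f x) x := by
  rw [derivCLM_apply]; exact f.hasDerivAt x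

lemma hasDerivAt_sderiv_pow (f : 𝓢(ℝ, ℂ)) (j : ℕ) (x : ℝ) :
    HasDerivAt ((sderiv ^ j) f) ((sderiv ^ (j + 1)) f x) x := by
  rw [pow_succ']; exact hasDerivAt_sderiv _ x

/-- A sequence of functions, each of which is the derivative of the preceding one. -/
def IsDerivSeq (H : ℕ → ℝ → ℂ) : Prop := ∀ j x, HasDerivAt (H j) (H (j + 1) x) x

lemma IsDerivSeq.iteratedDeriv_eq {H : ℕ → ℝ → ℂ} (h : IsDerivSeq H) (j : ℕ) :
    iteratedDeriv j (H 0) = H j := by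
  induction j with
  | zero => simp
  | succ j ih => rw [iteratedDeriv_succ, ih]; exact funext fun x => (h j x).deriv

lemma IsDerivSeq.contDiff {H : ℕ → ℝ → ℂ} (h : IsDerivSeq H) : ContDiff ℝ ∞ (H 0) := by
  refine contDiff_of_differentiable_iteratedDeriv fun m _ => ?_
  rw [h.iteratedDeriv_eq]
  exact fun x => (h m x).differentiableAt

lemma isDerivSeq_schwartz (f : 𝓢(ℝ, ℂ)) : IsDerivSeq fun j => (sderiv ^ j) f :=
  fun j x => hasDerivAt_sderiv_pow f j x

lemma iteratedDeriv_schwartz (f : 𝓢(ℝ, ℂ)) (j : ℕ) : iteratedDeriv j f = (sderiv ^ j) f :=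
  (isDerivSeq_schwartz f).iteratedDeriv_eq j

/-- A continuous linear operator on `𝓢(ℝ, ℂ)` from bounds for all derivatives of its values. -/
def clmOfDerivSeq (H : 𝓢(ℝ, ℂ) → ℕ → ℝ → ℂ)
    (hadd : ∀ f g x, H (f + g) 0 x = H f 0 x + H g 0 x)
    (hsmul : ∀ (a : ℂ) f x, H (a • f) 0 x = a • H f 0 x)
    (hder : ∀ f, IsDerivSeq (H f))
    (hbd : ∀ k j : ℕ, ∃ q : Seminorm ℂ 𝓢(ℝ, ℂ), Continuous q ∧
      ∀ f x, |x| ^ k * ‖H f j x‖ ≤ q f) : 𝓢(ℝ, ℂ) →L[ℂ] 𝓢(ℝ, ℂ) :=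
  mkCLM (σ := RingHom.id ℂ) (fun f => H f 0) hadd hsmul (fun f => (hder f).contDiff) <| by
    rintro ⟨k, j⟩
    obtain ⟨q, hq, h⟩ := hbd k j
    obtain ⟨s, C, -, hC⟩ := Seminorm.bound_of_continuous (schwartz_withSeminorms ℂ ℝ ℂ) q hq
    refine ⟨s, C, C.2, fun f x => ?_⟩
    rw [norm_iteratedFDeriv_eq_norm_iteratedDeriv, (hder f).iteratedDeriv_eq, Real.norm_eq_abs]
    exact (h f x).trans (hC f)

/-- The seminorm `f ↦ sup |x|^k |(T f)^(m)(x)|`. -/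
def seminormComp (k m : ℕ) (T : 𝓢(ℝ, ℂ) →L[ℂ] 𝓢(ℝ, ℂ)) : Seminorm ℂ 𝓢(ℝ, ℂ) :=
  (SchwartzMap.seminorm ℂ k m).comp T.toLinearMap

lemma continuous_seminormComp (k m : ℕ) (T : 𝓢(ℝ, ℂ) →L[ℂ] 𝓢(ℝ, ℂ)) :
    Continuous (seminormComp k m T) :=
  ((schwartz_withSeminorms ℂ ℝ ℂ).continuous_seminorm (k, m)).comp T.continuous

lemma pow_mul_norm_le_seminormComp (k : ℕ) (T : 𝓢(ℝ, ℂ) →L[ℂ] 𝓢(ℝ, ℂ)) (f : 𝓢(ℝ, ℂ)) (x : ℝ) :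
    |x| ^ k * ‖T f x‖ ≤ seminormComp k 0 T f :=
  norm_pow_mul_le_seminorm ℂ (T f) k x

/-! ### Division by the coordinate -/

/-- A compactly supported smooth function on `ℝ` with value `1` at `0`. -/
def bump0 : 𝓢(ℝ, ℂ) :=
  let b : ContDiffBump (0 : ℝ) := ⟨1, 2, one_pos, one_lt_two⟩
  (b.hasCompactSupport.comp_left (g := ((↑) : ℝ → ℂ)) Complex.ofReal_zero).toSchwartzMap
    (Complex.ofRealCLM.contDiff.comp b.contDiff)

lemma bump0_zero : bump0 0 = 1 := by
  change (((⟨1, 2, one_pos, one_lt_two⟩ : ContDiffBump (0 : ℝ)) 0 : ℝ) : ℂ) = 1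
  simp [ContDiffBump.one_of_mem_closedBall]

/-- `f ↦ f - f(0) χ`. -/
def subBump : 𝓢(ℝ, ℂ) →L[ℂ] 𝓢(ℝ, ℂ) :=
  ContinuousLinearMap.id ℂ _ -
    (((BoundedContinuousFunction.evalCLM ℂ (0 : ℝ)).comp
      (toBoundedContinuousFunctionCLM ℂ ℝ ℂ)).smulRight bump0)

lemma subBump_apply (f : 𝓢(ℝ, ℂ)) (x : ℝ) : subBump f x = f x - f 0 * bump0 x := by
  simp [subBump]

lemma subBump_apply_zero (f : 𝓢(ℝ, ℂ)) : subBump f 0 = 0 := by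
  simp [subBump_apply, bump0_zero]

lemma subBump_of_apply_zero {f : 𝓢(ℝ, ℂ)} (h : f 0 = 0) : subBump f = f := by
  ext x; simp [subBump_apply, h]

/-- The derivatives of `x ↦ ∫₀¹ ψ'(tx) dt`. -/
def divSeq (ψ : 𝓢(ℝ, ℂ)) (j : ℕ) (x : ℝ) : ℂ :=
  ∫ t in (0 : ℝ)..1, (t : ℂ) ^ j * (sderiv ^ (j + 1)) ψ (t * x)

lemma divSeq_integrable (ψ : 𝓢(ℝ, ℂ)) (j : ℕ) (x : ℝ) :
    IntervalIntegrable (fun t : ℝ => (t : ℂ) ^ j * (sderiv ^ (j + 1)) ψ (t * x)) volume 0 1 := by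
  apply Continuous.intervalIntegrable
  have := ((sderiv ^ (j + 1)) ψ).continuous
  fun_prop

lemma isDerivSeq_divSeq (ψ : 𝓢(ℝ, ℂ)) : IsDerivSeq (divSeq ψ) := by
  intro j x
  have hc := ((sderiv ^ (j + 1)) ψ).continuous
  have hc' := ((sderiv ^ (j + 2)) ψ).continuous
  refine (intervalIntegral.hasDerivAt_integral_of_dominated_loc_of_deriv_le
    (F := fun x t => (t : ℂ) ^ j * (sderiv ^ (j + 1)) ψ (t * x))
    (F' := fun x t => (t : ℂ) ^ (j + 1) * (sderiv ^ (j + 2)) ψ (t * x))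
    (bound := fun _ => SchwartzMap.seminorm ℂ 0 0 ((sderiv ^ (j + 2)) ψ))
    (s := Set.univ) Filter.univ_mem ?_ (divSeq_integrable ψ j x) ?_ ?_ ?_ ?_).2
  · refine .of_forall fun y => Continuous.aestronglyMeasurable ?_
    fun_prop
  · refine Continuous.aestronglyMeasurable ?_
    fun_prop
  · refine .of_forall fun t ht y _ => ?_
    rw [Set.uIoc_of_le zero_le_one] at ht
    rw [norm_mul, norm_pow, Complex.norm_real, Real.norm_of_nonneg ht.1.le]
    calc _ ≤ 1 * ‖(sderiv ^ (j + 2)) ψ (t * y)‖ := by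
            gcongr; exact pow_le_one₀ ht.1.le ht.2
      _ ≤ _ := by rw [one_mul]; exact norm_le_seminorm ℂ _ _
  · exact intervalIntegrable_const
  · refine .of_forall fun t _ y _ => ?_
    have h : HasDerivAt (fun y => (sderiv ^ (j + 1)) ψ (t * y)) _ y :=
      (hasDerivAt_sderiv_pow ψ (j + 1) (t * y)).scomp y ((hasDerivAt_id y).const_mul t)
    refine (h.const_mul ((t : ℂ) ^ j)).congr_deriv ?_
    simp only [mul_one, Complex.real_smul, pow_succ]; ring

lemma norm_divSeq_le (ψ : 𝓢(ℝ, ℂ)) (j : ℕ) (x : ℝ) :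
    ‖divSeq ψ j x‖ ≤ SchwartzMap.seminorm ℂ 0 0 ((sderiv ^ (j + 1)) ψ) := by
  have := intervalIntegral.norm_integral_le_of_norm_le_const (a := (0 : ℝ)) (b := 1)
    (f := fun t : ℝ => (t : ℂ) ^ j * (sderiv ^ (j + 1)) ψ (t * x))
    (C := SchwartzMap.seminorm ℂ 0 0 ((sderiv ^ (j + 1)) ψ)) (fun t ht => ?_)
  · simpa [divSeq] using this
  · rw [Set.uIoc_of_le zero_le_one] at ht
    rw [norm_mul, norm_pow, Complex.norm_real, Real.norm_of_nonneg ht.1.le]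
    calc _ ≤ 1 * ‖(sderiv ^ (j + 1)) ψ (t * x)‖ := by
            gcongr; exact pow_le_one₀ ht.1.le ht.2
      _ ≤ _ := by rw [one_mul]; exact norm_le_seminorm ℂ _ _

/-- Hadamard's lemma: the fundamental theorem of calculus for t ↦ ψ(tx) on [0, 1]. -/
lemma mul_divSeq_zero (ψ : 𝓢(ℝ, ℂ)) (h0 : ψ 0 = 0) (x : ℝ) : x * divSeq ψ 0 x = ψ x := by
  have h : ∀ t ∈ Set.uIcc (0 : ℝ) 1,
      HasDerivAt (fun t : ℝ => ψ (t * x)) (x * (sderiv ^ 1) ψ (t * x)) t := by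
    intro t _
    have h : HasDerivAt (fun t : ℝ => ψ (t * x)) _ t :=
      (hasDerivAt_sderiv ψ (t * x)).scomp t ((hasDerivAt_id t).mul_const x)
    exact h.congr_deriv (by rw [one_mul, pow_one, Complex.real_smul])
  have h2 := intervalIntegral.integral_eq_sub_of_hasDerivAt h (by
    apply Continuous.intervalIntegrable
    have := ((sderiv ^ 1) ψ).continuous
    fun_prop)
  rw [divSeq, ← intervalIntegral.integral_const_mul]
  simpa [h0] using h2

/-- Differentiating x · H₀ = ψ repeatedly gives this recursion. It trades a power of x for a lower
index, which is the source of the decay below. -/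
lemma mul_divSeq_succ (ψ : 𝓢(ℝ, ℂ)) (h0 : ψ 0 = 0) (j : ℕ) (x : ℝ) :
    x * divSeq ψ (j + 1) x + (j + 1) * divSeq ψ j x = (sderiv ^ (j + 1)) ψ x := by
  induction j generalizing x with
  | zero =>
    have h1 := ((hasDerivAt_id x).ofReal_comp).mul (isDerivSeq_divSeq ψ 0 x)
    have h2 : HasDerivAt ψ (sderiv ψ x) x := hasDerivAt_sderiv ψ x
    have h3 := h1.congr_of_eventuallyEq (f₁ := ψ)
      (.of_forall fun y => (mul_divSeq_zero ψ h0 y).symm)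
    have := h3.unique h2
    simp at this ⊢
    rw [← this]; ring
  | succ j ih =>
    have h1 := (((hasDerivAt_id x).ofReal_comp).mul (isDerivSeq_divSeq ψ (j + 1) x)).add
      ((isDerivSeq_divSeq ψ j x).const_mul ((j : ℂ) + 1))
    have h3 := h1.congr_of_eventuallyEq (f₁ := (sderiv ^ (j + 1)) ψ)
      (.of_forall fun y => (ih y).symm)
    have := h3.unique (hasDerivAt_sderiv_pow ψ (j + 1) x)
    rw [← this]
    push_cast
    simp
    ring

/-- The integral itself only gives boundedness. Decay comes by induction on k: the recursion
expresses x · H_{j+1} by ψ^{(j+1)} and H_j, and x · H₀ is ψ. -/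
lemma exists_divSeq_bound (k j : ℕ) : ∃ q : Seminorm ℂ 𝓢(ℝ, ℂ), Continuous q ∧
    ∀ ψ : 𝓢(ℝ, ℂ), ψ 0 = 0 → ∀ x, |x| ^ k * ‖divSeq ψ j x‖ ≤ q ψ := by
  induction k generalizing j with
  | zero =>
    exact ⟨_, continuous_seminormComp 0 0 (sderiv ^ (j + 1)), fun ψ _ x => by
      rw [pow_zero, one_mul]; exact norm_divSeq_le ψ j x⟩
  | succ k ih =>
    cases j with
    | zero =>
      refine ⟨_, continuous_seminormComp k 0 (.id ℂ _), fun ψ h0 x => ?_⟩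
      have := pow_mul_norm_le_seminormComp k (.id ℂ _) ψ x
      rw [ContinuousLinearMap.id_apply, ← mul_divSeq_zero ψ h0 x, norm_mul, Complex.norm_real,
        Real.norm_eq_abs] at this
      simpa only [pow_succ, mul_assoc] using this
    | succ j =>
      obtain ⟨q, hq, h⟩ := ih j
      refine ⟨seminormComp k 0 (sderiv ^ (j + 1)) + (j + 1) • q,
        (continuous_seminormComp k 0 _).add ?_, fun ψ h0 x => ?_⟩
      · have e : ⇑((j + 1) • q) = fun f => ((j : ℝ) + 1) * q f := by
          ext f; simp
        rw [e]; exact continuous_const.mul hq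
      · have e : (x : ℂ) * divSeq ψ (j + 1) x =
            (sderiv ^ (j + 1)) ψ x - (j + 1) * divSeq ψ j x :=
          eq_sub_of_add_eq (mul_divSeq_succ ψ h0 j x)
        have e2 : |x| * ‖divSeq ψ (j + 1) x‖ ≤
            ‖(sderiv ^ (j + 1)) ψ x‖ + (j + 1) * ‖divSeq ψ j x‖ := by
          rw [← Real.norm_eq_abs, ← Complex.norm_real, ← norm_mul, e]
          refine (norm_sub_le _ _).trans_eq ?_
          rw [norm_mul]; norm_cast
        calc |x| ^ (k + 1) * ‖divSeq ψ (j + 1) x‖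
            = |x| ^ k * (|x| * ‖divSeq ψ (j + 1) x‖) := by ring
          _ ≤ |x| ^ k * (‖(sderiv ^ (j + 1)) ψ x‖ + (j + 1) * ‖divSeq ψ j x‖) := by gcongr
          _ = |x| ^ k * ‖(sderiv ^ (j + 1)) ψ x‖ + (j + 1) * (|x| ^ k * ‖divSeq ψ j x‖) := by ring
          _ ≤ seminormComp k 0 (sderiv ^ (j + 1)) ψ + (j + 1) * q ψ :=
              add_le_add (pow_mul_norm_le_seminormComp k _ ψ x)
                (mul_le_mul_of_nonneg_left (h ψ h0 x) (by positivity))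
          _ = _ := by
              change _ = seminormComp k 0 (sderiv ^ (j + 1)) ψ + (j + 1) • q ψ
              rw [nsmul_eq_mul]; push_cast; rfl

/-- The operator `f ↦ (f - f(0) χ) / x` on Schwartz functions. -/
def divX : 𝓢(ℝ, ℂ) →L[ℂ] 𝓢(ℝ, ℂ) :=
  clmOfDerivSeq (fun f => divSeq (subBump f))
    (fun f g x => by
      simp only [divSeq, map_add]
      rw [← intervalIntegral.integral_add (divSeq_integrable _ _ _) (divSeq_integrable _ _ _)]
      simp [mul_add])
    (fun a f x => by
      simp only [divSeq, map_smul]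
      rw [← intervalIntegral.integral_smul]
      simp)
    (fun f => isDerivSeq_divSeq _)
    (fun k j => by
      obtain ⟨q, hq, h⟩ := exists_divSeq_bound k j
      exact ⟨q.comp (subBump : 𝓢(ℝ, ℂ) →ₗ[ℂ] 𝓢(ℝ, ℂ)), hq.comp subBump.continuous,
        fun f x => h _ (subBump_apply_zero f) x⟩)

lemma mul_divX {f : 𝓢(ℝ, ℂ)} (h : f 0 = 0) (x : ℝ) : x * divX f x = f x := by
  change x * divSeq (subBump f) 0 x = f x
  rw [subBump_of_apply_zero h, mul_divSeq_zero f h]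

/-- The recursion at x = 0. One division thus lowers the order of vanishing by exactly one. -/
lemma sderiv_pow_divX_zero {f : 𝓢(ℝ, ℂ)} (h : f 0 = 0) (j : ℕ) :
    (j + 1) * (sderiv ^ j) (divX f) 0 = (sderiv ^ (j + 1)) f 0 := by
  have e : (sderiv ^ j) (divX f) 0 = divSeq f j 0 := by
    rw [← iteratedDeriv_schwartz]
    change iteratedDeriv j (divSeq (subBump f) 0) 0 = _
    rw [subBump_of_apply_zero h, (isDerivSeq_divSeq f).iteratedDeriv_eq]
  rw [e, ← mul_divSeq_succ f h j 0]
  simp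

end
end MotionGroup
namespace MotionGroup
open scoped FourierTransform ContDiff

noncomputable section

/-! ### A smooth function `c` with `c(x²) = cos x` -/

/-- The entire function `∑ (-1)^k s^k / (2k)!`, which is `cos √s` for `s ≥ 0`. -/
def cosSqrt : ℝ → ℝ :=
  (FormalMultilinearSeries.ofScalars ℝ fun k : ℕ => ((-1 : ℝ) ^ k / (2 * k).factorial)).sum

/-- The ratio test gives infinite radius of convergence, so the sum is analytic on all of ℝ,
negative arguments included. -/
lemma contDiff_cosSqrt : ContDiff ℝ ∞ cosSqrt := by
  have hr : (FormalMultilinearSeries.ofScalars ℝ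
      fun k : ℕ => ((-1 : ℝ) ^ k / (2 * k).factorial)).radius = ⊤ := by
    refine FormalMultilinearSeries.ofScalars_radius_eq_top_of_tendsto ℝ _
      (.of_forall fun n => by positivity) ?_
    have h : Filter.Tendsto (fun n : ℕ => 1 / ((n : ℝ) + 1)) Filter.atTop (nhds 0) :=
      tendsto_one_div_add_atTop_nhds_zero_nat
    refine squeeze_zero (fun n => by positivity) (fun n => ?_) h
    rw [norm_div, norm_div, norm_pow, norm_pow, norm_neg, norm_one, one_pow, one_pow,
      div_div_div_eq, one_mul, mul_one, Real.norm_natCast, Real.norm_natCast,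
      show 2 * n.succ = 2 * n + 1 + 1 by simp; ring, Nat.factorial_succ, Nat.factorial_succ]
    rw [div_le_div_iff₀ (by positivity) (by positivity)]
    push_cast
    have : (0 : ℝ) < (2 * n).factorial := by positivity
    have hn : (0 : ℝ) ≤ n := by positivity
    nlinarith [mul_nonneg this.le hn, mul_nonneg (mul_nonneg this.le hn) hn]
  have := (FormalMultilinearSeries.ofScalars ℝ
      fun k : ℕ => ((-1 : ℝ) ^ k / (2 * k).factorial)).hasFPowerSeriesOnBall (by simp [hr])
  rw [hr] at this
  have h2 := this.analyticOnNhd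
  simp only [Metric.eball_top] at h2
  exact (contDiffOn_univ.1 (h2.contDiffOn (uniqueDiffOn_univ))) 

lemma cosSqrt_sq (x : ℝ) : cosSqrt (x ^ 2) = Real.cos x := by
  have h := (Real.hasSum_cos x).tsum_eq
  rw [← h]
  change FormalMultilinearSeries.ofScalarsSum _ _ = _
  rw [FormalMultilinearSeries.ofScalars_sum_eq]
  refine tsum_congr fun k => ?_
  rw [smul_eq_mul, ← pow_mul]; ring

lemma hasDerivAt_iteratedDeriv {f : ℝ → ℝ} (hf : ContDiff ℝ ∞ f) (m : ℕ) (s : ℝ) :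
    HasDerivAt (iteratedDeriv m f) (iteratedDeriv (m + 1) f s) s := by
  rw [iteratedDeriv_succ]
  exact ((hf.differentiable_iteratedDeriv m (mod_cast WithTop.coe_lt_top _)) s).hasDerivAt

/-- Differentiate c(x²) = cos x twice and put x = √s. -/
lemma cosSqrt_ode_zero {s : ℝ} (hs : 0 < s) :
    4 * s * iteratedDeriv 2 cosSqrt s + 2 * iteratedDeriv 1 cosSqrt s + cosSqrt s = 0 := by
  have key1 : ∀ x : ℝ, 2 * x * iteratedDeriv 1 cosSqrt (x ^ 2) = -Real.sin x := fun x => by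
    have h := (hasDerivAt_iteratedDeriv contDiff_cosSqrt 0 (x ^ 2)).comp x (hasDerivAt_pow 2 x)
    have h2 := (Real.hasDerivAt_cos x).congr_of_eventuallyEq (f₁ := fun x => cosSqrt (x ^ 2))
      (.of_forall fun y => cosSqrt_sq y)
    have := h.unique h2
    rw [← this]; push_cast; ring
  have key2 : ∀ x : ℝ, 2 * iteratedDeriv 1 cosSqrt (x ^ 2) +
      2 * x * (iteratedDeriv 2 cosSqrt (x ^ 2) * (2 * x)) = -Real.cos x := fun x => by
    have h := ((hasDerivAt_id x).const_mul 2).mul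
      ((hasDerivAt_iteratedDeriv contDiff_cosSqrt 1 (x ^ 2)).comp x (hasDerivAt_pow 2 x))
    have h2 := (Real.hasDerivAt_sin x).neg.congr_of_eventuallyEq
      (f₁ := fun x => 2 * x * iteratedDeriv 1 cosSqrt (x ^ 2))
      (.of_forall fun y => key1 y)
    have := h.unique h2
    rw [← this]; simp
  have h := key2 (Real.sqrt s)
  have h2 := cosSqrt_sq (Real.sqrt s)
  rw [Real.sq_sqrt hs.le] at h h2
  rw [← h2] at h
  have h3 : Real.sqrt s * Real.sqrt s = s := Real.mul_self_sqrt hs.le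
  linear_combination h - 4 * iteratedDeriv 2 cosSqrt s * h3

lemma cosSqrt_ode (m : ℕ) {s : ℝ} (hs : 0 < s) :
    4 * s * iteratedDeriv (m + 2) cosSqrt s + (4 * m + 2) * iteratedDeriv (m + 1) cosSqrt s +
      iteratedDeriv m cosSqrt s = 0 := by
  induction m generalizing s with
  | zero => simpa using cosSqrt_ode_zero hs
  | succ m ih =>
    have hd := fun m => hasDerivAt_iteratedDeriv contDiff_cosSqrt m s
    have h := ((((hasDerivAt_id s).const_mul 4).mul (hd (m + 2))).add
      ((hd (m + 1)).const_mul (4 * (m : ℝ) + 2))).add (hd m)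
    have h2 := (hasDerivAt_const s (0 : ℝ)).congr_of_eventuallyEq
      (f₁ := fun s => 4 * s * iteratedDeriv (m + 2) cosSqrt s +
        (4 * m + 2) * iteratedDeriv (m + 1) cosSqrt s + iteratedDeriv m cosSqrt s)
      ((lt_mem_nhds hs).mono fun t ht => ih ht)
    have := h.unique h2
    simp only [id, mul_one] at this
    push_cast
    linear_combination this

/-- Energy argument. With c_m the m-th derivative, E = c_m² + 4s c_{m+1}² satisfies E' = -8m
c_{m+1}² ≤ 0 by the differential equation, so c_m(s)² ≤ E(s) ≤ E(0) = c_m(0)². -/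
lemma abs_iteratedDeriv_cosSqrt_le (m : ℕ) {s : ℝ} (hs : 0 ≤ s) :
    |iteratedDeriv m cosSqrt s| ≤ |iteratedDeriv m cosSqrt 0| := by
  let E : ℝ → ℝ := fun s => iteratedDeriv m cosSqrt s ^ 2 +
    4 * s * iteratedDeriv (m + 1) cosSqrt s ^ 2
  have hd : ∀ s, HasDerivAt E (2 * iteratedDeriv m cosSqrt s * iteratedDeriv (m + 1) cosSqrt s +
      (4 * iteratedDeriv (m + 1) cosSqrt s ^ 2 + 4 * s * (2 * iteratedDeriv (m + 1) cosSqrt s *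
        iteratedDeriv (m + 2) cosSqrt s))) s := fun s => by
    have hd := fun m => hasDerivAt_iteratedDeriv contDiff_cosSqrt m s
    refine (((hd m).pow 2).add (((hasDerivAt_id s).const_mul 4).mul ((hd (m + 1)).pow 2))).congr_deriv
      ?_
    simp
  have hanti : AntitoneOn E (Set.Ici 0) := by
    refine antitoneOn_of_deriv_nonpos (convex_Ici 0)
      (fun x _ => (hd x).continuousAt.continuousWithinAt)
      (fun x _ => (hd x).differentiableAt.differentiableWithinAt) fun x hx => ?_
    rw [interior_Ici, Set.mem_Ioi] at hx
    rw [(hd x).deriv]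
    have := cosSqrt_ode m hx
    have e : 2 * iteratedDeriv m cosSqrt x * iteratedDeriv (m + 1) cosSqrt x +
      (4 * iteratedDeriv (m + 1) cosSqrt x ^ 2 + 4 * x * (2 * iteratedDeriv (m + 1) cosSqrt x *
        iteratedDeriv (m + 2) cosSqrt x)) = -(8 * m * iteratedDeriv (m + 1) cosSqrt x ^ 2) := by
      linear_combination 2 * iteratedDeriv (m + 1) cosSqrt x * this
    rw [e]
    have : 0 ≤ 8 * (m : ℝ) * iteratedDeriv (m + 1) cosSqrt x ^ 2 := by positivity
    linarith
  have h := hanti (Set.mem_Ici.2 le_rfl) (Set.mem_Ici.2 hs) hs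
  refine sq_le_sq.1 ?_
  have h2 : 0 ≤ 4 * s * iteratedDeriv (m + 1) cosSqrt s ^ 2 := by positivity
  simp only [E] at h
  linarith

/-- The smooth function that is `1` on `[0, ∞)` and `0` on `(-∞, -1]`. -/
def cutoff (s : ℝ) : ℝ := Real.smoothTransition (s + 1)

lemma contDiff_cutoff : ContDiff ℝ ∞ cutoff :=
  Real.smoothTransition.contDiff.comp (contDiff_id.add contDiff_const)

lemma cutoff_of_nonneg {s : ℝ} (hs : 0 ≤ s) : cutoff s = 1 :=
  Real.smoothTransition.one_of_one_le (by linarith)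

lemma cutoff_of_le {s : ℝ} (hs : s ≤ -1) : cutoff s = 0 :=
  Real.smoothTransition.zero_of_nonpos (by linarith)

/-- A function which is `0` on `(-∞,-1]` has bounded derivatives if they are bounded on
`(0, ∞)`. -/
lemma exists_bound_iteratedDeriv {f : ℝ → ℝ} (hf : ContDiff ℝ ∞ f) (h0 : ∀ s ≤ -1, f s = 0) (m : ℕ)
    {K : ℝ} (hK : ∀ s > 0, |iteratedDeriv m f s| ≤ K) : ∃ K, ∀ s, |iteratedDeriv m f s| ≤ K := by
  have hc : Continuous (iteratedDeriv m f) := hf.continuous_iteratedDeriv m (mod_cast le_top)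
  obtain ⟨K', hK'⟩ := (isCompact_Icc (a := (-1 : ℝ)) (b := 0)).exists_bound_of_continuousOn
    hc.continuousOn
  refine ⟨max K' K, fun s => ?_⟩
  rcases lt_or_ge s (-1) with h | h
  · have : iteratedDeriv m f s = iteratedDeriv m (fun _ => (0 : ℝ)) s :=
      Filter.EventuallyEq.iteratedDeriv_eq m ((gt_mem_nhds h).mono fun t ht => h0 t ht.le)
    have h1 := hK' (-1) (by simp)
    rw [this]
    simp only [iteratedDeriv_const]
    refine le_max_of_le_left ((norm_nonneg _).trans h1 |>.trans' ?_)
    split_ifs <;> simp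
  · rcases le_or_gt s 0 with h' | h'
    · exact le_max_of_le_left (hK' s ⟨h, h'⟩)
    · exact le_max_of_le_right (hK s h')

lemma exists_bound_cutoff (m : ℕ) : ∃ K, ∀ s, |iteratedDeriv m cutoff s| ≤ K := by
  refine exists_bound_iteratedDeriv contDiff_cutoff (fun s => cutoff_of_le) m (K := 1) fun s hs => ?_
  have : iteratedDeriv m cutoff s = iteratedDeriv m (fun _ => (1 : ℝ)) s :=
      Filter.EventuallyEq.iteratedDeriv_eq m ((lt_mem_nhds hs).mono fun t ht => cutoff_of_nonneg ht.le)
  rw [this, iteratedDeriv_const]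
  split_ifs <;> simp

/-- A smooth function with bounded derivatives and `cosKernel (x²) = cos (2πx)`. -/
def cosKernel (s : ℝ) : ℝ := cutoff s * cosSqrt ((2 * Real.pi) ^ 2 * s)

lemma contDiff_cosKernel : ContDiff ℝ ∞ cosKernel :=
  contDiff_cutoff.mul (contDiff_cosSqrt.comp (contDiff_const.mul contDiff_id))

lemma cosKernel_sq (x : ℝ) : cosKernel (x ^ 2) = Real.cos (2 * Real.pi * x) := by
  rw [cosKernel, cutoff_of_nonneg (sq_nonneg x), ← mul_pow, cosSqrt_sq, one_mul]

lemma exists_bound_cosKernel (m : ℕ) : ∃ K, ∀ s, |iteratedDeriv m cosKernel s| ≤ K := by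
  refine exists_bound_iteratedDeriv contDiff_cosKernel
    (fun s hs => by rw [cosKernel, cutoff_of_le hs, zero_mul]) m
    (K := |((2 * Real.pi) ^ 2) ^ m| * |iteratedDeriv m cosSqrt 0|) fun s hs => ?_
  have : iteratedDeriv m cosKernel s = iteratedDeriv m (fun s => cosSqrt ((2 * Real.pi) ^ 2 * s)) s :=
      Filter.EventuallyEq.iteratedDeriv_eq m ((lt_mem_nhds hs).mono fun t ht => by
        simp [cosKernel, cutoff_of_nonneg (le_of_lt ht)])
  rw [this, iteratedDeriv_comp_const_mul (contDiff_cosSqrt.of_le (mod_cast le_top)), abs_mul]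
  exact mul_le_mul_of_nonneg_left (abs_iteratedDeriv_cosSqrt_le m (by positivity)) (abs_nonneg _)

end
end MotionGroup
namespace MotionGroup
open scoped FourierTransform ContDiff

noncomputable section

/-! ### Even Schwartz functions are Schwartz functions of the square -/

/-- The even part of a Schwartz function. -/
def evenPart : 𝓢(ℝ, ℂ) →L[ℂ] 𝓢(ℝ, ℂ) :=
  (1 / 2 : ℂ) • (ContinuousLinearMap.id ℂ _ +
    compCLMOfContinuousLinearEquiv ℂ (ContinuousLinearEquiv.neg ℝ (M := ℝ)))

lemma evenPart_apply (f : 𝓢(ℝ, ℂ)) (x : ℝ) : evenPart f x = (f x + f (-x)) / 2 := by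
  simp [evenPart, compCLMOfContinuousLinearEquiv]; ring

/-- The operator `(1/2x) d/dx`, the derivative with respect to `x²`. -/
def derivSq : 𝓢(ℝ, ℂ) →L[ℂ] 𝓢(ℝ, ℂ) := (1 / 2 : ℂ) • divX.comp sderiv

lemma sderiv_odd {f : 𝓢(ℝ, ℂ)} (hf : ∀ x, f (-x) = f x) (x : ℝ) : sderiv f (-x) = -sderiv f x := by
  have h : HasDerivAt (fun x => f (-x)) _ x :=
    (hasDerivAt_sderiv f (-x)).scomp x (hasDerivAt_neg x)
  have h2 := h.congr_of_eventuallyEq (f₁ := f) (.of_forall fun y => (hf y).symm)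
  have := h2.unique (hasDerivAt_sderiv f x)
  rw [← this]; simp

lemma sderiv_zero_of_even {f : 𝓢(ℝ, ℂ)} (hf : ∀ x, f (-x) = f x) : sderiv f 0 = 0 := by
  have h := sderiv_odd hf 0
  rw [neg_zero] at h
  linear_combination h / 2

/-- The derivative of an even function is odd, hence zero at 0, so `divX` divides it exactly. -/
lemma mul_derivSq {f : 𝓢(ℝ, ℂ)} (hf : ∀ x, f (-x) = f x) (x : ℝ) :
    2 * x * derivSq f x = sderiv f x := by
  have h := mul_divX (sderiv_zero_of_even hf) x
  have e : derivSq f x = 1 / 2 * divX (sderiv f) x := rfl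
  rw [e, ← h]; ring

lemma derivSq_even {f : 𝓢(ℝ, ℂ)} (hf : ∀ x, f (-x) = f x) (x : ℝ) :
    derivSq f (-x) = derivSq f x := by
  rcases eq_or_ne x 0 with rfl | hx
  · simp
  · have h1 := mul_derivSq hf x
    have h2 := mul_derivSq hf (-x)
    rw [sderiv_odd hf, ← h1] at h2
    push_cast at h2
    have hx' : (x : ℂ) ≠ 0 := Complex.ofReal_ne_zero.2 hx
    have : 2 * (x : ℂ) * (derivSq f (-x) - derivSq f x) = 0 := by linear_combination -h2
    simpa [hx', sub_eq_zero] using this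

lemma derivSq_pow_even {f : 𝓢(ℝ, ℂ)} (hf : ∀ x, f (-x) = f x) (m : ℕ) (x : ℝ) :
    (derivSq ^ m) f (-x) = (derivSq ^ m) f x := by
  induction m generalizing x with
  | zero => exact hf x
  | succ m ih => rw [pow_succ']; exact derivSq_even ih x

/-- The derivatives of `s ↦ ∫ φ(ξ) C(s ξ²) dξ`, `C(x²) = cos (2πx)`. -/
def sqSeq (φ : 𝓢(ℝ, ℂ)) (m : ℕ) (s : ℝ) : ℂ :=
  ∫ ξ : ℝ, φ ξ * ((ξ ^ 2) ^ m * iteratedDeriv m cosKernel (s * ξ ^ 2) : ℝ)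

lemma continuous_iteratedDeriv_cosKernel (m : ℕ) : Continuous (iteratedDeriv m cosKernel) :=
  contDiff_cosKernel.continuous_iteratedDeriv m (mod_cast le_top)

lemma norm_sqSeq_integrand_le (φ : 𝓢(ℝ, ℂ)) (m : ℕ) {K : ℝ}
    (hK : ∀ s, |iteratedDeriv m cosKernel s| ≤ K) (s ξ : ℝ) :
    ‖φ ξ * ((ξ ^ 2) ^ m * iteratedDeriv m cosKernel (s * ξ ^ 2) : ℝ)‖ ≤
      K * (‖ξ‖ ^ (2 * m) * ‖φ ξ‖) := by
  rw [norm_mul, Complex.norm_real, norm_mul, Real.norm_eq_abs (iteratedDeriv _ _ _), norm_pow,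
    norm_pow, ← pow_mul]
  calc _ = |iteratedDeriv m cosKernel (s * ξ ^ 2)| * (‖ξ‖ ^ (2 * m) * ‖φ ξ‖) := by ring
    _ ≤ _ := by gcongr; exact hK _

lemma sqSeq_integrable (φ : 𝓢(ℝ, ℂ)) (m : ℕ) (s : ℝ) :
    Integrable fun ξ : ℝ => φ ξ * ((ξ ^ 2) ^ m * iteratedDeriv m cosKernel (s * ξ ^ 2) : ℝ) := by
  obtain ⟨K, hK⟩ := exists_bound_cosKernel m
  refine ((φ.integrable_pow_mul volume (2 * m)).const_mul K).mono' ?_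
    (.of_forall fun ξ => norm_sqSeq_integrand_le φ m hK s ξ)
  have := continuous_iteratedDeriv_cosKernel m
  have := φ.continuous
  exact Continuous.aestronglyMeasurable (by fun_prop)

lemma isDerivSeq_sqSeq (φ : 𝓢(ℝ, ℂ)) : IsDerivSeq (sqSeq φ) := by
  intro m s
  obtain ⟨K, hK⟩ := exists_bound_cosKernel (m + 1)
  refine (hasDerivAt_integral_of_dominated_loc_of_deriv_le (s := Set.univ)
    (F := fun s ξ => φ ξ * ((ξ ^ 2) ^ m * iteratedDeriv m cosKernel (s * ξ ^ 2) : ℝ))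
    (F' := fun s ξ => φ ξ * ((ξ ^ 2) ^ (m + 1) * iteratedDeriv (m + 1) cosKernel (s * ξ ^ 2) : ℝ))
    Filter.univ_mem (.of_forall fun s => (sqSeq_integrable φ m s).aestronglyMeasurable)
    (sqSeq_integrable φ m s) (sqSeq_integrable φ (m + 1) s).aestronglyMeasurable
    (.of_forall fun ξ s _ => norm_sqSeq_integrand_le φ (m + 1) hK s ξ)
    ((φ.integrable_pow_mul volume (2 * (m + 1))).const_mul K) (.of_forall fun ξ s _ => ?_)).2
  have h : HasDerivAt (fun s => iteratedDeriv m cosKernel (s * ξ ^ 2)) _ s :=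
    (hasDerivAt_iteratedDeriv contDiff_cosKernel m (s * ξ ^ 2)).comp
      (h := fun s => s * ξ ^ 2) s ((hasDerivAt_id s).mul_const (ξ ^ 2))
  refine ((h.const_mul ((ξ ^ 2) ^ m)).ofReal_comp.const_mul (φ ξ)).congr_deriv ?_
  push_cast; ring

lemma exists_sqSeq_bound (m : ℕ) : ∃ K, 0 ≤ K ∧ ∀ (φ : 𝓢(ℝ, ℂ)) s, ‖sqSeq φ m s‖ ≤
    K * (SchwartzMap.seminorm ℂ 0 0 φ + SchwartzMap.seminorm ℂ
      (2 * m + (volume : Measure ℝ).integrablePower) 0 φ) := by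
  obtain ⟨K, hK⟩ := exists_bound_cosKernel m
  have hK0 : 0 ≤ K := (abs_nonneg _).trans (hK 0)
  refine ⟨K * (2 ^ (volume : Measure ℝ).integrablePower *
      (∫ x : ℝ, (1 + ‖x‖) ^ (- ((volume : Measure ℝ).integrablePower : ℝ)))),
    mul_nonneg hK0 (mul_nonneg (by positivity) (integral_nonneg fun x => by positivity)),
    fun φ s => ?_⟩
  have h := integral_pow_mul_iteratedFDeriv_le ℂ volume φ (2 * m) 0
  simp only [norm_iteratedFDeriv_zero] at h
  refine (norm_integral_le_of_norm_le ((φ.integrable_pow_mul volume (2 * m)).const_mul K)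
    (.of_forall fun ξ => norm_sqSeq_integrand_le φ m hK s ξ)).trans ?_
  rw [integral_const_mul, mul_assoc]
  exact mul_le_mul_of_nonneg_left h hK0

/-- Fourier inversion at x and -x: the mean of the two exponentials is cos(2πxξ), which is the
kernel at x²ξ². -/
lemma sqSeq_fourier_zero (φ : 𝓢(ℝ, ℂ)) (x : ℝ) : sqSeq (𝓕 φ) 0 (x ^ 2) = evenPart φ x := by
  have inv : ∀ x : ℝ, φ x = ∫ ξ : ℝ, 𝓕 φ ξ * Complex.exp (2 * Real.pi * ξ * x * Complex.I) := by
    intro x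
    have h := congrArg (fun f : 𝓢(ℝ, ℂ) => f x)
      (FourierPair.fourierInv_fourier_eq (F := 𝓢(ℝ, ℂ)) φ)
    simp only [fourierInv_coe] at h
    rw [Real.fourierInv_eq'] at h
    rw [← h]
    refine integral_congr_ae (.of_forall fun ξ => ?_)
    simp [mul_comm]
    left; congr 1; ring
  have hint : ∀ x : ℝ, Integrable fun ξ : ℝ =>
      𝓕 φ ξ * Complex.exp (2 * Real.pi * ξ * x * Complex.I) := by
    intro x
    refine (𝓕 φ).integrable.mono ?_ (.of_forall fun ξ => ?_)
    · have := (𝓕 φ).continuous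
      exact Continuous.aestronglyMeasurable (by fun_prop)
    · rw [norm_mul, show (2 * Real.pi * ξ * x * Complex.I : ℂ) =
        ((2 * Real.pi * ξ * x : ℝ) : ℂ) * Complex.I by push_cast; ring,
        Complex.norm_exp_ofReal_mul_I, mul_one]
  rw [evenPart_apply, inv x, inv (-x), ← integral_add (hint x) (hint (-x)), ← integral_div]
  refine integral_congr_ae (.of_forall fun ξ => ?_)
  simp only [pow_zero, one_mul, iteratedDeriv_zero]
  rw [← mul_pow, cosKernel_sq, Complex.ofReal_cos, Complex.cos, ← mul_add, mul_div_assoc]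
  push_cast
  congr 5 <;> ring

/-- By the chain rule, d/ds at s = x² is (1/2x) d/dx; the point x = 0 follows by continuity. This
converts weights in s into Schwartz decay of a function of x. -/
lemma sqSeq_fourier (φ : 𝓢(ℝ, ℂ)) (m : ℕ) (x : ℝ) :
    sqSeq (𝓕 φ) m (x ^ 2) = (derivSq ^ m) (evenPart φ) x := by
  induction m generalizing x with
  | zero => exact sqSeq_fourier_zero φ x
  | succ m ih =>
    have hev : ∀ x, evenPart φ (-x) = evenPart φ x := fun x => by
      rw [evenPart_apply, evenPart_apply, neg_neg, add_comm]
    have key : ∀ x : ℝ, x ≠ 0 →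
        sqSeq (𝓕 φ) (m + 1) (x ^ 2) = (derivSq ^ (m + 1)) (evenPart φ) x := by
      intro x hx
      have h : HasDerivAt (fun x => sqSeq (𝓕 φ) m (x ^ 2)) _ x :=
        (isDerivSeq_sqSeq (𝓕 φ) m (x ^ 2)).scomp
          (g₁ := sqSeq (𝓕 φ) m) (h := fun x => x ^ 2) x (hasDerivAt_pow 2 x)
      have h2 := h.congr_of_eventuallyEq (f₁ := (derivSq ^ m) (evenPart φ))
        (.of_forall fun y => (ih y).symm)
      have h3 := h2.unique (hasDerivAt_sderiv _ x)
      rw [← mul_derivSq (derivSq_pow_even hev m) x] at h3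
      have hx' : (2 * x : ℂ) ≠ 0 := by simpa using hx
      have e : (derivSq ^ (m + 1)) (evenPart φ) x = derivSq ((derivSq ^ m) (evenPart φ)) x := by
        rw [pow_succ']; rfl
      rw [e]
      refine mul_left_cancel₀ hx' (Eq.trans ?_ h3)
      rw [Complex.real_smul]; push_cast; simp
    have hc1 : Continuous fun x : ℝ => sqSeq (𝓕 φ) (m + 1) (x ^ 2) :=
      (continuous_iff_continuousAt.2 fun s =>
        (isDerivSeq_sqSeq (𝓕 φ) (m + 1) s).continuousAt).comp (continuous_pow 2)
    have := Continuous.ext_on (dense_compl_singleton (0 : ℝ)) hc1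
      ((derivSq ^ (m + 1)) (evenPart φ)).continuous key
    exact congrFun this x

lemma contDiff_sqSeq_mul (φ : 𝓢(ℝ, ℂ)) :
    ContDiff ℝ ∞ fun s => (cutoff s : ℂ) * sqSeq φ 0 s :=
  (Complex.ofRealCLM.contDiff.comp contDiff_cutoff).mul (isDerivSeq_sqSeq φ).contDiff

lemma norm_iteratedDeriv_ofReal_cutoff (i : ℕ) (s : ℝ) :
    ‖iteratedDeriv i (fun s => (cutoff s : ℂ)) s‖ = |iteratedDeriv i cutoff s| := by
  have h : IsDerivSeq fun j s => ((iteratedDeriv j cutoff s : ℝ) : ℂ) := fun j s =>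
    (hasDerivAt_iteratedDeriv contDiff_cutoff j s).ofReal_comp
  have h2 := h.iteratedDeriv_eq i
  simp only [iteratedDeriv_zero] at h2
  rw [h2, Complex.norm_real, Real.norm_eq_abs]

lemma norm_iteratedDeriv_sqSeq_mul_le (φ : 𝓢(ℝ, ℂ)) (m : ℕ) (s : ℝ) :
    ‖iteratedDeriv m (fun s => (cutoff s : ℂ) * sqSeq φ 0 s) s‖ ≤
      ∑ i ∈ Finset.range (m + 1),
        (m.choose i : ℝ) * |iteratedDeriv i cutoff s| * ‖sqSeq φ (m - i) s‖ := by
  rw [← norm_iteratedFDeriv_eq_norm_iteratedDeriv]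
  refine (norm_iteratedFDeriv_mul_le (N := ∞) (Complex.ofRealCLM.contDiff.comp contDiff_cutoff)
    (isDerivSeq_sqSeq φ).contDiff s (mod_cast le_top)).trans_eq
    (Finset.sum_congr rfl fun i _ => ?_)
  rw [norm_iteratedFDeriv_eq_norm_iteratedDeriv, norm_iteratedFDeriv_eq_norm_iteratedDeriv,
    (isDerivSeq_sqSeq φ).iteratedDeriv_eq, ← norm_iteratedDeriv_ofReal_cutoff]
  rfl

/-- Uniform bounds by continuous seminorms. -/
def SeminormBounded (b : 𝓢(ℝ, ℂ) → ℝ → ℝ) : Prop :=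
  ∃ q : Seminorm ℂ 𝓢(ℝ, ℂ), Continuous q ∧ ∀ f s, b f s ≤ q f

lemma SeminormBounded.add {b c : 𝓢(ℝ, ℂ) → ℝ → ℝ} (hb : SeminormBounded b)
    (hc : SeminormBounded c) : SeminormBounded fun f s => b f s + c f s := by
  obtain ⟨q, hq, h⟩ := hb
  obtain ⟨q', hq', h'⟩ := hc
  exact ⟨q + q', hq.add hq', fun f s => add_le_add (h f s) (h' f s)⟩

lemma SeminormBounded.const_mul {b : 𝓢(ℝ, ℂ) → ℝ → ℝ} (hb : SeminormBounded b) {c : ℝ}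
    (hc : 0 ≤ c) : SeminormBounded fun f s => c * b f s := by
  obtain ⟨q, hq, h⟩ := hb
  refine ⟨c.toNNReal • q, ?_, fun f s => ?_⟩
  · change Continuous fun f => (c.toNNReal : ℝ) * q f
    exact continuous_const.mul hq
  · change _ ≤ (c.toNNReal : ℝ) * q f
    rw [Real.coe_toNNReal c hc]
    exact mul_le_mul_of_nonneg_left (h f s) hc

lemma SeminormBounded.mono {b c : 𝓢(ℝ, ℂ) → ℝ → ℝ} (hb : SeminormBounded b)
    (h : ∀ f s, c f s ≤ b f s) : SeminormBounded c := by
  obtain ⟨q, hq, h'⟩ := hb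
  exact ⟨q, hq, fun f s => (h f s).trans (h' f s)⟩

lemma SeminormBounded.sum {ι : Type*} (t : Finset ι) {b : ι → 𝓢(ℝ, ℂ) → ℝ → ℝ}
    (hb : ∀ i ∈ t, SeminormBounded (b i)) : SeminormBounded fun f s => ∑ i ∈ t, b i f s := by
  classical
  induction t using Finset.induction_on with
  | empty => exact ⟨0, continuous_const, fun f s => by simp⟩
  | insert i t hi ih =>
    refine ((hb i (by simp)).add (ih fun j hj => hb j (by simp [hj]))).mono fun f s => ?_
    rw [Finset.sum_insert hi]

lemma seminormBounded_seminorm (k m : ℕ) (T : 𝓢(ℝ, ℂ) →L[ℂ] 𝓢(ℝ, ℂ)) :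
    SeminormBounded fun f _ => SchwartzMap.seminorm ℂ k m (T f) :=
  ⟨seminormComp k m T, continuous_seminormComp k m T, fun _ _ => le_rfl⟩

/-- The Fourier transform on `𝓢(ℝ, ℂ)`. -/
abbrev fourierR : 𝓢(ℝ, ℂ) →L[ℂ] 𝓢(ℝ, ℂ) := fourierTransformCLM ℂ

/-- For s ≥ 0 put s = x² and use the decay of the corresponding Schwartz function of x. On [-1, 0]
the weight is at most 1 and the uniform bound on the integral is enough. -/
lemma seminormBounded_sqSeq (k j : ℕ) : SeminormBounded fun f s =>
    if -1 ≤ s then |s| ^ k * ‖sqSeq (𝓕 f) j s‖ else 0 := by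
  obtain ⟨K, hK0, hK⟩ := exists_sqSeq_bound j
  refine ((((seminormBounded_seminorm 0 0 fourierR).add
    (seminormBounded_seminorm (2 * j + (volume : Measure ℝ).integrablePower) 0 fourierR)).const_mul
      hK0).add (seminormBounded_seminorm (2 * k) 0 ((derivSq ^ j).comp evenPart))).mono
      fun f s => ?_
  have h1 : 0 ≤ K * (SchwartzMap.seminorm ℂ 0 0 (fourierR f) + SchwartzMap.seminorm ℂ
      (2 * j + (volume : Measure ℝ).integrablePower) 0 (fourierR f)) :=
    (norm_nonneg _).trans (hK (fourierR f) 0)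
  have h2 := apply_nonneg (SchwartzMap.seminorm ℂ (2 * k) 0) (((derivSq ^ j).comp evenPart) f)
  split_ifs with h
  · rcases le_total 0 s with hs | hs
    · have h3 := norm_pow_mul_le_seminorm ℂ (((derivSq ^ j).comp evenPart) f) (2 * k) (Real.sqrt s)
      rw [ContinuousLinearMap.comp_apply, ← sqSeq_fourier, pow_mul, Real.norm_eq_abs, sq_abs,
        Real.sq_sqrt hs] at h3
      rw [abs_of_nonneg hs]
      exact h3.trans (le_add_of_nonneg_left h1)
    · refine le_add_of_le_of_nonneg ?_ h2
      have h4 : |s| ^ k ≤ 1 := pow_le_one₀ (abs_nonneg _) (abs_le.2 ⟨h, hs.trans zero_le_one⟩)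
      calc _ ≤ 1 * ‖sqSeq (𝓕 f) j s‖ := by gcongr
        _ ≤ _ := by rw [one_mul]; exact hK _ s
  · exact add_nonneg h1 h2

lemma iteratedDeriv_cutoff_of_lt (i : ℕ) {s : ℝ} (hs : s < -1) : iteratedDeriv i cutoff s = 0 := by
  have : iteratedDeriv i cutoff s = iteratedDeriv i (fun _ => (0 : ℝ)) s :=
    Filter.EventuallyEq.iteratedDeriv_eq i ((gt_mem_nhds hs).mono fun t ht => cutoff_of_le ht.le)
  rw [this, iteratedDeriv_const]
  split_ifs <;> rfl

/-- Leibniz' rule; for s < -1 every term vanishes with the derivatives of the cutoff. -/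
lemma exists_sqSeq_mul_bound (k m : ℕ) : SeminormBounded fun f s =>
    |s| ^ k * ‖iteratedDeriv m (fun s => (cutoff s : ℂ) * sqSeq (𝓕 f) 0 s) s‖ := by
  choose K hK using exists_bound_cutoff
  have hK0 : ∀ i, 0 ≤ K i := fun i => (abs_nonneg _).trans (hK i 0)
  refine (SeminormBounded.sum (Finset.range (m + 1)) (b := fun i f s => m.choose i * K i *
    if -1 ≤ s then |s| ^ k * ‖sqSeq (𝓕 f) (m - i) s‖ else 0) fun i _ =>
      (seminormBounded_sqSeq k (m - i)).const_mul (mul_nonneg (by positivity) (hK0 i))).mono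
      fun f s => ?_
  refine (mul_le_mul_of_nonneg_left (norm_iteratedDeriv_sqSeq_mul_le (𝓕 f) m s)
    (by positivity)).trans ?_
  rw [Finset.mul_sum]
  refine Finset.sum_le_sum fun i _ => ?_
  split_ifs with h
  · calc _ = |iteratedDeriv i cutoff s| *
          ((m.choose i : ℝ) * (|s| ^ k * ‖sqSeq (𝓕 f) (m - i) s‖)) := by ring
      _ ≤ K i * ((m.choose i : ℝ) * (|s| ^ k * ‖sqSeq (𝓕 f) (m - i) s‖)) :=
          mul_le_mul_of_nonneg_right (hK i s) (by positivity)
      _ = _ := by ring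
  · simp [iteratedDeriv_cutoff_of_lt i (not_le.1 h)]

lemma sqSeq_add (φ ψ : 𝓢(ℝ, ℂ)) (m : ℕ) (s : ℝ) :
    sqSeq (φ + ψ) m s = sqSeq φ m s + sqSeq ψ m s := by
  rw [sqSeq, sqSeq, sqSeq, ← integral_add (sqSeq_integrable _ _ _) (sqSeq_integrable _ _ _)]
  simp only [_root_.add_apply, add_mul]

lemma sqSeq_smul (a : ℂ) (φ : 𝓢(ℝ, ℂ)) (m : ℕ) (s : ℝ) :
    sqSeq (a • φ) m s = a * sqSeq φ m s := by
  rw [sqSeq, sqSeq, ← integral_const_mul]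
  simp only [_root_.smul_apply, smul_eq_mul, mul_assoc]

/-- A continuous operator that maps every even Schwartz function `f` to a Schwartz function `p`
with `p(x²) = f(x)`. -/
def whitney : 𝓢(ℝ, ℂ) →L[ℂ] 𝓢(ℝ, ℂ) :=
  clmOfDerivSeq (fun f m => iteratedDeriv m fun s => (cutoff s : ℂ) * sqSeq (𝓕 f) 0 s)
    (fun f g s => by
      simp only [iteratedDeriv_zero, FourierTransform.fourier_add, sqSeq_add, mul_add])
    (fun a f s => by
      simp only [iteratedDeriv_zero, FourierTransform.fourier_smul, sqSeq_smul, smul_eq_mul]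
      ring)
    (fun f m s => by
      change HasDerivAt (iteratedDeriv m _) (iteratedDeriv (m + 1) _ s) s
      rw [iteratedDeriv_succ]
      exact (((contDiff_sqSeq_mul _).differentiable_iteratedDeriv m
        (mod_cast WithTop.coe_lt_top _)) s).hasDerivAt)
    exists_sqSeq_mul_bound

lemma whitney_sq {f : 𝓢(ℝ, ℂ)} (hf : ∀ x, f (-x) = f x) (x : ℝ) : whitney f (x ^ 2) = f x := by
  change (cutoff (x ^ 2) : ℂ) * sqSeq (𝓕 f) 0 (x ^ 2) = f x
  rw [cutoff_of_nonneg (sq_nonneg x), sqSeq_fourier_zero, evenPart_apply, hf]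
  simp

end
end MotionGroup
-- Representation theory: τ_n, its derivative, and the summands W_n^ℓ.
namespace MotionGroup
open MvPolynomial

noncomputable section

/-! ### The vector of basis polynomials -/

/-- The values at `z` of the basis polynomials. -/
def ev (n : ℕ) (z : Fin 2 → ℂ) (j : Fin (n + 1)) : ℂ :=
  ((Real.sqrt (n.choose j) : ℝ) : ℂ) * z 0 ^ (j : ℕ) * z 1 ^ (n - (j : ℕ))

lemma sqrt_choose_ne_zero {n : ℕ} (j : Fin (n + 1)) : ((Real.sqrt (n.choose j) : ℝ) : ℂ) ≠ 0 := by
  have : 0 < n.choose j := Nat.choose_pos (Nat.lt_succ_iff.1 j.2)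
  rw [Complex.ofReal_ne_zero, Real.sqrt_ne_zero']
  exact_mod_cast this

lemma sqrt_choose_sq {n : ℕ} (j : Fin (n + 1)) :
    ((Real.sqrt (n.choose j) : ℝ) : ℂ) * ((Real.sqrt (n.choose j) : ℝ) : ℂ) = n.choose j := by
  rw [← Complex.ofReal_mul, Real.mul_self_sqrt (by positivity)]; simp

lemma expo_injective (n : ℕ) : Function.Injective (expo n) := by
  intro i j h
  have := DFunLike.congr_fun h 0
  simpa [expo, Fin.ext_iff] using this

lemma degree_expo (n : ℕ) (j : Fin (n + 1)) : (expo n j).degree = n := by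
  have := j.2
  rw [Finsupp.degree_eq_sum, Fin.sum_univ_two]
  simp [expo]; omega

lemma basisPoly_isHomogeneous (n : ℕ) (j : Fin (n + 1)) : (basisPoly n j).IsHomogeneous n :=
  isHomogeneous_monomial _ (degree_expo n j)

lemma eval_monomial_expo (n : ℕ) (j : Fin (n + 1)) (z : Fin 2 → ℂ) :
    ∏ i, z i ^ expo n j i = z 0 ^ (j : ℕ) * z 1 ^ (n - (j : ℕ)) := by
  simp [Fin.prod_univ_two, expo]

lemma eval_basisPoly (n : ℕ) (z : Fin 2 → ℂ) (j : Fin (n + 1)) :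
    eval z (basisPoly n j) = ev n z j := by
  rw [basisPoly, eval_monomial, Finsupp.prod_fintype _ _ (by simp), eval_monomial_expo, ev, mul_assoc]

lemma eval_of_isHomogeneous {n : ℕ} {p : MvPolynomial (Fin 2) ℂ} (hp : p.IsHomogeneous n)
    (z : Fin 2 → ℂ) : eval z p =
      ∑ i : Fin (n + 1), ev n z i * (coeff (expo n i) p / ((Real.sqrt (n.choose i) : ℝ) : ℂ)) := by
  classical
  have hs : p.support ⊆ Finset.univ.image (expo n) := by
    intro d hd
    have h : d.degree = n := by
      by_contra h
      exact (mem_support_iff.1 hd) (hp.coeff_eq_zero h)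
    have h2 : d 0 + d 1 = n := by rw [← h, Finsupp.degree_eq_sum, Fin.sum_univ_two]
    refine Finset.mem_image.2 ⟨⟨d 0, by omega⟩, Finset.mem_univ _, ?_⟩
    ext i
    fin_cases i <;> simp [expo]
    omega
  rw [eval_eq', Finset.sum_subset hs fun d _ hd => by simp [notMem_support_iff.1 hd],
    Finset.sum_image fun i _ j _ h => expo_injective n h]
  refine Finset.sum_congr rfl fun i _ => ?_
  rw [eval_monomial_expo, ev]
  have := sqrt_choose_ne_zero i
  field_simp

/-- The row vector of basis values turns a matrix back into an operator on polynomials, so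
identities between matrices can be checked by evaluating polynomials at points. -/
lemma ev_vecMul_polyMatrix {n : ℕ} {T : MvPolynomial (Fin 2) ℂ →ₗ[ℂ] MvPolynomial (Fin 2) ℂ}
    (hT : ∀ j, (T (basisPoly n j)).IsHomogeneous n) (z : Fin 2 → ℂ) (j : Fin (n + 1)) :
    (ev n z ᵥ* polyMatrix n T) j = eval z (T (basisPoly n j)) := by
  rw [eval_of_isHomogeneous (hT j)]
  rfl

/-- The points `(t, 1)`, `t = 0, …, n`, at which a homogeneous polynomial can be interpolated. -/
def interp (n : ℕ) : EndV n := Matrix.of fun i => ev n ![((i : ℕ) : ℂ), 1]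

/-- A Vandermonde matrix with distinct nodes times an invertible diagonal one. Hence the vectors `ev
n z` span, and they separate matrices. -/
lemma isUnit_interp (n : ℕ) : IsUnit (interp n).det := by
  have h : interp n = Matrix.vandermonde (fun i : Fin (n + 1) => ((i : ℕ) : ℂ)) *
      Matrix.diagonal fun j : Fin (n + 1) => ((Real.sqrt (n.choose j) : ℝ) : ℂ) := by
    ext i j
    simp [interp, ev, Matrix.mul_diagonal, Matrix.vandermonde_apply, mul_comm]
  rw [h, Matrix.det_mul, Matrix.det_diagonal, isUnit_iff_ne_zero]
  refine mul_ne_zero (Matrix.det_vandermonde_ne_zero_iff.2 fun i j h => ?_)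
    (Finset.prod_ne_zero_iff.2 fun j _ => sqrt_choose_ne_zero j)
  simpa [Fin.ext_iff] using h

lemma interp_mul_apply {n : ℕ} (A : EndV n) (i j : Fin (n + 1)) :
    (interp n * A) i j = (ev n ![((i : ℕ) : ℂ), 1] ᵥ* A) j := rfl

lemma matrix_ext_ev {n : ℕ} {A A' : EndV n} (h : ∀ z, ev n z ᵥ* A = ev n z ᵥ* A') : A = A' := by
  have h2 : interp n * A = interp n * A' := by
    ext i j; rw [interp_mul_apply, interp_mul_apply, h]
  have h3 := congrArg (fun B : EndV n => (interp n)⁻¹ * B) h2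
  simpa [Matrix.nonsing_inv_mul_cancel_left _ _ (isUnit_interp n)] using h3

/-! ### The representation `τ_n` -/

lemma ev_vecMul_tau (n : ℕ) (k : Matrix (Fin 2) (Fin 2) ℂ) (z : Fin 2 → ℂ) :
    ev n z ᵥ* tau n k = ev n (k⁻¹ *ᵥ z) := by
  ext j
  rw [tau, ev_vecMul_polyMatrix]
  · rw [AlgHom.toLinearMap_apply, ← eval_basisPoly, aeval_def, eval_eval₂, eval, coe_eval₂Hom]
    congr 1
    · ext; simp
    · ext i; simp [Matrix.mulVec, dotProduct]
  · intro j
    have := (basisPoly_isHomogeneous n j).aeval (S := ℂ)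
      (fun i => ∑ j, C (k⁻¹ i j) * X j : Fin 2 → MvPolynomial (Fin 2) ℂ) (n := 1) (fun i =>
        IsHomogeneous.sum _ _ _ fun j _ => isHomogeneous_C_mul_X _ _)
    rwa [one_mul] at this

lemma tau_mul (n : ℕ) (k k' : Matrix (Fin 2) (Fin 2) ℂ) : tau n (k * k') = tau n k * tau n k' :=
  matrix_ext_ev fun z => by
    rw [← Matrix.vecMul_vecMul, ev_vecMul_tau, ev_vecMul_tau, ev_vecMul_tau, Matrix.mul_inv_rev,
      Matrix.mulVec_mulVec]

lemma tau_one (n : ℕ) : tau n 1 = 1 :=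
  matrix_ext_ev fun z => by rw [ev_vecMul_tau, inv_one, Matrix.one_mulVec, Matrix.vecMul_one]

lemma tau_mul_inv {n : ℕ} {k : Matrix (Fin 2) (Fin 2) ℂ} (hk : IsUnit k.det) :
    tau n k * tau n k⁻¹ = 1 := by
  rw [← tau_mul, Matrix.mul_nonsing_inv _ hk, tau_one]

lemma tau_inv_mul {n : ℕ} {k : Matrix (Fin 2) (Fin 2) ℂ} (hk : IsUnit k.det) :
    tau n k⁻¹ * tau n k = 1 := by
  rw [← tau_mul, Matrix.nonsing_inv_mul _ hk, tau_one]

/-- The binomial theorem; the weights √C(n,j) are there for this. The kernel (z·w̄)^n is visibly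
invariant under U(2). -/
lemma ev_dotProduct_star (n : ℕ) (z w : Fin 2 → ℂ) :
    ev n z ⬝ᵥ star (ev n w) = (z ⬝ᵥ star w) ^ n := by
  simp only [dotProduct, Fin.sum_univ_two, add_pow, Finset.sum_range, Pi.star_apply]
  refine Finset.sum_congr rfl fun j _ => ?_
  simp only [ev, star_mul', star_pow, RCLike.star_def, Complex.conj_ofReal]
  rw [← sqrt_choose_sq]; ring

lemma unitary_isUnit_det {k : Matrix (Fin 2) (Fin 2) ℂ} (hk : k ∈ Matrix.unitaryGroup (Fin 2) ℂ) :
    IsUnit k.det :=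
  (Matrix.isUnit_iff_isUnit_det k).1 ⟨⟨k, star k, hk.2, hk.1⟩, rfl⟩

lemma unitary_inv {k : Matrix (Fin 2) (Fin 2) ℂ} (hk : k ∈ Matrix.unitaryGroup (Fin 2) ℂ) :
    k⁻¹ = kᴴ := Matrix.inv_eq_left_inv hk.1

/-- Unitarity: invariance of the kernel (z·w̄)^n shows that τ τᴴ and 1 define the same form on the
vectors `ev n z`, and these span. -/
lemma tau_conjTranspose {n : ℕ} {k : Matrix (Fin 2) (Fin 2) ℂ}
    (hk : k ∈ Matrix.unitaryGroup (Fin 2) ℂ) : (tau n k)ᴴ = tau n k⁻¹ := by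
  have key : ∀ z w, ev n z ⬝ᵥ ((tau n k * (tau n k)ᴴ) *ᵥ star (ev n w)) =
      ev n z ⬝ᵥ star (ev n w) := by
    intro z w
    rw [Matrix.dotProduct_mulVec, ← Matrix.vecMul_vecMul, ← Matrix.dotProduct_mulVec,
      ← Matrix.star_vecMul, ev_vecMul_tau, ev_vecMul_tau, ev_dotProduct_star, ev_dotProduct_star]
    congr 1
    rw [Matrix.star_mulVec, unitary_inv hk, Matrix.conjTranspose_conjTranspose,
      dotProduct_comm, ← Matrix.dotProduct_mulVec, Matrix.mulVec_mulVec,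
      show k * kᴴ = 1 from hk.2, Matrix.one_mulVec, dotProduct_comm]
  have h1 : tau n k * (tau n k)ᴴ = 1 := by
    have hu : IsUnit ((interp n)ᴴ).det := by
      rw [Matrix.det_conjTranspose]; exact (isUnit_interp n).star
    have h2 : interp n * (tau n k * (tau n k)ᴴ) * (interp n)ᴴ = interp n * 1 * (interp n)ᴴ := by
      ext i j
      have := key ![((i : ℕ) : ℂ), 1] ![((j : ℕ) : ℂ), 1]
      rw [Matrix.dotProduct_mulVec] at this
      rw [mul_one]
      exact this
    have h3 := congrArg (fun B : EndV n => (interp n)⁻¹ * (B * ((interp n)ᴴ)⁻¹)) h2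
    simpa only [Matrix.mul_nonsing_inv_cancel_right _ _ hu,
      Matrix.nonsing_inv_mul_cancel_left _ _ (isUnit_interp n)] using h3
  calc (tau n k)ᴴ = (tau n k⁻¹ * tau n k) * (tau n k)ᴴ := by
        rw [tau_inv_mul (unitary_isUnit_det hk), one_mul]
    _ = _ := by rw [mul_assoc, h1, mul_one]

/-! ### The derived representation -/

lemma dtau_operator_apply (X : Matrix (Fin 2) (Fin 2) ℂ) (p : MvPolynomial (Fin 2) ℂ) :
    (-∑ i, ∑ j, X i j • (LinearMap.mulLeft ℂ (MvPolynomial.X j : MvPolynomial (Fin 2) ℂ) ∘ₗ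
        (pderiv i).toLinearMap)) p = -∑ i, ∑ j, X i j • (MvPolynomial.X j * pderiv i p) := by
  simp

lemma eval_pderiv_basisPoly_zero (n : ℕ) (z : Fin 2 → ℂ) (j : Fin (n + 1)) :
    eval z (pderiv 0 (basisPoly n j)) = ((Real.sqrt (n.choose j) : ℝ) : ℂ) *
      ((j : ℕ) * z 0 ^ ((j : ℕ) - 1)) * z 1 ^ (n - (j : ℕ)) := by
  rw [basisPoly, pderiv_monomial, eval_monomial, Finsupp.prod_fintype _ _ (by simp),
    Fin.prod_univ_two]
  simp [expo]
  ring

lemma eval_pderiv_basisPoly_one (n : ℕ) (z : Fin 2 → ℂ) (j : Fin (n + 1)) :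
    eval z (pderiv 1 (basisPoly n j)) = ((Real.sqrt (n.choose j) : ℝ) : ℂ) *
      z 0 ^ (j : ℕ) * ((n - (j : ℕ) : ℕ) * z 1 ^ (n - (j : ℕ) - 1)) := by
  rw [basisPoly, pderiv_monomial, eval_monomial, Finsupp.prod_fintype _ _ (by simp),
    Fin.prod_univ_two]
  simp [expo]
  ring

lemma ev_vecMul_dtau (n : ℕ) (X : Matrix (Fin 2) (Fin 2) ℂ) (z : Fin 2 → ℂ) (j : Fin (n + 1)) :
    (ev n z ᵥ* dtau n X) j = -(((Real.sqrt (n.choose j) : ℝ) : ℂ) *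
      ((j : ℕ) * z 0 ^ ((j : ℕ) - 1)) * z 1 ^ (n - (j : ℕ)) * (X *ᵥ z) 0 +
      ((Real.sqrt (n.choose j) : ℝ) : ℂ) *
      z 0 ^ (j : ℕ) * ((n - (j : ℕ) : ℕ) * z 1 ^ (n - (j : ℕ) - 1)) * (X *ᵥ z) 1) := by
  rw [dtau, ev_vecMul_polyMatrix]
  · rw [dtau_operator_apply, map_neg]
    simp only [Fin.sum_univ_two, map_add, smul_eval, map_mul, eval_X, eval_pderiv_basisPoly_zero,
      eval_pderiv_basisPoly_one, Matrix.mulVec, dotProduct]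
    ring
  · intro j
    rw [dtau_operator_apply]
    refine IsHomogeneous.neg (IsHomogeneous.sum _ _ _ fun i _ => IsHomogeneous.sum _ _ _ fun l _ => ?_)
    rw [smul_eq_C_mul]
    refine IsHomogeneous.C_mul ?_ _
    -- The degree n - 1 of a derivative truncates at n = 0, so constants are treated separately.
    rcases Nat.eq_zero_or_pos n with rfl | hn
    · have : pderiv i (basisPoly 0 j) = 0 := by
        have h : expo 0 j = 0 := by
          have := j.2; ext i; fin_cases i <;> simp [expo]
        rw [basisPoly, h, pderiv_monomial]; simp
      rw [this, mul_zero]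
      exact isHomogeneous_zero _ _ _
    · have := (isHomogeneous_X ℂ l).mul ((basisPoly_isHomogeneous n j).pderiv (i := i))
      rwa [show 1 + (n - 1) = n by omega] at this

/-- The derivative of `ev n` along a curve is given by `dτ_n`. -/
lemma hasDerivAt_ev (n : ℕ) (X : Matrix (Fin 2) (Fin 2) ℂ) (w : ℝ → Fin 2 → ℂ) (t : ℝ)
    (hw : ∀ i, HasDerivAt (fun t => w t i) (-(X *ᵥ w t) i) t) (j : Fin (n + 1)) :
    HasDerivAt (fun t => ev n (w t) j) ((ev n (w t) ᵥ* dtau n X) j) t := by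
  have h := (((hw 0).pow (j : ℕ)).const_mul ((Real.sqrt (n.choose j) : ℝ) : ℂ)).mul
    ((hw 1).pow (n - (j : ℕ)))
  refine h.congr_deriv ?_
  rw [ev_vecMul_dtau]
  simp only [Pi.pow_apply]
  ring

lemma dtau_add (n : ℕ) (X Y : Matrix (Fin 2) (Fin 2) ℂ) :
    dtau n (X + Y) = dtau n X + dtau n Y :=
  matrix_ext_ev fun z => by
    ext j
    rw [Matrix.vecMul_add, Pi.add_apply, ev_vecMul_dtau, ev_vecMul_dtau, ev_vecMul_dtau,
      Matrix.add_mulVec]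
    simp only [Pi.add_apply]; ring

lemma dtau_smul (n : ℕ) (c : ℂ) (X : Matrix (Fin 2) (Fin 2) ℂ) :
    dtau n (c • X) = c • dtau n X :=
  matrix_ext_ev fun z => by
    ext j
    rw [Matrix.vecMul_smul, Pi.smul_apply, ev_vecMul_dtau, ev_vecMul_dtau, Matrix.smul_mulVec]
    simp only [Pi.smul_apply, smul_eq_mul]; ring

/-- `τ_n(k) dτ_n(X) τ_n(k)⁻¹ = dτ_n(k X k⁻¹)`. -/
lemma tau_mul_dtau {n : ℕ} {k : Matrix (Fin 2) (Fin 2) ℂ} (hk : IsUnit k.det)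
    (X : Matrix (Fin 2) (Fin 2) ℂ) :
    tau n k * dtau n X = dtau n (k * X * k⁻¹) * tau n k := by
  refine matrix_ext_ev fun z => ?_
  ext j
  -- With Y = kXk⁻¹, differentiate ev(k⁻¹(z - tYz)) = ev(z - tYz) τ(k) at t = 0, once on each side.
  have lin : ∀ (Y : Matrix (Fin 2) (Fin 2) ℂ) (z : Fin 2 → ℂ) (i : Fin 2),
      HasDerivAt (fun t : ℝ => (z - (t : ℂ) • (Y *ᵥ z)) i)
        (-(Y *ᵥ (z - ((0 : ℝ) : ℂ) • (Y *ᵥ z))) i) 0 := fun Y z i => by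
    have h := ((hasDerivAt_id (0 : ℝ)).ofReal_comp.mul_const ((Y *ᵥ z) i)).const_sub (z i)
    refine h.congr_deriv ?_
    simp
  have h1 := hasDerivAt_ev n X _ 0 (lin X (k⁻¹ *ᵥ z)) j
  have h2 := hasDerivAt_ev n (k * X * k⁻¹) _ 0 (lin (k * X * k⁻¹) z)
  have h3 := HasDerivAt.fun_sum (u := Finset.univ) fun i _ => (h2 i).mul_const (tau n k i j)
  have e : (fun t : ℝ => ev n (k⁻¹ *ᵥ z - (t : ℂ) • (X *ᵥ (k⁻¹ *ᵥ z))) j) = fun t : ℝ =>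
      ∑ i, ev n (z - (t : ℂ) • ((k * X * k⁻¹) *ᵥ z)) i * tau n k i j := by
    ext t
    have e0 : k⁻¹ *ᵥ (z - (t : ℂ) • ((k * X * k⁻¹) *ᵥ z)) =
        k⁻¹ *ᵥ z - (t : ℂ) • (X *ᵥ (k⁻¹ *ᵥ z)) := by
      rw [Matrix.mulVec_sub, Matrix.mulVec_smul, Matrix.mulVec_mulVec, Matrix.mulVec_mulVec,
        mul_assoc k, Matrix.nonsing_inv_mul_cancel_left _ _ hk]
    rw [← e0, ← ev_vecMul_tau]
    rfl
  rw [e] at h1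
  have := h1.unique h3
  simp only [Complex.ofReal_zero, zero_smul, sub_zero] at this
  rw [← Matrix.vecMul_vecMul, ev_vecMul_tau, this, ← Matrix.vecMul_vecMul]
  rfl

end
end MotionGroup
namespace MotionGroup

noncomputable section

/-! ### The ladder operators -/

/-- The raising operator. -/
def Eop (n : ℕ) : EndV n := dtau n !![0, 1; 0, 0]
/-- The lowering operator. -/
def Fop (n : ℕ) : EndV n := dtau n !![0, 0; 1, 0]
/-- The weight operator `diag(n, n-2, …, -n)`. -/
def Hop (n : ℕ) : EndV n := dtau n !![1, 0; 0, -1]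

lemma dtau_eq (n : ℕ) (a b c : ℂ) :
    dtau n !![c, a; b, -c] = a • Eop n + b • Fop n + c • Hop n := by
  rw [Eop, Fop, Hop, ← dtau_smul, ← dtau_smul, ← dtau_smul, ← dtau_add, ← dtau_add]
  congr 1
  ext i j; fin_cases i <;> fin_cases j <;> simp

/-- `√C(n,j)`. -/
abbrev rt (n j : ℕ) : ℂ := ((Real.sqrt (n.choose j) : ℝ) : ℂ)

lemma rt_ne_zero {n j : ℕ} (h : j ≤ n) : rt n j ≠ 0 := sqrt_choose_ne_zero (⟨j, by omega⟩ : Fin (n+1))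

lemma Hop_eq (n : ℕ) : Hop n = Matrix.diagonal fun j : Fin (n + 1) => (n : ℂ) - 2 * (j : ℕ) := by
  refine matrix_ext_ev fun z => ?_
  ext j
  rw [Hop, ev_vecMul_dtau, Matrix.vecMul_diagonal, ev]
  simp only [Matrix.mulVec, dotProduct, Fin.sum_univ_two, Matrix.of_apply, Matrix.cons_val_zero,
    Matrix.cons_val_one, Matrix.cons_val', Matrix.cons_val_fin_one]
  have h1 : ((j : ℕ) : ℂ) * z 0 ^ ((j : ℕ) - 1) * z 0 = (j : ℕ) * z 0 ^ (j : ℕ) := by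
    rcases Nat.eq_zero_or_pos (j : ℕ) with h | h
    · simp [h]
    · rw [mul_assoc, ← pow_succ, Nat.sub_add_cancel h]
  have h2 : ((n - (j : ℕ) : ℕ) : ℂ) * z 1 ^ (n - (j : ℕ) - 1) * z 1 =
      (n - (j : ℕ) : ℕ) * z 1 ^ (n - (j : ℕ)) := by
    rcases Nat.eq_zero_or_pos (n - (j : ℕ)) with h | h
    · simp [h]
    · rw [mul_assoc, ← pow_succ, Nat.sub_add_cancel h]
  have h3 : ((n - (j : ℕ) : ℕ) : ℂ) = n - (j : ℕ) := Nat.cast_sub (Nat.lt_succ_iff.1 j.2)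
  linear_combination -rt n j * z 1 ^ (n - (j : ℕ)) * h1 + rt n j * z 0 ^ (j : ℕ) * h2 +
    rt n j * z 0 ^ (j : ℕ) * z 1 ^ (n - (j : ℕ)) * h3

lemma Eop_apply (n : ℕ) (i j : Fin (n + 1)) : Eop n i j =
    if (i : ℕ) + 1 = j then -((j : ℕ) * rt n j / rt n i) else 0 := by
  revert i j
  suffices h : Eop n = Matrix.of fun i j : Fin (n + 1) =>
      if (i : ℕ) + 1 = j then -((j : ℕ) * rt n j / rt n i) else 0 from fun i j => by rw [h]; rfl
  refine matrix_ext_ev fun z => ?_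
  ext j
  rw [Eop, ev_vecMul_dtau]
  simp only [Matrix.mulVec, dotProduct, Fin.sum_univ_two, Matrix.of_apply, Matrix.cons_val_zero,
    Matrix.cons_val_one, Matrix.cons_val', Matrix.cons_val_fin_one, Matrix.vecMul]
  rcases Nat.eq_zero_or_pos (j : ℕ) with h | h
  · rw [Finset.sum_eq_zero fun i _ => by rw [if_neg (by omega), mul_zero]]
    simp [h]
  · rw [Finset.sum_eq_single (⟨j - 1, by omega⟩ : Fin (n + 1))]
    · rw [if_pos (by simp; omega), ev]
      have := rt_ne_zero (show (j : ℕ) - 1 ≤ n by omega)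
      have e : n - ((j : ℕ) - 1) = n - (j : ℕ) + 1 := by omega
      simp only [e, pow_succ]
      field_simp
      ring
    · intro i _ hi
      rw [if_neg (fun h => hi (by ext; simp; omega)), mul_zero]
    · simp

lemma Fop_apply (n : ℕ) (i j : Fin (n + 1)) : Fop n i j =
    if (i : ℕ) = j + 1 then -((n - (j : ℕ)) * rt n j / rt n i) else 0 := by
  revert i j
  suffices h : Fop n = Matrix.of fun i j : Fin (n + 1) =>
      if (i : ℕ) = j + 1 then -((n - (j : ℕ)) * rt n j / rt n i) else 0 from
    fun i j => by rw [h]; rfl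
  refine matrix_ext_ev fun z => ?_
  ext j
  rw [Fop, ev_vecMul_dtau]
  simp only [Matrix.mulVec, dotProduct, Fin.sum_univ_two, Matrix.of_apply, Matrix.cons_val_zero,
    Matrix.cons_val_one, Matrix.cons_val', Matrix.cons_val_fin_one, Matrix.vecMul]
  rcases Nat.eq_zero_or_pos (n - (j : ℕ)) with h | h
  · rw [Finset.sum_eq_zero fun i _ => by rw [if_neg (by omega), mul_zero]]
    simp [h]
  · rw [Finset.sum_eq_single (⟨j + 1, by omega⟩ : Fin (n + 1))]
    · rw [if_pos (by simp), ev]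
      have := rt_ne_zero (show (j : ℕ) + 1 ≤ n by omega)
      have e : n - (j : ℕ) - 1 = n - ((j : ℕ) + 1) := by omega
      have h3 : ((n - (j : ℕ) : ℕ) : ℂ) = n - (j : ℕ) := Nat.cast_sub (by omega)
      simp only [e, pow_succ, h3]
      field_simp
      ring
    · intro i _ hi
      rw [if_neg (fun h => hi (by ext; simp; omega)), mul_zero]
    · simp

lemma Eop_succ_ne_zero {n : ℕ} {i j : Fin (n + 1)} (h : (i : ℕ) + 1 = j) : Eop n i j ≠ 0 := by
  rw [Eop_apply, if_pos h]
  refine neg_ne_zero.2 (div_ne_zero (mul_ne_zero ?_ (rt_ne_zero (by omega))) (rt_ne_zero (by omega)))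
  exact_mod_cast (by omega : (j : ℕ) ≠ 0)

lemma Fop_mul_Eop (n : ℕ) : Fop n * Eop n =
    Matrix.diagonal fun j : Fin (n + 1) => ((j : ℕ) : ℂ) * (n - (j : ℕ) + 1) := by
  ext i j
  rw [Matrix.mul_apply]
  rcases Nat.eq_zero_or_pos (i : ℕ) with h | h
  · rw [Finset.sum_eq_zero fun k _ => by rw [Fop_apply, if_neg (by omega), zero_mul]]
    rw [Matrix.diagonal_apply]
    split_ifs with hij
    · simp [h]
    · rfl
  · rw [Finset.sum_eq_single (⟨i - 1, by omega⟩ : Fin (n + 1))]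
    · have h1 := rt_ne_zero (show (i : ℕ) - 1 ≤ n by omega)
      have h2 := rt_ne_zero (show (i : ℕ) ≤ n by omega)
      rw [Fop_apply, Eop_apply, if_pos (by simp; omega), Matrix.diagonal_apply]
      by_cases hij : i = j
      · subst hij
        rw [if_pos (by simp; omega), if_pos rfl]
        have h3 : (((i : ℕ) - 1 : ℕ) : ℂ) = (i : ℕ) - 1 := by push_cast [h]; ring
        simp only [h3]
        field_simp
        ring
      · rw [if_neg (fun h => hij (by ext; simp at h; omega)), if_neg hij, mul_zero]
    · intro k _ hk
      rw [Fop_apply, if_neg (fun h => hk (by ext; simp; omega)), zero_mul]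
    · simp

lemma Eop_mul_Fop (n : ℕ) : Eop n * Fop n =
    Matrix.diagonal fun j : Fin (n + 1) => (((j : ℕ) : ℂ) + 1) * (n - (j : ℕ)) := by
  ext i j
  rw [Matrix.mul_apply]
  rcases Nat.eq_zero_or_pos (n - (i : ℕ)) with h | h
  · rw [Finset.sum_eq_zero fun k _ => by rw [Eop_apply, if_neg (by omega), zero_mul]]
    rw [Matrix.diagonal_apply]
    have : (i : ℕ) = n := by omega
    split_ifs with hij
    · simp [this]
    · rfl
  · rw [Finset.sum_eq_single (⟨i + 1, by omega⟩ : Fin (n + 1))]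
    · have h1 := rt_ne_zero (show (i : ℕ) + 1 ≤ n by omega)
      have h2 := rt_ne_zero (show (i : ℕ) ≤ n by omega)
      rw [Fop_apply, Eop_apply, if_pos (by simp), Matrix.diagonal_apply]
      by_cases hij : i = j
      · subst hij
        rw [if_pos (by simp), if_pos rfl]
        push_cast
        field_simp
      · rw [if_neg (fun h => hij (by ext; simp at h; omega)), if_neg hij, mul_zero]
    · intro k _ hk
      rw [Eop_apply, if_neg (fun h => hk (by ext; simp; omega)), zero_mul]
    · simp

/-- The commutator `B ↦ AB - BA`. -/
def adm {n : ℕ} (A : EndV n) : EndV n →ₗ[ℂ] EndV n := LinearMap.mulLeft ℂ A - LinearMap.mulRight ℂ A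

lemma adm_apply {n : ℕ} (A B : EndV n) : adm A B = A * B - B * A := rfl

lemma adm_adm {n : ℕ} (A B D : EndV n) : adm A (adm B D) = adm (adm A B) D + adm B (adm A D) := by
  simp only [adm_apply]; noncomm_ring

lemma adm_smul {n : ℕ} (c : ℂ) (A B : EndV n) : adm (c • A) B = c • adm A B := by
  simp only [adm_apply, smul_mul_assoc, mul_smul_comm, smul_sub]

lemma adm_add {n : ℕ} (A A' B : EndV n) : adm (A + A') B = adm A B + adm A' B := by
  simp only [adm_apply, add_mul, mul_add]; abel

lemma lie_E_F (n : ℕ) : adm (Eop n) (Fop n) = Hop n := by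
  rw [adm_apply, Eop_mul_Fop, Fop_mul_Eop, Hop_eq, Matrix.diagonal_sub]
  congr 1; ext j; ring

lemma lie_H_apply {n : ℕ} (A : EndV n) (i j : Fin (n + 1)) :
    adm (Hop n) A i j = 2 * ((j : ℕ) - (i : ℕ)) * A i j := by
  rw [adm_apply, Hop_eq, Matrix.sub_apply, Matrix.diagonal_mul, Matrix.mul_diagonal]
  ring

lemma lie_H_E (n : ℕ) : adm (Hop n) (Eop n) = (2 : ℂ) • Eop n := by
  ext i j
  rw [lie_H_apply, Matrix.smul_apply, Eop_apply, smul_eq_mul]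
  split_ifs with h
  · rw [← h]; push_cast; ring
  · ring

lemma lie_H_F (n : ℕ) : adm (Hop n) (Fop n) = -((2 : ℂ) • Fop n) := by
  ext i j
  rw [lie_H_apply, Matrix.neg_apply, Matrix.smul_apply, Fop_apply, smul_eq_mul]
  split_ifs with h
  · rw [h]; push_cast; ring
  · ring

lemma B1_eq (n : ℕ) : B1 n = -Hop n := by
  rw [B1, ← dtau_smul, Hop, ← neg_one_smul ℂ (dtau n _), ← dtau_smul]
  congr 1
  ext i j; fin_cases i <;> fin_cases j <;> simp [X1]

lemma B1_eq_diagonal (n : ℕ) : B1 n = Matrix.diagonal fun j : Fin (n + 1) => 2 * ((j : ℕ) : ℂ) - n := by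
  rw [B1_eq, Hop_eq, Matrix.diagonal_neg]
  congr 1; ext j; simp

lemma aeval_B1 (n : ℕ) (p : Polynomial ℂ) :
    Polynomial.aeval (B1 n) p = Matrix.diagonal fun j : Fin (n + 1) => p.eval (2 * ((j : ℕ) : ℂ) - n) := by
  rw [B1_eq_diagonal, ← Matrix.diagonalAlgHom_apply ℂ, Polynomial.aeval_algHom_apply]
  rw [Matrix.diagonalAlgHom_apply]
  congr 1
  ext j
  simp

/-! ### Powers of the raising operator -/

lemma Eop_pow_apply_eq_zero (n m : ℕ) (i j : Fin (n + 1)) (h : (i : ℕ) + m ≠ j) :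
    (Eop n ^ m) i j = 0 := by
  induction m generalizing j with
  | zero => rw [pow_zero, Matrix.one_apply_ne (fun e => h (by simp [e]))]
  | succ m ih =>
    rw [pow_succ, Matrix.mul_apply]
    refine Finset.sum_eq_zero fun k _ => ?_
    by_cases hk : (i : ℕ) + m = k
    · rw [Eop_apply, if_neg (by omega), mul_zero]
    · rw [ih k hk, zero_mul]

lemma Eop_pow_apply_ne_zero (n m : ℕ) (i j : Fin (n + 1)) (h : (i : ℕ) + m = j) :
    (Eop n ^ m) i j ≠ 0 := by
  induction m generalizing j with
  | zero =>
    have : i = j := by ext; simpa using h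
    simp [this]
  | succ m ih =>
    rw [pow_succ, Matrix.mul_apply, Finset.sum_eq_single (⟨i + m, by omega⟩ : Fin (n + 1))]
    · exact mul_ne_zero (ih _ rfl) (Eop_succ_ne_zero (by simp; omega))
    · intro k _ hk
      rw [Eop_pow_apply_eq_zero _ _ _ _ (fun e => hk (by ext; simp [← e])), zero_mul]
    · simp

lemma Eop_pow_ne_zero {n m : ℕ} (h : m ≤ n) : Eop n ^ m ≠ 0 := fun e =>
  Eop_pow_apply_ne_zero n m ⟨0, by omega⟩ ⟨m, by omega⟩ (by simp) (by rw [e]; rfl)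

lemma Eop_pow_eq_zero (n : ℕ) : Eop n ^ (n + 1) = 0 := by
  ext i j
  exact Eop_pow_apply_eq_zero _ _ _ _ (by omega)

lemma lie_H_E_pow (n m : ℕ) : adm (Hop n) (Eop n ^ m) = ((2 * m : ℕ) : ℂ) • Eop n ^ m := by
  ext i j
  rw [lie_H_apply, Matrix.smul_apply, smul_eq_mul]
  by_cases h : (i : ℕ) + m = j
  · rw [← h]; push_cast; ring
  · rw [Eop_pow_apply_eq_zero _ _ _ _ h]; ring

lemma lie_E_E_pow (n m : ℕ) : adm (Eop n) (Eop n ^ m) = 0 := by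
  rw [adm_apply, ← pow_succ, ← pow_succ', sub_self]

/-- The iterated commutators `ad(F)^j E^l`. -/
def ladder (n l j : ℕ) : EndV n := (⇑(adm (Fop n)))^[j] (Eop n ^ l)

lemma ladder_succ (n l j : ℕ) : ladder n l (j + 1) = adm (Fop n) (ladder n l j) :=
  Function.iterate_succ_apply' _ _ _

lemma lie_H_ladder (n l j : ℕ) : adm (Hop n) (ladder n l j) = (2 * l - 2 * j : ℂ) • ladder n l j := by
  induction j with
  | zero => rw [ladder, Function.iterate_zero, id, lie_H_E_pow]; push_cast; simp
  | succ j ih =>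
    rw [ladder_succ, adm_adm, lie_H_F, ih, ← neg_smul, adm_smul, map_smul, ← add_smul]
    congr 1; push_cast; ring

/-- The 𝔰𝔩₂ computation: [E, F] = H acts on rung j by 2l - 2j, and these weights add up to
(j+1)(2l-j). -/
lemma lie_E_ladder_succ (n l j : ℕ) :
    adm (Eop n) (ladder n l (j + 1)) = ((j + 1) * (2 * l - j) : ℂ) • ladder n l j := by
  induction j with
  | zero =>
    rw [ladder_succ, adm_adm, lie_E_F, lie_H_ladder]
    have : adm (Eop n) (ladder n l 0) = 0 := lie_E_E_pow n l
    rw [this, map_zero, add_zero]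
    congr 1; simp
  | succ j ih =>
    rw [ladder_succ, adm_adm, lie_E_F, lie_H_ladder, ih, map_smul, ← ladder_succ, ← add_smul]
    congr 1; push_cast; ring

/-- The factor (j+1)(2l-j) is nonzero for j < 2l, so ad E leads from each rung back up to E^l ≠ 0.
-/
lemma ladder_ne_zero {n l j : ℕ} (hl : l ≤ n) (hj : j ≤ 2 * l) : ladder n l j ≠ 0 := by
  induction j with
  | zero => exact Eop_pow_ne_zero hl
  | succ j ih =>
    intro h
    have h2 := lie_E_ladder_succ n l j
    rw [h, map_zero, eq_comm, smul_eq_zero] at h2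
    refine h2.elim (fun h3 => ?_) (ih (by omega))
    rcases mul_eq_zero.1 h3 with h4 | h4
    · exact Nat.cast_add_one_ne_zero j h4
    · rw [sub_eq_zero] at h4
      have : 2 * l = j := by exact_mod_cast h4
      omega

end
end MotionGroup
namespace MotionGroup

noncomputable section

/-! ### Invariant subspaces are stable under the Lie algebra -/

lemma hasDerivAt_matrix_mul {m : Type*} [Fintype m] {M N : ℝ → Matrix m m ℂ} {M' N' : Matrix m m ℂ}
    {t : ℝ} (hM : ∀ i j, HasDerivAt (fun t => M t i j) (M' i j) t)
    (hN : ∀ i j, HasDerivAt (fun t => N t i j) (N' i j) t) (i j : m) :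
    HasDerivAt (fun t => (M t * N t) i j) ((M' * N t + M t * N') i j) t := by
  simp only [Matrix.mul_apply, Matrix.add_apply, ← Finset.sum_add_distrib]
  exact HasDerivAt.fun_sum fun k _ => (hM i k).mul (hN k j)

/-- The one-parameter group `cos t + sin t X` of a matrix with `X² = -1`. -/
def oneParam (X : Matrix (Fin 2) (Fin 2) ℂ) (t : ℝ) : Matrix (Fin 2) (Fin 2) ℂ :=
  (Real.cos t : ℂ) • (1 : Matrix (Fin 2) (Fin 2) ℂ) + (Real.sin t : ℂ) • X

lemma oneParam_zero (X : Matrix (Fin 2) (Fin 2) ℂ) : oneParam X 0 = 1 := by simp [oneParam]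

lemma oneParam_mul_neg {X : Matrix (Fin 2) (Fin 2) ℂ} (hX : X * X = -1) (t : ℝ) :
    oneParam X t * oneParam X (-t) = 1 := by
  have h : (Real.cos t : ℂ) ^ 2 + (Real.sin t : ℂ) ^ 2 = 1 := by
    exact_mod_cast Real.cos_sq_add_sin_sq t
  simp only [oneParam, Real.cos_neg, Real.sin_neg, add_mul, mul_add, smul_mul_smul_comm, hX, mul_one,
    one_mul]
  ext i j
  simp only [Matrix.add_apply, Matrix.smul_apply, Matrix.neg_apply, smul_eq_mul, Complex.ofReal_neg]
  linear_combination (1 : Matrix (Fin 2) (Fin 2) ℂ) i j * h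

lemma oneParam_inv {X : Matrix (Fin 2) (Fin 2) ℂ} (hX : X * X = -1) (t : ℝ) :
    (oneParam X t)⁻¹ = oneParam X (-t) := Matrix.inv_eq_right_inv (oneParam_mul_neg hX t)

lemma oneParam_mem {X : Matrix (Fin 2) (Fin 2) ℂ} (hX : X * X = -1) (hs : Xᴴ = -X) (t : ℝ) :
    oneParam X t ∈ Matrix.unitaryGroup (Fin 2) ℂ := by
  rw [Matrix.mem_unitaryGroup_iff]
  have : star (oneParam X t) = oneParam X (-t) := by
    rw [Matrix.star_eq_conjTranspose, oneParam, Matrix.conjTranspose_add,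
      Matrix.conjTranspose_smul, Matrix.conjTranspose_smul, hs, oneParam, Real.cos_neg, Real.sin_neg,
      Complex.ofReal_neg, Matrix.conjTranspose_one, RCLike.star_def,
      Complex.conj_ofReal, Complex.conj_ofReal, smul_neg, neg_smul]
  rw [this, oneParam_mul_neg hX]

/-- The action on the vectors `ev n z` is differentiated first; the inverse of the interpolation
matrix then recovers the single entries. -/
lemma hasDerivAt_tau_oneParam {X : Matrix (Fin 2) (Fin 2) ℂ} (hX : X * X = -1) (n : ℕ)
    (i j : Fin (n + 1)) :
    HasDerivAt (fun t => tau n (oneParam X t) i j) (dtau n X i j) 0 := by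
  have h1 : ∀ z : Fin 2 → ℂ, HasDerivAt (fun t => ev n (oneParam X (-t) *ᵥ z) j)
      ((ev n z ᵥ* dtau n X) j) 0 := fun z => by
    have h := hasDerivAt_ev n X (fun t => oneParam X (-t) *ᵥ z) 0 (fun i => by
      have hs : HasDerivAt (fun t : ℝ => ((Real.sin t : ℝ) : ℂ)) _ 0 :=
        (Real.hasDerivAt_sin 0).ofReal_comp
      have hc : HasDerivAt (fun t : ℝ => ((Real.cos t : ℝ) : ℂ)) _ 0 :=
        (Real.hasDerivAt_cos 0).ofReal_comp
      have := (hc.mul_const (z i)).sub (hs.mul_const ((X *ᵥ z) i))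
      refine (this.congr_deriv ?_).congr_of_eventuallyEq (.of_forall fun t => ?_)
      · simp [oneParam_zero]
      · change (oneParam X (-t) *ᵥ z) i = _
        rw [oneParam, Matrix.add_mulVec, Matrix.smul_mulVec, Matrix.smul_mulVec, Matrix.one_mulVec,
          Real.cos_neg, Real.sin_neg, Complex.ofReal_neg, neg_smul, ← sub_eq_add_neg]
        rfl) j
    simpa [oneParam_zero] using h
  have h2 := HasDerivAt.fun_sum (u := Finset.univ) fun (l : Fin (n + 1)) _ =>
    (h1 ![((l : ℕ) : ℂ), 1]).const_mul ((interp n)⁻¹ i l)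
  have e : ∀ A : EndV n, A i j = ∑ l, (interp n)⁻¹ i l * (ev n ![((l : ℕ) : ℂ), 1] ᵥ* A) j :=
    fun A => by
      have := Matrix.nonsing_inv_mul_cancel_left (interp n) A (isUnit_interp n)
      conv_lhs => rw [← this]
      rfl
  rw [e (dtau n X)]
  refine h2.congr_of_eventuallyEq (.of_forall fun t => ?_)
  change tau n (oneParam X t) i j = _
  rw [e (tau n (oneParam X t))]
  simp only [ev_vecMul_tau, oneParam_inv hX]

/-- Otherwise some functional kills U but not the commutator. It vanishes along the orbit t ↦ τ(k_t)
A τ(k_t)⁻¹ in U, hence on the derivative at t = 0, which is that commutator. -/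
lemma adm_dtau_mem {n : ℕ} {U : Submodule ℂ (EndV n)} (hU : IsInvariant U)
    {X : Matrix (Fin 2) (Fin 2) ℂ} (hX : X * X = -1) (hs : Xᴴ = -X) {A : EndV n} (hA : A ∈ U) :
    adm (dtau n X) A ∈ U := by
  by_contra hmem
  obtain ⟨f, hf, hfU⟩ := Submodule.exists_le_ker_of_notMem hmem
  have h1 := hasDerivAt_tau_oneParam hX n
  have h2 : ∀ i j, HasDerivAt (fun t => tau n (oneParam X t)⁻¹ i j) ((-dtau n X) i j) 0 :=
    fun i j => by
      have h := (hasDerivAt_tau_oneParam hX n i j)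
      rw [← neg_zero] at h
      have := h.scomp (0 : ℝ) (hasDerivAt_neg (0 : ℝ))
      refine (this.congr_deriv (by simp)).congr_of_eventuallyEq (.of_forall fun t => ?_)
      simp only [oneParam_inv hX]
      rfl
  have h3 := hasDerivAt_matrix_mul (N' := -dtau n X)
    (hasDerivAt_matrix_mul (N := fun _ => A) (N' := 0) h1
    (fun i j => hasDerivAt_const _ _)) h2
  simp only [oneParam_zero, inv_one, tau_one, mul_zero, add_zero, mul_one, one_mul] at h3
  have hlam : ∀ B : EndV n, f B = ∑ i, ∑ j, B i j * f (Matrix.single i j 1) := fun B => by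
    conv_lhs => rw [Matrix.matrix_eq_sum_single B]
    simp only [map_sum]
    refine Finset.sum_congr rfl fun i _ => Finset.sum_congr rfl fun j _ => ?_
    rw [← smul_eq_mul, ← map_smul, Matrix.smul_single, smul_eq_mul, mul_one]
  have h4 := HasDerivAt.fun_sum (u := Finset.univ) fun i _ =>
    HasDerivAt.fun_sum (u := Finset.univ) fun j _ =>
      (h3 i j).mul_const (f (Matrix.single i j 1))
  simp only [← hlam] at h4
  have h5 : (fun t => f (tau n (oneParam X t) * A * tau n (oneParam X t)⁻¹)) = fun _ => 0 :=
    funext fun t => hfU (hU _ (oneParam_mem hX hs t) A hA)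
  rw [h5] at h4
  have h6 := h4.unique (hasDerivAt_const _ _)
  refine hf (Eq.trans ?_ h6)
  rw [adm_apply, mul_neg, sub_eq_add_neg]

lemma X1_sq : X1 * X1 = -1 := by
  ext i j; fin_cases i <;> fin_cases j <;> simp [X1, Matrix.mul_apply]
lemma X2_sq : X2 * X2 = -1 := by
  ext i j; fin_cases i <;> fin_cases j <;> simp [X2, Matrix.mul_apply]
lemma X3_sq : X3 * X3 = -1 := by
  ext i j; fin_cases i <;> fin_cases j <;> simp [X3, Matrix.mul_apply]
lemma X1_star : X1ᴴ = -X1 := by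
  ext i j; fin_cases i <;> fin_cases j <;> simp [X1, Matrix.conjTranspose_apply]
lemma X2_star : X2ᴴ = -X2 := by
  ext i j; fin_cases i <;> fin_cases j <;> simp [X2, Matrix.conjTranspose_apply]
lemma X3_star : X3ᴴ = -X3 := by
  ext i j; fin_cases i <;> fin_cases j <;> simp [X3, Matrix.conjTranspose_apply]

lemma Hop_eq_X (n : ℕ) : Hop n = (-Complex.I) • dtau n X1 := by
  rw [← dtau_smul, Hop]; congr 1
  ext i j; fin_cases i <;> fin_cases j <;> simp [X1]

lemma Eop_eq_X (n : ℕ) : Eop n = (1 / 2 : ℂ) • dtau n X2 + (-Complex.I / 2) • dtau n X3 := by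
  rw [← dtau_smul, ← dtau_smul, ← dtau_add, Eop]; congr 1
  ext i j; fin_cases i <;> fin_cases j <;> simp [X2, X3]
  · linear_combination (1 / 2 : ℂ) * Complex.I_mul_I
  · linear_combination (1 / 2 : ℂ) * Complex.I_mul_I

lemma Fop_eq_X (n : ℕ) : Fop n = (-1 / 2 : ℂ) • dtau n X2 + (-Complex.I / 2) • dtau n X3 := by
  rw [← dtau_smul, ← dtau_smul, ← dtau_add, Fop]; congr 1
  ext i j; fin_cases i <;> fin_cases j <;> simp [X2, X3]
  · linear_combination (1 / 2 : ℂ) * Complex.I_mul_I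
  · linear_combination (1 / 2 : ℂ) * Complex.I_mul_I

lemma adm_H_mem {n : ℕ} {U : Submodule ℂ (EndV n)} (hU : IsInvariant U) {A : EndV n} (hA : A ∈ U) :
    adm (Hop n) A ∈ U := by
  rw [Hop_eq_X, adm_smul]
  exact U.smul_mem _ (adm_dtau_mem hU X1_sq X1_star hA)

lemma adm_E_mem {n : ℕ} {U : Submodule ℂ (EndV n)} (hU : IsInvariant U) {A : EndV n} (hA : A ∈ U) :
    adm (Eop n) A ∈ U := by
  rw [Eop_eq_X, adm_add, adm_smul, adm_smul]
  exact U.add_mem (U.smul_mem _ (adm_dtau_mem hU X2_sq X2_star hA))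
    (U.smul_mem _ (adm_dtau_mem hU X3_sq X3_star hA))

lemma adm_F_mem {n : ℕ} {U : Submodule ℂ (EndV n)} (hU : IsInvariant U) {A : EndV n} (hA : A ∈ U) :
    adm (Fop n) A ∈ U := by
  rw [Fop_eq_X, adm_add, adm_smul, adm_smul]
  exact U.add_mem (U.smul_mem _ (adm_dtau_mem hU X2_sq X2_star hA))
    (U.smul_mem _ (adm_dtau_mem hU X3_sq X3_star hA))

lemma ladder_mem {n l : ℕ} {U : Submodule ℂ (EndV n)} (hU : IsInvariant U)
    (hE : Eop n ^ l ∈ U) (j : ℕ) : ladder n l j ∈ U := by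
  induction j with
  | zero => exact hE
  | succ j ih => rw [ladder_succ]; exact adm_F_mem hU ih

/-! ### Highest weight vectors -/

/-- E is supported on the first superdiagonal with nonzero entries there, so Ev = vE determines row
i+1 of v from row i; a zero first row would make v zero. -/
lemma exists_apply_ne_zero_of_adm_E {n : ℕ} {v : EndV n} (hv : v ≠ 0) (hE : adm (Eop n) v = 0) :
    ∃ m, v 0 m ≠ 0 := by
  by_contra! h
  refine hv ?_
  have key : ∀ (i : ℕ) (hi : i < n + 1) (j : Fin (n + 1)), v ⟨i, hi⟩ j = 0 := by
    intro i
    induction i with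
    | zero => exact fun _ j => h j
    | succ i ih =>
      intro hi j
      have h1 : (Eop n * v) ⟨i, by omega⟩ j = (v * Eop n) ⟨i, by omega⟩ j := by
        rw [adm_apply, sub_eq_zero] at hE; rw [hE]
      rw [Matrix.mul_apply, Matrix.mul_apply,
        Finset.sum_eq_zero (s := Finset.univ) (f := fun k => v ⟨i, by omega⟩ k * Eop n k j)
          (fun k _ => by rw [ih, zero_mul]), Finset.sum_eq_single (⟨i + 1, hi⟩ : Fin (n + 1))] at h1
      · exact (mul_eq_zero.1 h1).resolve_left (Eop_succ_ne_zero rfl)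
      · intro k _ hk
        rw [Eop_apply, if_neg (fun e => hk (by ext; simp at e ⊢; omega)), zero_mul]
      · simp
  ext i j
  exact key i i.2 j

/-- The weight μ allows only one nonzero entry in row 0. Subtracting the multiple of E^m with the
same entry leaves a matrix commuting with E whose first row is zero. -/
lemma eq_smul_Eop_pow {n : ℕ} {v : EndV n} {μ : ℂ} (hv : v ≠ 0) (hE : adm (Eop n) v = 0)
    (hH : adm (Hop n) v = μ • v) : ∃ m ≤ n, ∃ c : ℂ, c ≠ 0 ∧ v = c • Eop n ^ m := by
  obtain ⟨m, hm⟩ := exists_apply_ne_zero_of_adm_E hv hE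
  have hμ : ∀ j, v 0 j ≠ 0 → μ = 2 * (j : ℕ) := fun j hj => by
    have := congrFun (congrFun hH 0) j
    rw [lie_H_apply, Matrix.smul_apply, smul_eq_mul] at this
    have := mul_right_cancel₀ hj this
    simpa using this.symm
  have hm' := Eop_pow_apply_ne_zero n m 0 m (by simp)
  refine ⟨m, Nat.lt_succ_iff.1 m.2, v 0 m / (Eop n ^ (m : ℕ)) 0 m, div_ne_zero hm hm', ?_⟩
  by_contra hne
  have hne' : v - (v 0 m / (Eop n ^ (m : ℕ)) 0 m) • Eop n ^ (m : ℕ) ≠ 0 := sub_ne_zero.2 hne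
  obtain ⟨j, hj⟩ := exists_apply_ne_zero_of_adm_E hne' (by
    rw [map_sub, map_smul, lie_E_E_pow, hE, smul_zero, sub_zero])
  rw [Matrix.sub_apply, Matrix.smul_apply, smul_eq_mul] at hj
  by_cases hjm : j = m
  · subst hjm
    exact hj (by rw [div_mul_cancel₀ _ hm', sub_self])
  · rw [Eop_pow_apply_eq_zero n m 0 j (fun e => hjm (Fin.ext (by simpa using e.symm))), mul_zero,
      sub_zero] at hj
    have h1 := (hμ m hm).symm.trans (hμ j hj)
    refine hjm (Fin.ext ?_)
    have h2 : ((m : ℕ) : ℂ) = (j : ℕ) := by linear_combination h1 / 2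
    exact_mod_cast h2.symm

/-- Left and right multiplication by E commute and are nilpotent. -/
lemma isNilpotent_adm_E (n : ℕ) : IsNilpotent (adm (Eop n)) := by
  have hE : IsNilpotent (Eop n) := ⟨n + 1, Eop_pow_eq_zero n⟩
  refine Commute.isNilpotent_sub (LinearMap.commute_mulLeft_right _ _)
    ((LinearMap.isNilpotent_mulLeft_iff _ _).2 hE) ((LinearMap.isNilpotent_mulRight_iff _ _).2 hE)

/-- Highest weight vectors exist: ad E is nilpotent, so its kernel in U is nonzero. That kernel is
stable under ad H and contains an eigenvector, necessarily a multiple of some E^m. -/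
lemma exists_Eop_pow_mem {n : ℕ} {U : Submodule ℂ (EndV n)} (hU : IsInvariant U) (hne : U ≠ ⊥) :
    ∃ m ≤ n, Eop n ^ m ∈ U := by
  obtain ⟨u, hu, hu0⟩ := U.exists_mem_ne_zero_of_ne_bot hne
  have hpow : ∀ k, ((adm (Eop n)) ^ k) u ∈ U := fun k => by
    induction k with
    | zero => exact hu
    | succ k ih => rw [pow_succ']; exact adm_E_mem hU ih
  let Z : Submodule ℂ (EndV n) := U ⊓ LinearMap.ker (adm (Eop n))
  have hZ : ∃ z ∈ Z, z ≠ 0 := by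
    classical
    obtain ⟨N, hN⟩ := isNilpotent_adm_E n
    have hex : ∃ k, ((adm (Eop n)) ^ k) u = 0 := ⟨N, by rw [hN]; rfl⟩
    have h1 := Nat.find_spec hex
    have h0 : Nat.find hex ≠ 0 := fun h => hu0 (by rw [h] at h1; exact h1)
    obtain ⟨k, hk⟩ := Nat.exists_eq_succ_of_ne_zero h0
    refine ⟨((adm (Eop n)) ^ k) u, ⟨hpow k, ?_⟩, Nat.find_min hex (by omega)⟩
    rw [hk, pow_succ'] at h1
    exact h1
  have hHZ : ∀ z ∈ Z, adm (Hop n) z ∈ Z := fun z hz => by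
    refine ⟨adm_H_mem hU hz.1, ?_⟩
    have hz2 : adm (Eop n) z = 0 := hz.2
    have hEH : adm (Eop n) (Hop n) = (-2 : ℂ) • Eop n := by
      have := lie_H_E n
      rw [neg_smul, ← this, adm_apply, adm_apply]; abel
    change adm (Eop n) (adm (Hop n) z) = 0
    rw [adm_adm, hEH, adm_smul, hz2, map_zero, smul_zero, add_zero]
  obtain ⟨z, hz, hz0⟩ := hZ
  have : Nontrivial Z := ⟨⟨⟨z, hz⟩, 0, fun h => hz0 (congrArg Subtype.val h)⟩⟩
  obtain ⟨μ, hμ⟩ := Module.End.exists_eigenvalue ((adm (Hop n)).restrict hHZ)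
  obtain ⟨v, hv⟩ := hμ.exists_hasEigenvector
  have hv1 : adm (Hop n) (v : EndV n) = μ • (v : EndV n) := congrArg Subtype.val hv.apply_eq_smul
  obtain ⟨m, hm, c, hc, e⟩ := eq_smul_Eop_pow (v := (v : EndV n))
    (fun h => hv.2 (Subtype.ext h)) v.2.2 hv1
  refine ⟨m, hm, ?_⟩
  have h1 : (v : EndV n) ∈ U := v.2.1
  rw [e] at h1
  exact (Submodule.smul_mem_iff _ hc).1 h1

end
end MotionGroup
namespace MotionGroup

noncomputable section

/-! ### The invariant subspaces spanned by powers of nilpotent elements -/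

/-- The nilpotent matrix `(a, b)ᵀ (-b, a)`. -/
def nil (a b : ℂ) : Matrix (Fin 2) (Fin 2) ℂ := !![-(a * b), a ^ 2; -b ^ 2, a * b]

/-- For v = (a, b), the matrix `nil a b` is y ↦ det(v, y) v, and k multiplies the determinant form
by det k. -/
lemma conj_nil {k : Matrix (Fin 2) (Fin 2) ℂ} (a b : ℂ) :
    k * nil a b * k⁻¹ = k.det⁻¹ • nil (k 0 0 * a + k 0 1 * b) (k 1 0 * a + k 1 1 * b) := by
  rw [Matrix.inv_def, Matrix.mul_smul, Matrix.adjugate_fin_two, Ring.inverse_eq_inv']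
  congr 1
  ext i j
  fin_cases i <;> fin_cases j <;> simp [nil, Matrix.mul_apply] <;> ring

/-- The span of the powers `dτ(X)^l`, where `X` runs over the nilpotent matrices. -/
def Uspace (n l : ℕ) : Submodule ℂ (EndV n) :=
  Submodule.span ℂ (Set.range fun x : ℂ × ℂ => dtau n (nil x.1 x.2) ^ l)

lemma tau_conj_dtau_pow {n : ℕ} {k : Matrix (Fin 2) (Fin 2) ℂ} (hk : IsUnit k.det)
    (X : Matrix (Fin 2) (Fin 2) ℂ) (l : ℕ) :
    tau n k * dtau n X ^ l * tau n k⁻¹ = dtau n (k * X * k⁻¹) ^ l := by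
  have h : SemiconjBy (tau n k) (dtau n X) (dtau n (k * X * k⁻¹)) := tau_mul_dtau hk X
  rw [(h.pow_right l).eq, mul_assoc, tau_mul_inv hk, mul_one]

lemma Uspace_conj_mem {n l : ℕ} {k : Matrix (Fin 2) (Fin 2) ℂ} (hk : IsUnit k.det) {A : EndV n}
    (hA : A ∈ Uspace n l) : tau n k * A * tau n k⁻¹ ∈ Uspace n l := by
  induction hA using Submodule.span_induction with
  | mem x hx =>
    obtain ⟨⟨a, b⟩, rfl⟩ := hx
    rw [tau_conj_dtau_pow hk, conj_nil, dtau_smul, smul_pow]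
    exact Submodule.smul_mem _ _ (Submodule.subset_span ⟨(_, _), rfl⟩)
  | zero => simp
  | add x y _ _ hx hy => rw [mul_add, add_mul]; exact Submodule.add_mem _ hx hy
  | smul c x _ hx => rw [mul_smul_comm, smul_mul_assoc]; exact Submodule.smul_mem _ _ hx

lemma isInvariant_Uspace (n l : ℕ) : IsInvariant (Uspace n l) := fun _ hk _ hA =>
  Uspace_conj_mem (unitary_isUnit_det hk) hA

lemma Eop_pow_mem_Uspace (n l : ℕ) : Eop n ^ l ∈ Uspace n l :=
  Submodule.subset_span ⟨(1, 0), by simp [nil, Eop]⟩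

/-- Homogeneous matrix-valued polynomials of degree `d` in two variables. -/
def IsHomog {n : ℕ} (d : ℕ) (f : ℂ → ℂ → EndV n) : Prop :=
  ∃ M : ℕ → EndV n, ∀ a b, f a b = ∑ i ∈ Finset.range (d + 1), (a ^ i * b ^ (d - i)) • M i

namespace IsHomog

variable {n d : ℕ} {f g : ℂ → ℂ → EndV n}

lemma add (hf : IsHomog d f) (hg : IsHomog d g) : IsHomog d (fun a b => f a b + g a b) := by
  obtain ⟨M, hM⟩ := hf
  obtain ⟨N, hN⟩ := hg
  exact ⟨fun i => M i + N i, fun a b => by simp [hM, hN, Finset.sum_add_distrib]⟩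

lemma mul_const (hf : IsHomog d f) (A : EndV n) : IsHomog d (fun a b => f a b * A) := by
  obtain ⟨M, hM⟩ := hf
  exact ⟨fun i => M i * A, fun a b => by simp [hM, Finset.sum_mul]⟩

lemma smul_left (hf : IsHomog d f) : IsHomog (d + 1) (fun a b => a • f a b) := by
  obtain ⟨M, hM⟩ := hf
  refine ⟨fun i => if i = 0 then 0 else M (i - 1), fun a b => ?_⟩
  rw [Finset.sum_range_succ']
  simp [hM, Finset.smul_sum, smul_smul, pow_succ', mul_assoc]

lemma smul_right (hf : IsHomog d f) : IsHomog (d + 1) (fun a b => b • f a b) := by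
  obtain ⟨M, hM⟩ := hf
  refine ⟨fun i => if i = d + 1 then 0 else M i, fun a b => ?_⟩
  rw [Finset.sum_range_succ]
  simp only [↓reduceIte, smul_zero, add_zero, hM, Finset.smul_sum]
  refine Finset.sum_congr rfl fun i hi => ?_
  have hi' : i ≤ d := Nat.lt_succ_iff.1 (Finset.mem_range.1 hi)
  rw [if_neg (by omega), smul_smul, Nat.succ_sub hi', pow_succ]
  congr 1; ring

lemma span_le (hf : IsHomog d f) : ∃ s : Finset (EndV n), s.card ≤ d + 1 ∧
    ∀ a b, f a b ∈ Submodule.span ℂ (s : Set (EndV n)) := by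
  classical
  obtain ⟨M, hM⟩ := hf
  refine ⟨(Finset.range (d + 1)).image M, Finset.card_image_le.trans (by simp), fun a b => ?_⟩
  rw [hM]
  exact Submodule.sum_mem _ fun i hi => Submodule.smul_mem _ _
    (Submodule.subset_span (Finset.mem_coe.2 (Finset.mem_image_of_mem _ hi)))

end IsHomog

lemma isHomog_dtau_nil_pow (n l : ℕ) : IsHomog (2 * l) fun a b => dtau n (nil a b) ^ l := by
  induction l with
  | zero => exact ⟨fun _ => 1, fun a b => by simp⟩
  | succ l ih =>
    have h1 := (ih.mul_const (Eop n)).smul_left.smul_left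
    have h2 := (ih.mul_const (-Fop n)).smul_right.smul_right
    have h3 := (ih.mul_const (-Hop n)).smul_right.smul_left
    change IsHomog (2 * l + 1 + 1) _
    convert (h1.add h2).add h3 using 3 with a b
    rw [pow_succ, show nil a b = !![-(a * b), a ^ 2; -b ^ 2, -(-(a * b))] by rw [neg_neg]; rfl,
      dtau_eq]
    simp only [mul_add, mul_neg, mul_smul_comm, smul_smul, smul_neg, neg_smul]
    simp only [pow_two]

/-- The generators are values of a matrix-valued form of degree 2l in (a, b), so its 2l+1
coefficients span a space containing them. -/
lemma finrank_Uspace_le (n l : ℕ) : Module.finrank ℂ (Uspace n l) ≤ 2 * l + 1 := by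
  obtain ⟨s, hs, h⟩ := (isHomog_dtau_nil_pow n l).span_le
  have hle : Uspace n l ≤ Submodule.span ℂ (s : Set (EndV n)) :=
    Submodule.span_le.2 (by rintro _ ⟨x, rfl⟩; exact h _ _)
  exact (Submodule.finrank_mono hle).trans ((finrank_span_finset_le_card s).trans hs)

/-- The rungs are eigenvectors of ad H with distinct eigenvalues. -/
lemma linearIndependent_ladder {n l N : ℕ} (hl : l ≤ n) (hN : N ≤ 2 * l + 1) :
    LinearIndependent ℂ fun j : Fin N => ladder n l j := by
  refine Module.End.eigenvectors_linearIndependent' (adm (Hop n))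
    (fun j : Fin N => (2 * l - 2 * (j : ℕ) : ℂ)) (fun i j h => Fin.ext ?_) _ fun j =>
    ⟨Module.End.mem_eigenspace_iff.2 (lie_H_ladder n l j), ladder_ne_zero hl (by omega)⟩
  have : ((i : ℕ) : ℂ) = (j : ℕ) := by
    have h' : (2 * l - 2 * (i : ℕ) : ℂ) = 2 * l - 2 * (j : ℕ) := h
    linear_combination (-1 / 2 : ℂ) * h'
  exact_mod_cast this

lemma span_ladder_le {n l : ℕ} {U : Submodule ℂ (EndV n)} (hU : IsInvariant U)
    (hE : Eop n ^ l ∈ U) :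
    Submodule.span ℂ (Set.range fun j : Fin (2 * l + 1) => ladder n l j) ≤ U :=
  Submodule.span_le.2 (by rintro _ ⟨j, rfl⟩; exact ladder_mem hU hE j)

lemma Uspace_eq_span {n l : ℕ} (hl : l ≤ n) :
    Uspace n l = Submodule.span ℂ (Set.range fun j : Fin (2 * l + 1) => ladder n l j) := by
  refine (Submodule.eq_of_le_of_finrank_le
    (span_ladder_le (isInvariant_Uspace n l) (Eop_pow_mem_Uspace n l)) ?_).symm
  rw [finrank_span_eq_card (linearIndependent_ladder hl le_rfl), Fintype.card_fin]
  exact finrank_Uspace_le n l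

lemma finrank_Uspace {n l : ℕ} (hl : l ≤ n) : Module.finrank ℂ (Uspace n l) = 2 * l + 1 := by
  rw [Uspace_eq_span hl, finrank_span_eq_card (linearIndependent_ladder hl le_rfl), Fintype.card_fin]

/-- Expand E^m in the ladder and apply ad E. It kills E^m and rung 0 and moves the other rungs to
independent vectors with nonzero factors, so only rung 0, a multiple of E^l, remains. -/
lemma eq_of_Eop_pow_mem {n l m : ℕ} (hl : l ≤ n) (hm : m ≤ n) (h : Eop n ^ m ∈ Uspace n l) :
    m = l := by
  rw [Uspace_eq_span hl, Submodule.mem_span_range_iff_exists_fun] at h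
  obtain ⟨c, hc⟩ := h
  rw [Fin.sum_univ_succ] at hc
  have h1 := congrArg (adm (Eop n)) hc
  have h0 : adm (Eop n) (ladder n l 0) = 0 := lie_E_E_pow n l
  simp only [map_add, map_sum, map_smul, lie_E_E_pow, Fin.val_zero, h0, smul_zero, zero_add,
    Fin.val_succ, lie_E_ladder_succ, smul_smul] at h1
  have h2 := Fintype.linearIndependent_iff.1
    (linearIndependent_ladder (N := 2 * l) hl (by omega)) _ h1
  have h3 : ∀ j : Fin (2 * l), c j.succ = 0 := fun j => by
    refine (mul_eq_zero.1 (h2 j)).resolve_right (mul_ne_zero (Nat.cast_add_one_ne_zero _) ?_)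
    have : ((j : ℕ) : ℂ) ≠ (2 * l : ℕ) := by exact_mod_cast j.2.ne
    push_cast at this
    exact sub_ne_zero.2 this.symm
  simp only [h3, zero_smul, Finset.sum_const_zero, add_zero] at hc
  by_contra hne
  have h4 := Eop_pow_apply_ne_zero n m 0 ⟨m, by omega⟩ (by simp)
  rw [← hc] at h4
  refine h4 ?_
  change c 0 * (Eop n ^ l) 0 ⟨m, by omega⟩ = 0
  rw [Eop_pow_apply_eq_zero n l 0 ⟨m, by omega⟩ (by simpa using Ne.symm hne), mul_zero]

lemma isIrred_Uspace {n l : ℕ} (hl : l ≤ n) : IsIrred (Uspace n l) := by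
  refine ⟨isInvariant_Uspace n l, fun h => ?_, fun U hU hle => ?_⟩
  · have := Eop_pow_mem_Uspace n l
    rw [h, Submodule.mem_bot] at this
    exact Eop_pow_ne_zero hl this
  · by_cases hb : U = ⊥
    · exact Or.inl hb
    · obtain ⟨m, hm, hmU⟩ := exists_Eop_pow_mem hU hb
      obtain rfl := eq_of_Eop_pow_mem hl hm (hle hmU)
      exact Or.inr (le_antisymm hle (Uspace_eq_span hl ▸ span_ladder_le hU hmU))

/-- An irreducible subspace contains some E^m, hence its whole ladder, and equals that span by
irreducibility; the dimension 2l+1 forces m = l. So the supremum has a single member. -/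
lemma W_eq {n l : ℕ} (hl : l ≤ n) : W n l = Uspace n l := by
  refine le_antisymm (sSup_le ?_) (le_sSup ⟨isIrred_Uspace hl, finrank_Uspace hl⟩)
  rintro U ⟨⟨hU, hb, hmin⟩, hdim⟩
  obtain ⟨m, hm, hmU⟩ := exists_Eop_pow_mem hU hb
  have h := (hmin _ (isInvariant_Uspace n m) (Uspace_eq_span hm ▸ span_ladder_le hU hmU)).resolve_left
    (isIrred_Uspace hm).2.1
  rw [← h, finrank_Uspace hm] at hdim
  obtain rfl : m = l := by omega
  exact h.ge

/-! ### The diagonal matrices in `W` -/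

lemma adm_H_eq_zero_iff {n : ℕ} {A : EndV n} : adm (Hop n) A = 0 ↔ A.IsDiag := by
  refine ⟨fun h i j hij => ?_, fun h => ?_⟩
  · have := congrFun (congrFun h i) j
    rw [lie_H_apply] at this
    refine (mul_eq_zero.1 this).resolve_left (mul_ne_zero two_ne_zero (sub_ne_zero.2 ?_))
    exact fun e => hij (Fin.ext (by exact_mod_cast e.symm))
  · ext i j
    rw [lie_H_apply]
    by_cases hij : i = j
    · simp [hij]
    · simp [h hij]

lemma isDiag_ladder (n l : ℕ) : (ladder n l l).IsDiag := by
  rw [← adm_H_eq_zero_iff, lie_H_ladder, sub_self, zero_smul]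

/-- Diagonal means weight zero for ad H, and rung l is the only one of weight zero. -/
lemma isDiag_and_mem_W_iff {n l : ℕ} (hl : l ≤ n) (A : EndV n) :
    (A.IsDiag ∧ A ∈ W n l) ↔ ∃ c : ℂ, A = c • ladder n l l := by
  rw [W_eq hl]
  refine ⟨fun ⟨hd, hA⟩ => ?_, ?_⟩
  · rw [Uspace_eq_span hl, Submodule.mem_span_range_iff_exists_fun] at hA
    obtain ⟨c, rfl⟩ := hA
    rw [← adm_H_eq_zero_iff] at hd
    simp only [map_sum, map_smul, lie_H_ladder, smul_smul] at hd
    have h2 := Fintype.linearIndependent_iff.1 (linearIndependent_ladder hl le_rfl) _ hd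
    refine ⟨c ⟨l, by omega⟩, Finset.sum_eq_single _ (fun j _ hj => ?_) (by simp)⟩
    rw [(mul_eq_zero.1 (h2 j)).resolve_right ?_, zero_smul]
    refine fun e => hj (Fin.ext ?_)
    have : ((j : ℕ) : ℂ) = l := by linear_combination (-1 / 2 : ℂ) * e
    exact_mod_cast this
  · rintro ⟨c, rfl⟩
    refine ⟨(isDiag_ladder n l).smul c, Submodule.smul_mem _ _ ?_⟩
    exact ladder_mem (isInvariant_Uspace n l) (Eop_pow_mem_Uspace n l) l

-- A finite difference lowers the degree by one, with a controlled top coefficient.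
open Polynomial in
lemma coeff_taylor_sub {p : ℂ[X]} {j : ℕ} (hp : p.natDegree ≤ j + 1) (r : ℂ) :
    (taylor r p - p).natDegree ≤ j ∧ (taylor r p - p).coeff j = (j + 1) * r * p.coeff (j + 1) := by
  have h1 : (hasseDeriv j p).natDegree < 2 :=
    (natDegree_hasseDeriv_le p j).trans_lt (by omega)
  have h2 : (hasseDeriv (j + 1) p).natDegree < 1 :=
    (natDegree_hasseDeriv_le p (j + 1)).trans_lt (by omega)
  refine ⟨natDegree_le_iff_coeff_eq_zero.2 fun N hN => ?_, ?_⟩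
  · rcases (Nat.succ_le_of_lt hN).eq_or_lt with rfl | hN'
    · rw [coeff_sub, taylor_coeff, eval_eq_sum_range' h2]
      simp [hasseDeriv_coeff]
    · rw [coeff_sub, coeff_eq_zero_of_natDegree_lt (by rw [natDegree_taylor]; omega),
        coeff_eq_zero_of_natDegree_lt (by omega), sub_zero]
  · rw [coeff_sub, taylor_coeff, eval_eq_sum_range' h1]
    simp [hasseDeriv_coeff, Finset.sum_range_succ, add_comm 1 j]
    ring

open Polynomial in
lemma Fop_mul_aeval (n : ℕ) (p : ℂ[X]) :
    Fop n * aeval (B1 n) p = aeval (B1 n) (taylor (-2) p) * Fop n := by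
  ext i j
  rw [aeval_B1, aeval_B1, Matrix.mul_diagonal, Matrix.diagonal_mul, taylor_eval, mul_comm]
  by_cases h : Fop n i j = 0
  · simp [h]
  · rw [Fop_apply] at h
    have hij : (i : ℕ) = j + 1 := by
      by_contra hne
      exact h (if_neg (by omega))
    rw [hij]; congr 2; push_cast; ring

open Polynomial in
lemma Eop_pow_mul_aeval (n k : ℕ) (p : ℂ[X]) :
    Eop n ^ k * aeval (B1 n) p = aeval (B1 n) (taylor (2 * (k : ℂ)) p) * Eop n ^ k := by
  ext i j
  rw [aeval_B1, aeval_B1, Matrix.mul_diagonal, Matrix.diagonal_mul, taylor_eval, mul_comm]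
  by_cases h : (Eop n ^ k) i j = 0
  · simp [h]
  · have hij : (i : ℕ) + k = j := by
      by_contra hne
      exact h (Eop_pow_apply_eq_zero n k i j hne)
    rw [← hij]; congr 2; push_cast; ring

-- Moving E and F past functions of B_n^1 shifts the argument, and FE and EF are quadratic
-- polynomials in B_n^1. Commuting with F therefore sends p(B_n^1) E^{k+1} to another polynomial
-- times E^k.
open Polynomial in
lemma exists_ladder_poly (n l j : ℕ) (hj : j ≤ l) : ∃ p : ℂ[X], p.natDegree ≤ j ∧ p.coeff j ≠ 0 ∧
    ladder n l j = aeval (B1 n) p * Eop n ^ (l - j) := by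
  induction j with
  | zero => exact ⟨1, by simp, by simp, by simp [ladder]⟩
  | succ j ih =>
    obtain ⟨p, hp, hc, e⟩ := ih (by omega)
    obtain ⟨k, hk⟩ : ∃ k, l - j = k + 1 := ⟨l - j - 1, by omega⟩
    set c : ℂ[X] := C (1 / 4) * ((C (n : ℂ) + X) * (C ((n : ℂ) + 2) - X)) with hcdef
    set d : ℂ[X] := C (1 / 4) * ((C (n : ℂ) + 2 + X) * (C (n : ℂ) - X)) with hddef
    have hFE : Fop n * Eop n = aeval (B1 n) c := by
      rw [Fop_mul_Eop, aeval_B1]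
      congr 1; ext j; simp [hcdef]; ring
    have hEF : Eop n * Fop n = aeval (B1 n) d := by
      rw [Eop_mul_Fop, aeval_B1]
      congr 1; ext j; simp [hddef]; ring
    have hcd : c - taylor (2 * (k : ℂ)) d = C ((k : ℂ) + 1) * X + C (((k : ℂ) + 1) * k) := by
      refine Polynomial.funext fun x => ?_
      rw [eval_sub, taylor_eval]
      simp [hcdef, hddef]; ring
    -- The commutator gives p(x-2) c(x) - p(x) d(x+2k). Grouped this way, a difference of degree j-1
    -- meets the quadratic c, and p meets the linear c(x) - d(x+2k), so the degree rises by exactly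
    -- one.
    refine ⟨(taylor (-2) p - p) * c + p * (C ((k : ℂ) + 1) * X + C (((k : ℂ) + 1) * k)), ?_, ?_, ?_⟩
    rotate_right
    · rw [ladder_succ, e, adm_apply, ← hcd, show l - (j + 1) = k by omega, hk, ← mul_assoc,
        Fop_mul_aeval, pow_succ', mul_assoc (aeval (B1 n) (taylor (-2) p)), ← mul_assoc (Fop n), hFE,
        ← pow_succ', pow_succ, mul_assoc (aeval (B1 n) p), mul_assoc (Eop n ^ k), hEF,
        Eop_pow_mul_aeval, ← mul_assoc, ← mul_assoc, ← map_mul (aeval (B1 n) : ℂ[X] →ₐ[ℂ] EndV n), ← map_mul (aeval (B1 n) : ℂ[X] →ₐ[ℂ] EndV n),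
        ← sub_mul, ← map_sub (aeval (B1 n) : ℂ[X] →ₐ[ℂ] EndV n)]
      congr 2; ring
    all_goals
      have hX : (C ((k : ℂ) + 1) * X + C (((k : ℂ) + 1) * k)).natDegree ≤ 1 := by
        compute_degree
      have hc2 : c.natDegree ≤ 2 := by rw [hcdef]; compute_degree
    · cases j with
      | zero =>
        rw [eq_C_of_natDegree_le_zero hp, taylor_C, sub_self, zero_mul, zero_add]
        exact natDegree_mul_le_of_le (natDegree_C _).le hX
      | succ j =>
        exact natDegree_add_le_of_degree_le
          (natDegree_mul_le_of_le (m := j) (n := 2) (coeff_taylor_sub hp (-2)).1 hc2)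
          (natDegree_mul_le_of_le hp hX)
    · have hXc : (C ((k : ℂ) + 1) * X + C (((k : ℂ) + 1) * k)).coeff 1 = (k : ℂ) + 1 := by
        rw [coeff_add, coeff_C_mul, coeff_X_one, coeff_C_succ, mul_one, add_zero]
      have hcc : c.coeff 2 = -1 / 4 := by
        rw [show c = C (1 / 4 * (n * (n + 2) : ℂ)) + C (1 / 2) * X + C (-1 / 4) * X ^ 2 from
          Polynomial.funext fun x => by simp [hcdef]; ring]
        simp only [coeff_add, coeff_C_mul, coeff_X_pow, coeff_X, coeff_C]; norm_num
      rw [coeff_add, coeff_mul_add_eq_of_natDegree_le hp hX, hXc]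
      cases j with
      | zero =>
        rw [eq_C_of_natDegree_le_zero hp, taylor_C, sub_self, zero_mul, coeff_zero, zero_add,
          coeff_C_zero]
        exact mul_ne_zero hc (by exact_mod_cast k.succ_ne_zero)
      | succ j =>
        obtain ⟨h1, h2⟩ := coeff_taylor_sub hp (-2)
        rw [show j + 1 + 1 = j + 2 from rfl, coeff_mul_add_eq_of_natDegree_le h1 hc2, h2, hcc]
        -- Both contributions to the top coefficient are positive multiples of that of p, so they
        -- cannot cancel.
        have : ((j : ℂ) + 1) * -2 * p.coeff (j + 1) * (-1 / 4) + p.coeff (j + 1) * (k + 1)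
            = p.coeff (j + 1) * (((j + 2 * k + 3 : ℕ) : ℂ) / 2) := by push_cast; ring
        rw [this]
        exact mul_ne_zero hc (div_ne_zero (Nat.cast_ne_zero.2 (by omega)) two_ne_zero)

lemma exists_isDiagPoly {n l : ℕ} (hl : l ≤ n) : ∃ q, IsDiagPoly n l q := by
  obtain ⟨p, hp, hc, e⟩ := exists_ladder_poly n l l le_rfl
  rw [Nat.sub_self, pow_zero, mul_one] at e
  have hdeg : p.natDegree = l := le_antisymm hp (Polynomial.le_natDegree_of_ne_zero hc)
  have hlead : p.leadingCoeff = p.coeff l := by rw [Polynomial.leadingCoeff, hdeg]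
  refine ⟨Polynomial.C (p.coeff l)⁻¹ * p, ?_, ?_, fun A => ?_⟩
  · rw [Polynomial.Monic, Polynomial.leadingCoeff_mul, hlead, Polynomial.leadingCoeff_C,
      inv_mul_cancel₀ hc]
  · rw [Polynomial.natDegree_C_mul (inv_ne_zero hc), hdeg]
  · rw [isDiag_and_mem_W_iff hl, e, ← Polynomial.smul_eq_C_mul, map_smul]
    exact ⟨fun ⟨c, h⟩ => ⟨c * p.coeff l, by rw [h, smul_smul, mul_assoc, mul_inv_cancel₀ hc, mul_one]⟩,
      fun ⟨c, h⟩ => ⟨c * (p.coeff l)⁻¹, by rw [h, smul_smul]⟩⟩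

lemma isDiagPoly_qPoly {n l : ℕ} (hl : l ≤ n) : IsDiagPoly n l (qPoly n l) :=
  Classical.epsilon_spec (exists_isDiagPoly hl)

end
end MotionGroup
-- Equivariant functions: the symbol Q and the division by it.
namespace MotionGroup

noncomputable section

/-! ### The polynomial `Q` -/

/-- The symbol of `𝐃_n`, up to the factor `4π²`. -/
def Dsym (n : ℕ) (z : C2) : EndV n :=
  (2 * (z 0 * conj (z 1))) • Eop n + (2 * (z 1 * conj (z 0))) • Fop n
    + (z 0 * conj (z 0) - z 1 * conj (z 1)) • Hop n

lemma Dsym_eq_dtau (n : ℕ) (z : C2) : Dsym n z =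
    dtau n !![z 0 * conj (z 0) - z 1 * conj (z 1), 2 * (z 0 * conj (z 1));
      2 * (z 1 * conj (z 0)), -(z 0 * conj (z 0) - z 1 * conj (z 1))] := (dtau_eq n _ _ _).symm

lemma norm_sq_C2 (z : C2) : ((‖z‖ ^ 2 : ℝ) : ℂ) = z 0 * conj (z 0) + z 1 * conj (z 1) := by
  rw [EuclideanSpace.norm_sq_eq, Fin.sum_univ_two, Complex.ofReal_add]
  simp only [Complex.mul_conj', Complex.ofReal_pow]

lemma sphereMatrix_mul_conjTranspose (z : C2) : sphereMatrix z * (sphereMatrix z)ᴴ = 1 := by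
  rw [sphereMatrix]
  split_ifs with h
  · simp
  · have hz : ((‖z‖ : ℝ) : ℂ) ≠ 0 := by exact_mod_cast norm_ne_zero_iff.2 h
    have h2 := norm_sq_C2 z
    rw [Complex.ofReal_pow] at h2
    ext i j
    fin_cases i <;> fin_cases j <;> simp [Matrix.mul_apply, Matrix.conjTranspose_apply] <;>
      field_simp <;> (try rw [h2]) <;> ring

lemma sphereMatrix_mem (z : C2) : sphereMatrix z ∈ Matrix.unitaryGroup (Fin 2) ℂ :=
  Matrix.mem_unitaryGroup_iff.2 (sphereMatrix_mul_conjTranspose z)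

/-- The point `(0, r)` of `ℂ²`. -/
def axis : ℝ →ₗᵢ[ℝ] C2 where
  toFun r := WithLp.toLp 2 ![0, (r : ℂ)]
  map_add' r s := by ext i; fin_cases i <;> simp
  map_smul' r s := by ext i; fin_cases i <;> simp
  norm_map' r := by simp [EuclideanSpace.norm_eq, Real.sqrt_sq_eq_abs]

@[simp] lemma axis_zero_apply (r : ℝ) : axis r 0 = 0 := rfl
@[simp] lemma axis_one_apply (r : ℝ) : axis r 1 = r := rfl

lemma act_sphereMatrix (z : C2) : act (sphereMatrix z) (axis ‖z‖) = z := by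
  by_cases h : z = 0
  · subst h; simp [act]
  · have hz : ((‖z‖ : ℝ) : ℂ) ≠ 0 := by exact_mod_cast norm_ne_zero_iff.2 h
    ext i
    fin_cases i <;> simp [act, sphereMatrix, h, dotProduct, Fin.sum_univ_two] <;>
      field_simp

lemma norm_sq_smul_conj_B1 (n : ℕ) (z : C2) (hz : z ≠ 0) :
    ((‖z‖ ^ 2 : ℝ) : ℂ) • (tau n (sphereMatrix z) * B1 n * tau n (sphereMatrix z)⁻¹) = Dsym n z := by
  have hz' : ((‖z‖ : ℝ) : ℂ) ≠ 0 := by exact_mod_cast norm_ne_zero_iff.2 hz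
  have hB : B1 n = dtau n !![-1, 0; 0, 1] := by
    rw [B1_eq, Hop, ← neg_one_smul ℂ, ← dtau_smul]; congr 1
    ext i j; fin_cases i <;> fin_cases j <;> simp
  have h := tau_conj_dtau_pow (n := n) (unitary_isUnit_det (sphereMatrix_mem z)) !![-1, 0; 0, 1] 1
  rw [pow_one, pow_one] at h
  rw [hB, h, ← dtau_smul, Dsym_eq_dtau, unitary_inv (sphereMatrix_mem z)]
  congr 1
  rw [sphereMatrix, if_neg hz]
  ext i j
  simp only [Matrix.mul_apply, Matrix.conjTranspose_apply, Fin.sum_univ_two, Matrix.smul_apply]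
  fin_cases i <;> fin_cases j <;> simp <;> field_simp <;> ring

lemma pow_conj {n : ℕ} {k : Matrix (Fin 2) (Fin 2) ℂ} (hk : IsUnit k.det) (A : EndV n) (j : ℕ) :
    tau n k * A ^ j * tau n k⁻¹ = (tau n k * A * tau n k⁻¹) ^ j := by
  have h : SemiconjBy (tau n k) A (tau n k * A * tau n k⁻¹) := by
    rw [SemiconjBy, mul_assoc, tau_inv_mul hk, mul_one]
  rw [(h.pow_right j).eq, mul_assoc, tau_mul_inv hk, mul_one]

lemma B_eq_sum {n l : ℕ} (hl : l ≤ n) :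
    B n l = ∑ k ∈ Finset.range (l + 1), (qPoly n l).coeff k • B1 n ^ k := by
  rw [B, Polynomial.aeval_eq_sum_range, (isDiagPoly_qPoly hl).2.1]

lemma Q_eq_conj (n l : ℕ) (z : C2) : Q n l z =
    ((‖z‖ ^ (2 * l) : ℝ) : ℂ) • (tau n (sphereMatrix z) * B n l * tau n (sphereMatrix z)⁻¹) := by
  rw [Q, QB, tau_conjTranspose (sphereMatrix_mem z)]

/-- Conjugation commutes with polynomials, and |z|² times the conjugate of B_n^1 is `Dsym`. This
shows that Q is a polynomial and has the form of the homogenised operator. At z = 0 only the case l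
= 0 gives a nonzero value. -/
lemma Q_eq_sum {n l : ℕ} (hl : l ≤ n) (z : C2) : Q n l z =
    ∑ k ∈ Finset.range (l + 1),
      (qPoly n l).coeff k • ((‖z‖ ^ (2 * (l - k)) : ℝ) : ℂ) • Dsym n z ^ k := by
  by_cases hz : z = 0
  · subst hz
    have hD : Dsym n 0 = 0 := by simp [Dsym]
    rw [Q_eq_conj, sphereMatrix, if_pos rfl, inv_one, tau_one, one_mul, mul_one, hD, norm_zero]
    rcases Nat.eq_zero_or_pos l with rfl | hl0
    · simp [B_eq_sum hl]
    · rw [Finset.sum_eq_zero, zero_pow (by omega), Complex.ofReal_zero, zero_smul]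
      intro k hk
      rcases (Nat.lt_succ_iff.1 (Finset.mem_range.1 hk)).eq_or_lt with rfl | hk'
      · rw [zero_pow hl0.ne', smul_zero, smul_zero]
      · rw [zero_pow (by omega), Complex.ofReal_zero, zero_smul, smul_zero]
  · rw [Q_eq_conj, B_eq_sum hl, Finset.mul_sum, Finset.sum_mul, Finset.smul_sum]
    refine Finset.sum_congr rfl fun k hk => ?_
    have hk' : k ≤ l := Nat.lt_succ_iff.1 (Finset.mem_range.1 hk)
    rw [mul_smul_comm, smul_mul_assoc, pow_conj (unitary_isUnit_det (sphereMatrix_mem z)),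
      ← norm_sq_smul_conj_B1 n z hz, smul_pow, smul_comm]
    congr 1
    rw [smul_smul]
    congr 1
    rw [← Complex.ofReal_pow, ← Complex.ofReal_mul, ← pow_mul, ← pow_add]
    congr 2; omega

lemma continuous_Dsym (n : ℕ) : Continuous (Dsym n) := by
  unfold Dsym
  fun_prop

lemma continuous_Q {n l : ℕ} (hl : l ≤ n) : Continuous (Q n l) := by
  rw [funext (Q_eq_sum hl)]
  have := continuous_Dsym n
  refine continuous_finsetSum _ fun k hk => ?_
  have h1 : Continuous fun z : C2 => ((‖z‖ ^ (2 * (l - k)) : ℝ) : ℂ) := by fun_prop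
  have h2 : Continuous fun z => Dsym n z ^ k := by
    clear h1 hk
    induction k with
    | zero => simpa using continuous_const
    | succ k ih => simp only [pow_succ]; exact Continuous.matrix_mul ih this
  exact Continuous.const_smul (g := fun z : C2 => ((‖z‖ ^ (2 * (l - k)) : ℝ) : ℂ) • Dsym n z ^ k)
    (h1.smul h2) ((qPoly n l).coeff k)

lemma Dsym_real_smul (n : ℕ) (t : ℝ) (z : C2) : Dsym n (t • z) = ((t ^ 2 : ℝ) : ℂ) • Dsym n z := by
  simp only [Dsym, PiLp.smul_apply, Complex.real_smul, map_mul, Complex.conj_ofReal, smul_add,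
    smul_smul]
  push_cast
  congr 1
  · congr 1
    · congr 1; ring
    · congr 1; ring
  · congr 1; ring

lemma Q_real_smul {n l : ℕ} (hl : l ≤ n) (t : ℝ) (z : C2) :
    Q n l (t • z) = ((t ^ (2 * l) : ℝ) : ℂ) • Q n l z := by
  rw [Q_eq_sum hl, Q_eq_sum hl, Finset.smul_sum]
  refine Finset.sum_congr rfl fun k hk => ?_
  have hk' : k ≤ l := Nat.lt_succ_iff.1 (Finset.mem_range.1 hk)
  rw [Dsym_real_smul, smul_pow, smul_comm (_ : ℂ) ((qPoly n l).coeff k)]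
  congr 1
  rw [smul_smul, smul_smul]
  congr 1
  rw [← Complex.ofReal_pow, ← Complex.ofReal_mul, ← Complex.ofReal_mul, norm_smul, mul_pow,
    Real.norm_eq_abs, pow_mul |t|, sq_abs, ← pow_mul, ← pow_mul, mul_right_comm, ← pow_add]
  congr 3; omega

/-- `Dsym` is tridiagonal, so the k-th superdiagonal of its k-th power involves only the E part. -/
lemma Dsym_pow_apply (n : ℕ) (z : C2) (k : ℕ) (i j : Fin (n + 1)) :
    ((i : ℕ) + k < j → (Dsym n z ^ k) i j = 0) ∧
    ((i : ℕ) + k = j → (Dsym n z ^ k) i j = (2 * (z 0 * conj (z 1))) ^ k * (Eop n ^ k) i j) := by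
  have hE : ∀ i j : Fin (n + 1), (i : ℕ) < j →
      Dsym n z i j = (2 * (z 0 * conj (z 1))) * Eop n i j := fun i j hij => by
    have h1 : Fop n i j = 0 := by rw [Fop_apply, if_neg (by omega)]
    have h2 : Hop n i j = 0 := by
      rw [Hop_eq, Matrix.diagonal_apply_ne _ (fun e => hij.ne (by rw [e]))]
    simp [Dsym, h1, h2]
  have hE0 : ∀ i j : Fin (n + 1), (i : ℕ) + 1 < j → Eop n i j = 0 := fun i j hij => by
    rw [Eop_apply, if_neg (by omega)]
  induction k generalizing i j with
  | zero =>
    refine ⟨fun h => ?_, fun h => by simp⟩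
    rw [pow_zero, Matrix.one_apply_ne (fun e => by simp [e] at h)]
  | succ k ih =>
    refine ⟨fun h => ?_, fun h => ?_⟩
    · rw [pow_succ, Matrix.mul_apply]
      refine Finset.sum_eq_zero fun m _ => ?_
      by_cases hm : (i : ℕ) + k < m
      · rw [(ih i m).1 hm, zero_mul]
      · rw [hE m j (by omega), hE0 m j (by omega), mul_zero, mul_zero]
    · rw [pow_succ, pow_succ (Eop n), Matrix.mul_apply, Matrix.mul_apply, Finset.mul_sum]
      refine Finset.sum_congr rfl fun m _ => ?_
      rcases lt_trichotomy ((i : ℕ) + k) m with hm | hm | hm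
      · rw [(ih i m).1 hm, Eop_pow_apply_eq_zero n k i m hm.ne, zero_mul, zero_mul, mul_zero]
      · rw [(ih i m).2 hm, hE m j (by omega)]; ring
      · rw [hE m j (by omega), hE0 m j (by omega)]; ring

/-- Only the power k = l reaches the entry (0, l), and its coefficient is 1 because the polynomial
is monic. -/
lemma Q_corner {n l : ℕ} (hl : l ≤ n) (z : C2) :
    Q n l z 0 ⟨l, by omega⟩ =
      (2 ^ l * (Eop n ^ l) 0 ⟨l, by omega⟩) * (z 0 * conj (z 1)) ^ l := by
  have hq := isDiagPoly_qPoly hl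
  have hc : (qPoly n l).coeff l = 1 := by
    have := hq.1
    rwa [Polynomial.Monic, Polynomial.leadingCoeff, hq.2.1] at this
  rw [Q_eq_sum hl, Finset.sum_range_succ, Matrix.add_apply, Matrix.sum_apply, Finset.sum_eq_zero,
    hc, Nat.sub_self, zero_add, one_smul, mul_zero, pow_zero, Complex.ofReal_one, one_smul,
    (Dsym_pow_apply n z l 0 ⟨l, by omega⟩).2 (by simp)]
  · ring
  · intro k hk
    have hk' := Finset.mem_range.1 hk
    rw [Matrix.smul_apply, Matrix.smul_apply,
      (Dsym_pow_apply n z k 0 ⟨l, by omega⟩).1 (by simpa using hk'), smul_zero, smul_zero]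

/-! ### Equivariant functions with values in `W` -/

lemma B_isDiag (n l : ℕ) : (B n l).IsDiag := by
  rw [B, aeval_B1]; exact Matrix.isDiag_diagonal _

lemma exists_B_apply_ne_zero {n l : ℕ} (hl : l ≤ n) : ∃ i, B n l i i ≠ 0 := by
  by_contra! h
  have hB : B n l = 0 := by
    ext i j
    by_cases hij : i = j
    · subst hij; exact h i
    · exact B_isDiag n l hij
  obtain ⟨c, hc⟩ := ((isDiagPoly_qPoly hl).2.2 (ladder n l l)).1
    ((isDiag_and_mem_W_iff hl _).2 ⟨1, (one_smul _ _).symm⟩)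
  change _ = c • B n l at hc
  rw [hB, smul_zero] at hc
  exact ladder_ne_zero hl (by omega) hc

lemma tau_diagonal (n : ℕ) (a : ℂ) (ha : a ≠ 0) :
    tau n !![a, 0; 0, 1] = Matrix.diagonal fun j : Fin (n + 1) => (a ^ (j : ℕ))⁻¹ := by
  refine matrix_ext_ev fun z => ?_
  have hinv : (!![a, 0; 0, 1] : Matrix (Fin 2) (Fin 2) ℂ)⁻¹ = !![a⁻¹, 0; 0, 1] :=
    Matrix.inv_eq_right_inv (by
      ext i j; fin_cases i <;> fin_cases j <;> simp [Matrix.mul_apply, ha])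
  ext j
  rw [ev_vecMul_tau, hinv, Matrix.vecMul_diagonal]
  simp [ev, Matrix.mulVec, dotProduct, Fin.sum_univ_two, mul_pow]
  ring

/-- The elements diag(a, 1) fix the axis, so the value there commutes with the diagonal matrices
with entries a^{-j}. -/
lemma IsEquivariant.isDiag_axis {n : ℕ} {F : C2 → EndV n} (hF : IsEquivariant F) (r : ℝ) :
    (F (axis r)).IsDiag := by
  have key : ∀ a : ℂ, a * conj a = 1 → ∀ i j : Fin (n + 1),
      a ^ (i : ℕ) * F (axis r) i j = a ^ (j : ℕ) * F (axis r) i j := fun a ha i j => by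
    have ha0 : a ≠ 0 := left_ne_zero_of_mul_eq_one ha
    have hk : (!![a, 0; 0, 1] : Matrix (Fin 2) (Fin 2) ℂ) ∈ Matrix.unitaryGroup (Fin 2) ℂ := by
      rw [Matrix.mem_unitaryGroup_iff, Matrix.star_eq_conjTranspose]
      ext i j; fin_cases i <;> fin_cases j <;>
        simp [Matrix.mul_apply, Matrix.conjTranspose_apply, ha]
    have hact : act !![a, 0; 0, 1] (axis r) = axis r := by
      ext i; fin_cases i <;> simp [act, dotProduct, Fin.sum_univ_two]
    have h := hF _ hk (axis r)
    rw [hact] at h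
    have h2 : F (axis r) * tau n !![a, 0; 0, 1] = tau n !![a, 0; 0, 1] * F (axis r) := by
      conv_lhs => rw [h]
      rw [mul_assoc, tau_inv_mul (unitary_isUnit_det hk), mul_one]
    rw [tau_diagonal n a ha0] at h2
    have h3 := congrFun (congrFun h2 i) j
    rw [Matrix.mul_diagonal, Matrix.diagonal_mul] at h3
    have hi : a ^ (i : ℕ) ≠ 0 := pow_ne_zero _ ha0
    have hj : a ^ (j : ℕ) ≠ 0 := pow_ne_zero _ ha0
    field_simp at h3
    linear_combination h3
  have main : ∀ (i j : Fin (n + 1)) (p q : ℕ), p < q → (∀ a : ℂ, a * conj a = 1 →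
      a ^ p * F (axis r) i j = a ^ q * F (axis r) i j) → F (axis r) i j = 0 := by
    intro i j p q hpq h
    have hd : ((q - p : ℕ) : ℂ) ≠ 0 := Nat.cast_ne_zero.2 (by omega)
    -- Chosen so that a^{q-p} = -1, which makes the two sides opposite.
    set a : ℂ := Complex.exp ((Real.pi / (q - p : ℕ) : ℝ) * Complex.I) with ha
    have ha1 : a * conj a = 1 := by
      rw [Complex.mul_conj', ha, Complex.norm_exp_ofReal_mul_I]; simp
    have ha2 : a ^ (q - p) = -1 := by
      rw [ha, ← Complex.exp_nat_mul, ← Complex.exp_pi_mul_I]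
      congr 1; push_cast [Nat.cast_sub hpq.le] at hd ⊢; field_simp
    have h1 := h a ha1
    rw [show q = p + (q - p) by omega, pow_add, ha2] at h1
    have ha0 : a ^ p ≠ 0 := pow_ne_zero _ (left_ne_zero_of_mul_eq_one ha1)
    have : a ^ p * (2 * F (axis r) i j) = 0 := by linear_combination h1
    simpa [ha0] using this
  intro i j hij
  rcases lt_or_gt_of_ne (fun e => hij (Fin.ext e) : (i : ℕ) ≠ j) with h | h
  · exact main i j _ _ h fun a ha => key a ha i j
  · exact main i j _ _ h fun a ha => (key a ha i j).symm

lemma IsEquivariant.apply_axis {n l : ℕ} (hl : l ≤ n) {F : C2 → EndV n} (hF : IsEquivariant F)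
    (hW : ∀ z, F z ∈ W n l) {i : Fin (n + 1)} (hi : B n l i i ≠ 0) (r : ℝ) :
    F (axis r) = (F (axis r) i i / B n l i i) • B n l := by
  obtain ⟨c, hc⟩ := ((isDiagPoly_qPoly hl).2.2 (F (axis r))).1 ⟨hF.isDiag_axis r, hW _⟩
  change _ = c • B n l at hc
  rw [hc, Matrix.smul_apply, smul_eq_mul, mul_div_cancel_right₀ _ hi]

/-- Transport the value at (0, |z|) to z by k_{z'}. -/
lemma IsEquivariant.norm_pow_smul {n l : ℕ} (hl : l ≤ n) {F : C2 → EndV n} (hF : IsEquivariant F)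
    (hW : ∀ z, F z ∈ W n l) {i : Fin (n + 1)} (hi : B n l i i ≠ 0) (z : C2) :
    ((‖z‖ ^ (2 * l) : ℝ) : ℂ) • F z = (F (axis ‖z‖) i i / B n l i i) • Q n l z := by
  have h := hF _ (sphereMatrix_mem z) (axis ‖z‖)
  rw [act_sphereMatrix, hF.apply_axis hl hW hi] at h
  rw [h, Q_eq_conj, mul_smul_comm, smul_mul_assoc, smul_comm]

lemma tau_neg_one (n : ℕ) : tau n (-1) = ((-1) ^ n : ℂ) • (1 : EndV n) := by
  refine matrix_ext_ev fun z => ?_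
  have hinv : (-1 : Matrix (Fin 2) (Fin 2) ℂ)⁻¹ = -1 := Matrix.inv_eq_right_inv (by simp)
  ext j
  rw [ev_vecMul_tau, hinv, Matrix.vecMul_smul, Matrix.vecMul_one, Matrix.neg_mulVec,
    Matrix.one_mulVec, Pi.smul_apply, smul_eq_mul]
  have : ((-1 : ℂ)) ^ n = (-1) ^ (j : ℕ) * (-1) ^ (n - (j : ℕ)) := by
    rw [← pow_add]; congr 1; omega
  simp only [ev, Pi.neg_apply, this, neg_pow (z 0), neg_pow (z 1)]
  ring

/-- The element -1 of U(2) acts on V_n by a scalar, so conjugation by it is trivial. -/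
lemma IsEquivariant.apply_neg {n : ℕ} {F : C2 → EndV n} (hF : IsEquivariant F) (z : C2) :
    F (-z) = F z := by
  have hk : (-1 : Matrix (Fin 2) (Fin 2) ℂ) ∈ Matrix.unitaryGroup (Fin 2) ℂ := by
    rw [Matrix.mem_unitaryGroup_iff]; simp
  have h := hF _ hk z
  have hinv : (-1 : Matrix (Fin 2) (Fin 2) ℂ)⁻¹ = -1 := Matrix.inv_eq_right_inv (by simp)
  have hact : act (-1) z = -z := by ext i; simp [act, Matrix.neg_mulVec]
  rw [hact, hinv, tau_neg_one, smul_mul_assoc, one_mul, mul_smul_comm, mul_one, smul_smul,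
    ← mul_pow] at h
  simpa using h

end
end MotionGroup
-- Vanishing of the profile at the origin and the Schwartz radial factor.
namespace MotionGroup

noncomputable section

/-! ### Schwartz functions on `ℂ²` -/

/-- A matrix entry as a continuous linear functional. -/
def entryCLM (n : ℕ) (i j : Fin (n + 1)) : EndV n →L[ℂ] ℂ :=
  LinearMap.toContinuousLinearMap (Matrix.entryLinearMap ℂ ℂ i j)

@[simp] lemma entryCLM_apply {n : ℕ} (i j : Fin (n + 1)) (A : EndV n) : entryCLM n i j A = A i j := rfl

/-- The restriction of a Schwartz function to the axis `{(0, r)}`. -/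
def restrictAxis : 𝓢(C2, ℂ) →L[ℂ] 𝓢(ℝ, ℂ) :=
  compCLMOfAntilipschitz ℂ axis.toContinuousLinearMap.hasTemperateGrowth axis.antilipschitz

@[simp] lemma restrictAxis_apply (f : 𝓢(C2, ℂ)) (r : ℝ) : restrictAxis f r = f (axis r) := rfl

/-- The radial function `z ↦ h(|z|²)`. -/
def compNormSq : 𝓢(ℝ, ℂ) →L[ℂ] 𝓢(C2, ℂ) :=
  compCLM ℂ (g := fun z : C2 => ‖z‖ ^ 2) (Function.hasTemperateGrowth_norm_sq C2)
    ⟨1, 1, fun z => by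
      rw [Real.norm_of_nonneg (by positivity)]
      nlinarith [sq_nonneg (‖z‖ - 1)]⟩

@[simp] lemma compNormSq_apply (h : 𝓢(ℝ, ℂ)) (z : C2) : compNormSq h z = h (‖z‖ ^ 2) := rfl

/-- The function `r ↦ F(0, r)_{ii} / B_{ii}`. -/
def profile (n l : ℕ) (i : Fin (n + 1)) : 𝓢(C2, EndV n) →L[ℂ] 𝓢(ℝ, ℂ) :=
  (B n l i i)⁻¹ • restrictAxis.comp (postcompCLM (entryCLM n i i))

lemma profile_apply {n l : ℕ} {i : Fin (n + 1)} (F : 𝓢(C2, EndV n)) (r : ℝ) :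
    profile n l i F r = F (axis r) i i / B n l i i := by
  rw [div_eq_inv_mul]; rfl

lemma mul_divX_pow {f : 𝓢(ℝ, ℂ)} {m : ℕ} (h : ∀ j < m, (sderiv ^ j) f 0 = 0) (x : ℝ) :
    (x : ℂ) ^ m * (divX ^ m) f x = f x := by
  induction m generalizing f with
  | zero => simp
  | succ m ih =>
    have h0 : f 0 = 0 := h 0 (by omega)
    have h1 := ih (f := divX f) fun j hj => by
      have := sderiv_pow_divX_zero h0 j
      rw [h (j + 1) (by omega)] at this
      exact (mul_eq_zero.1 this).resolve_left (Nat.cast_add_one_ne_zero j)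
    rw [← mul_divX h0 x, ← h1, pow_succ, pow_succ, mul_comm ((x : ℂ) ^ m), mul_assoc]
    rfl

/-- The point `(x, 1)` of `ℂ²`. -/
def linePt (x : ℝ) : C2 := x • EuclideanSpace.single 0 1 + EuclideanSpace.single 1 1

@[simp] lemma linePt_zero (x : ℝ) : linePt x 0 = x := by simp [linePt]
@[simp] lemma linePt_one (x : ℝ) : linePt x 1 = 1 := by simp [linePt]

lemma norm_sq_linePt (x : ℝ) : ‖linePt x‖ ^ 2 = 1 + x ^ 2 := by
  rw [EuclideanSpace.norm_sq_eq, Fin.sum_univ_two]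
  simp [add_comm]

-- The m-th directional derivative along (x, 1) at the origin is polynomial in x, since the
-- direction is affine in x.
open LineDeriv in
lemma exists_polynomial_iteratedDeriv (m : ℕ) (G : 𝓢(C2, ℂ)) : ∃ P : Polynomial ℂ, ∀ x : ℝ,
    iteratedDeriv m (fun t : ℝ => G (t • linePt x)) 0 = P.eval (x : ℂ) := by
  induction m generalizing G with
  | zero => exact ⟨Polynomial.C (G 0), fun x => by simp⟩
  | succ m ih =>
    obtain ⟨P, hP⟩ := ih (∂_{(EuclideanSpace.single 0 1 : C2)} G)
    obtain ⟨R, hR⟩ := ih (∂_{(EuclideanSpace.single 1 1 : C2)} G)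
    refine ⟨Polynomial.X * P + R, fun x => ?_⟩
    have hcd : ∀ H : 𝓢(C2, ℂ), ContDiff ℝ m fun t : ℝ => H (t • linePt x) := fun H =>
      (H.smooth m).comp (contDiff_id.smul contDiff_const)
    have hd : deriv (fun t : ℝ => G (t • linePt x)) = fun t =>
        (x : ℂ) * (∂_{(EuclideanSpace.single 0 1 : C2)} G) (t • linePt x) +
          (∂_{(EuclideanSpace.single 1 1 : C2)} G) (t • linePt x) := by
      funext t
      have h1 : HasDerivAt (fun t : ℝ => t • linePt x) ((1 : ℝ) • linePt x) t :=
        (hasDerivAt_id t).smul_const _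
      have h2 := (G.hasFDerivAt (t • linePt x)).comp_hasDerivAt t h1
      refine h2.deriv.trans ?_
      rw [one_smul, lineDerivOp_apply_eq_fderiv, lineDerivOp_apply_eq_fderiv, linePt, map_add,
        map_smul, Complex.real_smul]
    rw [iteratedDeriv_succ', hd, iteratedDeriv_fun_add (contDiff_const.mul (hcd _)).contDiffAt
      (hcd _).contDiffAt, iteratedDeriv_const_mul_field, hP, hR]
    simp

lemma profile_even {n l : ℕ} {i : Fin (n + 1)} {G : 𝓢(C2, EndV n)} (hG : IsEquivariant G)
    (r : ℝ) : profile n l i G (-r) = profile n l i G r := by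
  rw [profile_apply, profile_apply, map_neg, hG.apply_neg]

/-- For t ≠ 0 this is the corner entry of the relation with Q, divided by t^{2l}; evenness of the
profile replaces |t| by t, and continuity supplies t = 0. -/
lemma corner_line {n l : ℕ} (hl : l ≤ n) {G : 𝓢(C2, EndV n)} (hG : IsEquivariant G)
    (hW : ∀ z, G z ∈ W n l) {i : Fin (n + 1)} (hi : B n l i i ≠ 0) (x t : ℝ) :
    (1 + (x : ℂ) ^ 2) ^ l * G (t • linePt x) 0 ⟨l, by omega⟩ =
      (2 ^ l * (Eop n ^ l) 0 ⟨l, by omega⟩) * (x : ℂ) ^ l *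
        profile n l i G (Real.sqrt (1 + x ^ 2) * t) := by
  have hs : 0 ≤ 1 + x ^ 2 := by positivity
  have hnorm : ∀ t : ℝ, ‖t • linePt x‖ = |t| * Real.sqrt (1 + x ^ 2) := fun t => by
    rw [norm_smul, Real.norm_eq_abs, ← norm_sq_linePt, Real.sqrt_sq (norm_nonneg _)]
  have hline : Continuous fun t : ℝ => t • linePt x := continuous_id.smul continuous_const
  have hc1 : Continuous fun t : ℝ =>
      (1 + (x : ℂ) ^ 2) ^ l * G (t • linePt x) 0 ⟨l, by omega⟩ :=
    continuous_const.mul ((entryCLM n 0 ⟨l, by omega⟩).continuous.comp (G.continuous.comp hline))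
  have hc2 : Continuous fun t : ℝ => (2 ^ l * (Eop n ^ l) 0 ⟨l, by omega⟩) * (x : ℂ) ^ l *
      profile n l i G (Real.sqrt (1 + x ^ 2) * t) :=
    continuous_const.mul ((profile n l i G).continuous.comp (continuous_const.mul continuous_id))
  refine congrFun (Continuous.ext_on (dense_compl_singleton (0 : ℝ)) hc1 hc2 fun t ht => ?_) t
  have ht : t ≠ 0 := ht
  have h := hG.norm_pow_smul hl hW hi (t • linePt x)
  rw [← profile_apply] at h
  have h2 := congrFun (congrFun h 0) ⟨l, by omega⟩
  rw [Matrix.smul_apply, Matrix.smul_apply, Q_corner hl, smul_eq_mul, smul_eq_mul, hnorm] at h2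
  have habs : profile n l i G (|t| * Real.sqrt (1 + x ^ 2)) =
      profile n l i G (Real.sqrt (1 + x ^ 2) * t) := by
    rcases abs_cases t with ⟨e, _⟩ | ⟨e, _⟩
    · rw [e, mul_comm]
    · rw [e, neg_mul, profile_even hG, mul_comm]
  rw [habs, pow_mul, mul_pow, sq_abs, Real.sq_sqrt hs] at h2
  simp only [PiLp.smul_apply, linePt_zero, linePt_one, Complex.real_smul, mul_one,
    Complex.conj_ofReal] at h2
  have ht2 : ((t : ℂ) ^ 2) ^ l ≠ 0 := pow_ne_zero _ (pow_ne_zero _ (by exact_mod_cast ht))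
  refine mul_left_cancel₀ ht2 ?_
  push_cast at h2
  rw [mul_pow] at h2
  linear_combination h2

/-- Odd derivatives vanish by evenness. For m = 2j, smoothness of the corner entry in all variables
turns the line identity into a polynomial identity in x, which would fail at x = i if the derivative
were nonzero. -/
lemma iteratedDeriv_profile_zero {n l : ℕ} (hl : l ≤ n) {G : 𝓢(C2, EndV n)} (hG : IsEquivariant G)
    (hW : ∀ z, G z ∈ W n l) {i : Fin (n + 1)} (hi : B n l i i ≠ 0) {m : ℕ} (hm : m < 2 * l) :
    iteratedDeriv m (profile n l i G) 0 = 0 := by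
  rcases Nat.even_or_odd' m with ⟨j, rfl | rfl⟩
  swap
  · have h1 := iteratedDeriv_comp_neg (2 * j + 1) (profile n l i G) 0
    simp only [profile_even hG, neg_zero] at h1
    rw [pow_succ, pow_mul] at h1
    simp only [neg_one_sq, one_pow, one_mul, neg_smul, one_smul] at h1
    exact self_eq_neg.1 h1
  · set d := iteratedDeriv (2 * j) (profile n l i G) 0 with hd
    set κ : ℂ := 2 ^ l * (Eop n ^ l) 0 ⟨l, by omega⟩ with hκ
    have hκ0 : κ ≠ 0 := mul_ne_zero (pow_ne_zero _ two_ne_zero)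
      (Eop_pow_apply_ne_zero n l 0 ⟨l, by omega⟩ (by simp))
    obtain ⟨P, hP⟩ := exists_polynomial_iteratedDeriv (2 * j)
      (postcompCLM (entryCLM n 0 ⟨l, by omega⟩) G)
    have key : ∀ x : ℝ, (1 + (x : ℂ) ^ 2) ^ (l - j) * P.eval (x : ℂ) = κ * d * (x : ℂ) ^ l := fun x => by
      have h1 : (fun t : ℝ => (1 + (x : ℂ) ^ 2) ^ l *
          (postcompCLM (entryCLM n 0 ⟨l, by omega⟩) G) (t • linePt x)) = fun t : ℝ =>
          κ * (x : ℂ) ^ l * profile n l i G (Real.sqrt (1 + x ^ 2) * t) :=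
        funext fun t => corner_line hl hG hW hi x t
      have h2 := congrArg (fun f => iteratedDeriv (2 * j) f 0) h1
      simp only [iteratedDeriv_const_mul_field] at h2
      rw [hP, iteratedDeriv_comp_const_smul ((profile n l i G).smooth _)] at h2
      simp only [mul_zero] at h2
      rw [pow_mul, Real.sq_sqrt (by positivity), ← hd] at h2
      have h0 : (1 + (x : ℂ) ^ 2) ^ j ≠ 0 := by
        have : (1 + x ^ 2) ^ j ≠ 0 := by positivity
        exact_mod_cast this
      refine mul_left_cancel₀ h0 ?_
      rw [← mul_assoc, ← pow_add, show j + (l - j) = l by omega, h2]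
      simp only [Complex.real_smul]
      push_cast
      ring
    have hpoly : (1 + Polynomial.X ^ 2) ^ (l - j) * P - Polynomial.C (κ * d) * Polynomial.X ^ l = 0 := by
      refine Polynomial.eq_zero_of_infinite_isRoot _ ((Set.infinite_range_of_injective
        Complex.ofReal_injective).mono ?_)
      rintro _ ⟨x, rfl⟩
      simp [Polynomial.IsRoot, key x]
    -- At x = i the factor (1+x²)^{l-j} vanishes, because j < l, while κ i^l does not.
    have hI := congrArg (Polynomial.eval Complex.I) hpoly
    have hlj : l - j ≠ 0 := by omega
    simpa [hlj, hκ0] using hI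

/-- The function `h` with `F(z) = h(|z|²) Q(z)` for equivariant `W`-valued `F`. -/
def radialSymbol (n l : ℕ) (i : Fin (n + 1)) : 𝓢(C2, EndV n) →L[ℂ] 𝓢(ℝ, ℂ) :=
  (whitney.comp (divX ^ (2 * l))).comp (profile n l i)

/-- The 2l-fold quotient of the profile is even because 2l is even, so it is a Schwartz function of
|z|². The identity is cancelled off the origin and extended by continuity. -/
lemma eq_radialSymbol_smul_Q {n l : ℕ} (hl : l ≤ n) {G : 𝓢(C2, EndV n)} (hG : IsEquivariant G)
    (hW : ∀ z, G z ∈ W n l) {i : Fin (n + 1)} (hi : B n l i i ≠ 0) (z : C2) :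
    G z = radialSymbol n l i G (‖z‖ ^ 2) • Q n l z := by
  set ψ := (divX ^ (2 * l)) (profile n l i G) with hψ
  have hmul : ∀ x : ℝ, (x : ℂ) ^ (2 * l) * ψ x = profile n l i G x := mul_divX_pow fun j hj => by
    rw [← iteratedDeriv_schwartz]
    exact iteratedDeriv_profile_zero hl hG hW hi hj
  have heven : ∀ x, ψ (-x) = ψ x := fun x => by
    by_cases hx : x = 0
    · simp [hx]
    · have hx' : (x : ℂ) ^ (2 * l) ≠ 0 := pow_ne_zero _ (by exact_mod_cast hx)
      have h1 := hmul (-x)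
      rw [profile_even hG, ← hmul x] at h1
      refine mul_left_cancel₀ hx' (Eq.trans ?_ h1)
      push_cast
      rw [pow_mul, pow_mul, neg_sq]
  have hrad : ∀ x : ℝ, radialSymbol n l i G (x ^ 2) = ψ x := fun x => whitney_sq heven x
  refine congrFun (Continuous.ext_on (dense_compl_singleton (0 : C2)) G.continuous
    (g := fun z => radialSymbol n l i G (‖z‖ ^ 2) • Q n l z) ?_ fun z hz => ?_) z
  · exact ((radialSymbol n l i G).continuous.comp (continuous_norm.pow 2)).smul (continuous_Q hl)
  · have hz : z ≠ 0 := hz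
    have hz' : ((‖z‖ ^ (2 * l) : ℝ) : ℂ) ≠ 0 := by
      exact_mod_cast pow_ne_zero _ (norm_ne_zero_iff.2 hz)
    have h := hG.norm_pow_smul hl hW hi z
    rw [← profile_apply, ← hmul, mul_smul, ← Complex.ofReal_pow] at h
    rw [(smul_right_injective (EndV n) hz').eq_iff.1 h, ← hrad]

end
end MotionGroup
-- The Fourier side: equivariance, the potential g₀ and multipliers.
namespace MotionGroup

open scoped FourierTransform LineDeriv

noncomputable section

/-! ### Lebesgue measure and the unitary action -/

/-- `ℂ²` as the Hilbert sum of two copies of `ℂ`. -/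
def prodIso : WithLp 2 (ℂ × ℂ) ≃ₗᵢ[ℝ] C2 where
  toFun p := WithLp.toLp 2 ![p.fst, p.snd]
  invFun z := WithLp.toLp 2 (z 0, z 1)
  map_add' p q := by ext i; fin_cases i <;> simp
  map_smul' c p := by ext i; fin_cases i <;> simp
  left_inv p := rfl
  right_inv z := by ext i; fin_cases i <;> simp
  norm_map' p := by
    rw [EuclideanSpace.norm_eq, WithLp.prod_norm_eq_of_L2, Fin.sum_univ_two]; rfl

lemma leb_eq_volume : leb = (volume : Measure C2) := by
  have h := prodIso.measurePreserving.comp ((WithLp.volume_preserving_toLp ℂ ℂ).comp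
    (volume_preserving_piFinTwo fun _ => ℂ))
  rw [leb, ← h.map_eq]
  congr 1
  funext v
  ext i
  fin_cases i <;> rfl

lemma rdot_eq_inner (z w : C2) : rdot z w = inner ℝ z w := by
  simp [rdot, Fin.sum_univ_two, PiLp.inner_apply, Complex.inner]
  ring

lemma norm_act {k : Matrix (Fin 2) (Fin 2) ℂ} (hk : k ∈ Matrix.unitaryGroup (Fin 2) ℂ) (z : C2) :
    ‖act k z‖ = ‖z‖ := by
  have e : ∀ z : C2, ((‖z‖ ^ 2 : ℝ) : ℂ) = star (WithLp.ofLp z) ⬝ᵥ WithLp.ofLp z := fun z => by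
    rw [norm_sq_C2]; simp [dotProduct, Fin.sum_univ_two, mul_comm]
  have h : ((‖act k z‖ ^ 2 : ℝ) : ℂ) = ((‖z‖ ^ 2 : ℝ) : ℂ) := by
    rw [e, e]
    change star (k *ᵥ WithLp.ofLp z) ⬝ᵥ (k *ᵥ WithLp.ofLp z) = _
    rw [Matrix.star_mulVec, Matrix.dotProduct_mulVec, Matrix.vecMul_vecMul,
      ← Matrix.star_eq_conjTranspose, Matrix.mem_unitaryGroup_iff'.1 hk, Matrix.vecMul_one]
  have h2 : ‖act k z‖ ^ 2 = ‖z‖ ^ 2 := by exact_mod_cast h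
  exact (sq_eq_sq₀ (norm_nonneg _) (norm_nonneg _)).1 h2

/-- The action of a unitary matrix as an isometry. -/
def actIso {k : Matrix (Fin 2) (Fin 2) ℂ} (hk : k ∈ Matrix.unitaryGroup (Fin 2) ℂ) :
    C2 ≃ₗᵢ[ℝ] C2 :=
  LinearIsometry.toLinearIsometryEquiv
    { toFun := act k
      map_add' := fun z w => by ext i; fin_cases i <;> simp [act] <;> ring
      map_smul' := fun c z => by ext i; fin_cases i <;> simp [act] <;> ring
      norm_map' := norm_act hk } rfl

lemma actIso_apply {k : Matrix (Fin 2) (Fin 2) ℂ} (hk : k ∈ Matrix.unitaryGroup (Fin 2) ℂ)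
    (z : C2) : actIso hk z = act k z := rfl

/-! ### The Fourier transform of equivariant functions -/

lemma fourier_clm_apply {E E' : Type*} [NormedAddCommGroup E] [NormedSpace ℂ E] [CompleteSpace E]
    [NormedAddCommGroup E'] [NormedSpace ℂ E'] [CompleteSpace E'] (L : E →L[ℂ] E') (f : 𝓢(C2, E))
    (w : C2) : 𝓕 (fun z => L (f z)) w = L (𝓕 f w) := by
  rw [fourier_coe, Real.fourier_eq', Real.fourier_eq', ← L.integral_comp_comm]
  · simp only [map_smul]
  · have := (Real.fourierIntegral_convergent_iff (μ := (volume : Measure C2)) w).2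
      (f.integrable (μ := volume))
    simpa only [Circle.smul_def, Real.fourierChar_apply, mul_neg, neg_mul] using this

/-- Conjugation by `τ_n(k)`. -/
def conjCLM (n : ℕ) (k : Matrix (Fin 2) (Fin 2) ℂ) : EndV n →L[ℂ] EndV n :=
  LinearMap.toContinuousLinearMap (LinearMap.mulLeft ℂ (tau n k) ∘ₗ LinearMap.mulRight ℂ (tau n k⁻¹))

lemma conjCLM_apply {n : ℕ} (k : Matrix (Fin 2) (Fin 2) ℂ) (A : EndV n) :
    conjCLM n k A = tau n k * A * tau n k⁻¹ := (mul_assoc _ _ _).symm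

/-- The Fourier transform commutes with linear isometries of ℂ² and with continuous linear maps of
the values. -/
lemma isEquivariant_fourier {n : ℕ} {F : 𝓢(C2, EndV n)} (hF : IsEquivariant F) :
    IsEquivariant (𝓕 F : 𝓢(C2, EndV n)) := fun k hk z => by
  have h : ⇑F ∘ actIso hk = fun z => conjCLM n k (F z) := funext fun w => by
    rw [conjCLM_apply, ← hF k hk w]; rfl
  rw [← conjCLM_apply]
  refine Eq.trans ?_ (fourier_clm_apply (conjCLM n k) F z)
  rw [← actIso_apply hk, fourier_coe, ← Real.fourier_comp_linearIsometry, h]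
  rfl

lemma fourier_mem_W {n l : ℕ} {F : 𝓢(C2, EndV n)} (hW : ∀ z, F z ∈ W n l) (z : C2) :
    𝓕 F z ∈ W n l := by
  by_contra hmem
  obtain ⟨f, hf, hfU⟩ := Submodule.exists_le_ker_of_notMem hmem
  have h0 : (fun z => f (F z)) = fun _ => (0 : ℂ) := funext fun z => hfU (hW z)
  refine hf ((fourier_clm_apply (LinearMap.toContinuousLinearMap f) F z).symm.trans ?_)
  change 𝓕 (fun z => f (F z)) z = 0
  rw [h0, Real.fourier_eq']
  simp only [smul_zero, integral_zero]

/-! ### The scalar potential -/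

/-- The function `g₀` with `F = Q(∂) g₀`. -/
def potential (n l : ℕ) (i : Fin (n + 1)) : 𝓢(C2, EndV n) →L[ℂ] 𝓢(C2, ℂ) :=
  ((FourierTransform.fourierCLE ℂ 𝓢(C2, ℂ)).symm.toContinuousLinearMap).comp
    ((((2 * Real.pi) ^ (2 * l) : ℂ)⁻¹ • compNormSq).comp
      ((radialSymbol n l i).comp (fourierTransformCLM ℂ)))

lemma fourier_potential {n l : ℕ} (i : Fin (n + 1)) (F : 𝓢(C2, EndV n)) (w : C2) :
    𝓕 (potential n l i F) w =
      ((2 * Real.pi) ^ (2 * l) : ℂ)⁻¹ * radialSymbol n l i (𝓕 F) (‖w‖ ^ 2) := by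
  have : 𝓕 (potential n l i F) = ((2 * Real.pi) ^ (2 * l) : ℂ)⁻¹ • compNormSq
      (radialSymbol n l i (𝓕 F)) := FourierTransform.fourier_fourierInv_eq _
  rw [this]
  rfl

lemma potential_comp_isometry {n l : ℕ} (i : Fin (n + 1)) (F : 𝓢(C2, EndV n)) (A : C2 ≃ₗᵢ[ℝ] C2)
    (z : C2) : potential n l i F (A z) = potential n l i F z := by
  set f := ((2 * Real.pi) ^ (2 * l) : ℂ)⁻¹ • compNormSq (radialSymbol n l i (𝓕 F)) with hf
  have e : potential n l i F = 𝓕⁻ f := rfl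
  have h : ⇑f ∘ A = f := funext fun w => by simp [hf, Function.comp]
  rw [e, fourierInv_coe, ← Real.fourierInv_comp_linearIsometry, h]

/-- The transform of the potential is radial, hence so is the potential. -/
lemma potential_axis {n l : ℕ} (i : Fin (n + 1)) (F : 𝓢(C2, EndV n)) (z : C2) :
    potential n l i F (axis ‖z‖) = potential n l i F z := by
  rw [← potential_comp_isometry i F (actIso (sphereMatrix_mem z)), actIso_apply, act_sphereMatrix]

/-- The function `g` with `g₀(z) = g(|z|²)`. -/
def radialPart (n l : ℕ) (i : Fin (n + 1)) : 𝓢(C2, EndV n) →L[ℂ] 𝓢(ℝ, ℂ) :=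
  (whitney.comp restrictAxis).comp (potential n l i)

lemma potential_eq {n l : ℕ} (i : Fin (n + 1)) (F : 𝓢(C2, EndV n)) (z : C2) :
    potential n l i F z = radialPart n l i F (‖z‖ ^ 2) := by
  have heven : ∀ x, restrictAxis (potential n l i F) (-x) = restrictAxis (potential n l i F) x :=
    fun x => by
      rw [restrictAxis_apply, map_neg, restrictAxis_apply]
      exact potential_comp_isometry i F (LinearIsometryEquiv.neg ℝ) (axis x)
  rw [← potential_axis]
  exact (whitney_sq heven ‖z‖).symm

lemma fourier_potential_smul_Q {n l : ℕ} (hl : l ≤ n) {i : Fin (n + 1)} (hi : B n l i i ≠ 0)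
    {F : 𝓢(C2, EndV n)} (hF : IsEquivariant F) (hW : ∀ z, F z ∈ W n l) (w : C2) :
    ((2 * Real.pi) ^ (2 * l) : ℂ) • 𝓕 (potential n l i F) w • Q n l w = 𝓕 F w := by
  rw [eq_radialSymbol_smul_Q hl (isEquivariant_fourier hF) (fourier_mem_W hW) hi w,
    fourier_potential, smul_smul, mul_inv_cancel_left₀]
  exact pow_ne_zero _ (mul_ne_zero two_ne_zero (by exact_mod_cast Real.pi_ne_zero))

/-! ### Multipliers -/

lemma finrank_C2 : Module.finrank ℝ C2 = 4 := by
  rw [← Module.finrank_mul_finrank ℝ ℂ C2, Complex.finrank_real_complex, finrank_euclideanSpace,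
    Fintype.card_fin]

lemma fourier_two_pi_smul (u : 𝓢(C2, ℂ)) (w : C2) : fourier u ((2 * Real.pi) • w) = 𝓕 u w := by
  rw [fourier, leb_eq_volume, fourier_coe, Real.fourier_eq']
  refine integral_congr_ae (.of_forall fun z => ?_)
  simp only [smul_eq_mul]
  rw [mul_comm, rdot_eq_inner, inner_smul_right]
  congr 2
  push_cast
  ring

/-- The substitution ζ = 2πw passes to the Fourier transform with kernel e^{-2πi⟨z,w⟩}; its Jacobian
on ℝ⁴ cancels the factor (2π)^{-4}. -/
lemma multiplier_eq_fourierInv {n : ℕ} (P : C2 → EndV n) (u : 𝓢(C2, ℂ)) (z : C2) :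
    multiplier P u z = 𝓕⁻ (fun w => 𝓕 u w • P ((2 * Real.pi) • w)) z := by
  have h := Measure.integral_comp_smul (volume : Measure C2)
    (fun w => (Complex.exp (Complex.I * (rdot z w : ℂ)) * fourier u w) • P w) (2 * Real.pi)
  rw [finrank_C2, abs_of_nonneg (by positivity)] at h
  rw [multiplier, leb_eq_volume, ← Complex.ofReal_inv, Complex.coe_smul, ← h, Real.fourierInv_eq']
  refine integral_congr_ae (.of_forall fun w => ?_)
  simp only [fourier_two_pi_smul, smul_smul]
  rw [rdot_eq_inner, inner_smul_right, real_inner_comm]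
  congr 3
  push_cast
  ring

/-- Q is homogeneous of real degree 2l, so Q(2πw) produces the (2π)^{2l} that the definition of the
potential divides out. -/
lemma eq_multiplier {n l : ℕ} (hl : l ≤ n) {i : Fin (n + 1)} (hi : B n l i i ≠ 0)
    {F : 𝓢(C2, EndV n)} (hF : IsEquivariant F) (hW : ∀ z, F z ∈ W n l) (z : C2) :
    F z = multiplier (Q n l) (potential n l i F) z := by
  rw [multiplier_eq_fourierInv]
  have h : (fun w => 𝓕 (potential n l i F) w • Q n l ((2 * Real.pi) • w)) = ⇑(𝓕 F : 𝓢(C2, EndV n)) := by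
    funext w
    rw [← fourier_potential_smul_Q hl hi hF hW w, Q_real_smul hl, smul_comm]
    push_cast
    rfl
  rw [h, ← fourierInv_coe, FourierTransform.fourierInv_fourier_eq]

end
end MotionGroup
-- Symbols of the differential operators.
namespace MotionGroup

open scoped FourierTransform LineDeriv

noncomputable section

/-! ### Differential operators on Schwartz functions -/

/-- The operator `∂_{z_j}` on Schwartz functions. -/
def dzS {n : ℕ} (j : Fin 2) (f : 𝓢(C2, EndV n)) : 𝓢(C2, EndV n) :=
  (1 / 2 : ℂ) • (∂_{(EuclideanSpace.single j 1 : C2)} f -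
    Complex.I • ∂_{(EuclideanSpace.single j Complex.I : C2)} f)

/-- The operator `∂_{z̄_j}` on Schwartz functions. -/
def dzbarS {n : ℕ} (j : Fin 2) (f : 𝓢(C2, EndV n)) : 𝓢(C2, EndV n) :=
  (1 / 2 : ℂ) • (∂_{(EuclideanSpace.single j 1 : C2)} f +
    Complex.I • ∂_{(EuclideanSpace.single j Complex.I : C2)} f)

/-- The Laplacian in the variable `z_j` on Schwartz functions. -/
def lap1S {n : ℕ} (j : Fin 2) (f : 𝓢(C2, EndV n)) : 𝓢(C2, EndV n) := (-4 : ℂ) • dzS j (dzbarS j f)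

/-- The Laplacian on Schwartz functions. -/
def lapS {n : ℕ} (f : 𝓢(C2, EndV n)) : 𝓢(C2, EndV n) := lap1S 0 f + lap1S 1 f

/-- Left multiplication by a matrix. -/
def mulCLM {n : ℕ} (A : EndV n) : EndV n →L[ℂ] EndV n :=
  LinearMap.toContinuousLinearMap (LinearMap.mulLeft ℂ A)

@[simp] lemma mulCLM_apply {n : ℕ} (A B : EndV n) : mulCLM A B = A * B := rfl

/-- The operator `𝐃_n` on Schwartz functions. -/
def DopS {n : ℕ} (f : 𝓢(C2, EndV n)) : 𝓢(C2, EndV n) :=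
  Complex.I • postcompCLM (mulCLM (dtau n X1)) (lap1S 1 f - lap1S 0 f)
    - (4 : ℂ) • postcompCLM (mulCLM (dtau n X2)) (dzbarS 0 (dzS 1 f) - dzS 0 (dzbarS 1 f))
    + (4 * Complex.I) • postcompCLM (mulCLM (dtau n X3)) (dzS 0 (dzbarS 1 f) + dzbarS 0 (dzS 1 f))

variable {n : ℕ}

lemma dz_coe (j : Fin 2) (f : 𝓢(C2, EndV n)) : dz j f = dzS j f := by
  funext z
  simp only [dz, dzS, _root_.smul_apply, _root_.sub_apply, lineDerivOp_apply_eq_fderiv]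

lemma dzbar_coe (j : Fin 2) (f : 𝓢(C2, EndV n)) : dzbar j f = dzbarS j f := by
  funext z
  simp only [dzbar, dzbarS, _root_.smul_apply, _root_.add_apply, lineDerivOp_apply_eq_fderiv]

lemma lap1_coe (j : Fin 2) (f : 𝓢(C2, EndV n)) : lap1 j f = lap1S j f := by
  funext z
  rw [lap1, dzbar_coe, dz_coe]; rfl

lemma lap_coe (f : 𝓢(C2, EndV n)) : lap f = lapS f := by
  funext z
  rw [lap, lap1_coe, lap1_coe]; rfl

lemma lap_iterate_coe (m : ℕ) (f : 𝓢(C2, EndV n)) : lap^[m] f = lapS^[m] f := by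
  induction m with
  | zero => rfl
  | succ m ih => rw [Function.iterate_succ_apply', Function.iterate_succ_apply', ih, lap_coe]

lemma Dop_coe (f : 𝓢(C2, EndV n)) : Dop n f = DopS f := by
  funext z
  rw [Dop, lap1_coe, lap1_coe, dzbar_coe, dz_coe, dz_coe, dzbar_coe]; rfl

lemma Dop_iterate_coe (m : ℕ) (f : 𝓢(C2, EndV n)) : (Dop n)^[m] f = DopS^[m] f := by
  induction m with
  | zero => rfl
  | succ m ih => rw [Function.iterate_succ_apply', Function.iterate_succ_apply', ih, Dop_coe]

/-! ### Symbols -/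

lemma fourier_lineDeriv_apply (v : C2) (f : 𝓢(C2, EndV n)) (w : C2) :
    𝓕 (∂_{v} f) w = (2 * Real.pi * Complex.I * (inner ℝ w v : ℝ)) • 𝓕 f w := by
  rw [fourier_lineDerivOp_eq, _root_.smul_apply,
    smulLeftCLM_apply_apply (Function.hasTemperateGrowth_inner_left v),
    mul_smul _ ((inner ℝ w v : ℝ) : ℂ), Complex.coe_smul]

lemma fourier_dzS (j : Fin 2) (f : 𝓢(C2, EndV n)) (w : C2) :
    𝓕 (dzS j f) w = (Real.pi * Complex.I * conj (w j)) • 𝓕 f w := by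
  have h : 𝓕 (dzS j f) = (1 / 2 : ℂ) • (𝓕 (∂_{(EuclideanSpace.single j 1 : C2)} f) -
      Complex.I • 𝓕 (∂_{(EuclideanSpace.single j Complex.I : C2)} f)) := by
    change fourierTransformCLM ℂ _ = _
    rw [dzS, map_smul, map_sub, map_smul]; rfl
  rw [h, _root_.smul_apply, _root_.sub_apply, _root_.smul_apply, fourier_lineDeriv_apply,
    fourier_lineDeriv_apply, smul_smul, ← sub_smul, smul_smul]
  congr 1
  simp only [← rdot_eq_inner, rdot]
  apply Complex.ext <;> fin_cases j <;> simp [Fin.sum_univ_two] <;> ring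

lemma fourier_dzbarS (j : Fin 2) (f : 𝓢(C2, EndV n)) (w : C2) :
    𝓕 (dzbarS j f) w = (Real.pi * Complex.I * w j) • 𝓕 f w := by
  have h : 𝓕 (dzbarS j f) = (1 / 2 : ℂ) • (𝓕 (∂_{(EuclideanSpace.single j 1 : C2)} f) +
      Complex.I • 𝓕 (∂_{(EuclideanSpace.single j Complex.I : C2)} f)) := by
    change fourierTransformCLM ℂ _ = _
    rw [dzbarS, map_smul, map_add, map_smul]; rfl
  rw [h, _root_.smul_apply, _root_.add_apply, _root_.smul_apply, fourier_lineDeriv_apply,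
    fourier_lineDeriv_apply, smul_smul, ← add_smul, smul_smul]
  congr 1
  simp only [← rdot_eq_inner, rdot]
  apply Complex.ext <;> fin_cases j <;> simp [Fin.sum_univ_two] <;> ring

lemma fourier_lap1S (j : Fin 2) (f : 𝓢(C2, EndV n)) (w : C2) :
    𝓕 (lap1S j f) w = (4 * Real.pi ^ 2 * (w j * conj (w j))) • 𝓕 f w := by
  have h : 𝓕 (lap1S j f) = (-4 : ℂ) • 𝓕 (dzS j (dzbarS j f)) := by
    change fourierTransformCLM ℂ _ = _
    rw [lap1S, map_smul]; rfl
  rw [h, _root_.smul_apply, fourier_dzS, fourier_dzbarS, smul_smul, smul_smul]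
  congr 1
  linear_combination (-4 * Real.pi ^ 2 * (w j * conj (w j)) : ℂ) * Complex.I_mul_I

lemma fourier_lapS (f : 𝓢(C2, EndV n)) (w : C2) :
    𝓕 (lapS f) w = (4 * Real.pi ^ 2 * ((‖w‖ ^ 2 : ℝ) : ℂ)) • 𝓕 f w := by
  have h : 𝓕 (lapS f) = 𝓕 (lap1S 0 f) + 𝓕 (lap1S 1 f) := by
    change fourierTransformCLM ℂ _ = _
    rw [lapS, map_add]; rfl
  rw [h, _root_.add_apply, fourier_lap1S, fourier_lap1S, ← add_smul, norm_sq_C2, ← mul_add]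

lemma fourier_lapS_iterate (m : ℕ) (f : 𝓢(C2, EndV n)) (w : C2) :
    𝓕 (lapS^[m] f) w = (4 * Real.pi ^ 2 * ((‖w‖ ^ 2 : ℝ) : ℂ)) ^ m • 𝓕 f w := by
  induction m with
  | zero => simp
  | succ m ih => rw [Function.iterate_succ_apply', fourier_lapS, ih, smul_smul, ← pow_succ']

lemma fourier_postcomp_mulCLM (A : EndV n) (f : 𝓢(C2, EndV n)) (w : C2) :
    𝓕 (postcompCLM (mulCLM A) f) w = A * 𝓕 f w := by
  rw [fourier_coe]
  exact fourier_clm_apply (mulCLM A) f w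

/-- Rewriting X₁, X₂, X₃ in terms of H, E, F collects the second-order symbols into `Dsym`. -/
lemma fourier_DopS (f : 𝓢(C2, EndV n)) (w : C2) :
    𝓕 (DopS f) w = (4 * Real.pi ^ 2 : ℂ) • (Dsym n w * 𝓕 f w) := by
  have h : 𝓕 (DopS f) = Complex.I • 𝓕 (postcompCLM (mulCLM (dtau n X1)) (lap1S 1 f - lap1S 0 f))
      - (4 : ℂ) • 𝓕 (postcompCLM (mulCLM (dtau n X2)) (dzbarS 0 (dzS 1 f) - dzS 0 (dzbarS 1 f)))
      + (4 * Complex.I) •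
        𝓕 (postcompCLM (mulCLM (dtau n X3)) (dzS 0 (dzbarS 1 f) + dzbarS 0 (dzS 1 f))) := by
    change fourierTransformCLM ℂ _ = _
    rw [DopS, map_add, map_sub, map_smul, map_smul, map_smul]; rfl
  have h1 : 𝓕 (lap1S 1 f - lap1S 0 f) = 𝓕 (lap1S 1 f) - 𝓕 (lap1S 0 f) :=
    map_sub (fourierTransformCLM ℂ) _ _
  have h2 : 𝓕 (dzbarS 0 (dzS 1 f) - dzS 0 (dzbarS 1 f)) =
    𝓕 (dzbarS 0 (dzS 1 f)) - 𝓕 (dzS 0 (dzbarS 1 f)) := map_sub (fourierTransformCLM ℂ) _ _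
  have h3 : 𝓕 (dzS 0 (dzbarS 1 f) + dzbarS 0 (dzS 1 f)) =
    𝓕 (dzS 0 (dzbarS 1 f)) + 𝓕 (dzbarS 0 (dzS 1 f)) := map_add (fourierTransformCLM ℂ) _ _
  have hX2 : dtau n X2 = Eop n - Fop n := by
    rw [Eop_eq_X, Fop_eq_X]; module
  have hX3 : dtau n X3 = Complex.I • (Eop n + Fop n) := by
    rw [Eop_eq_X, Fop_eq_X]
    match_scalars <;> first | ring1 | linear_combination Complex.I_mul_I
  have hX1 : dtau n X1 = Complex.I • Hop n := by
    rw [Hop_eq_X]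
    match_scalars
    linear_combination Complex.I_mul_I
  rw [h, _root_.add_apply, _root_.sub_apply, _root_.smul_apply, _root_.smul_apply,
    _root_.smul_apply, fourier_postcomp_mulCLM, fourier_postcomp_mulCLM, fourier_postcomp_mulCLM,
    h1, h2, h3, _root_.sub_apply, _root_.sub_apply, _root_.add_apply, fourier_lap1S, fourier_lap1S,
    fourier_dzbarS, fourier_dzS, fourier_dzS, fourier_dzbarS, hX1, hX2, hX3, smul_smul, smul_smul,
    ← sub_smul, ← sub_smul, ← add_smul, Dsym]
  simp only [mul_smul_comm, smul_mul_assoc, sub_mul, add_mul]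
  match_scalars <;> ring_nf <;> simp only [Complex.I_sq, Complex.I_pow_four] <;> ring

lemma fourier_DopS_iterate (m : ℕ) (f : 𝓢(C2, EndV n)) (w : C2) :
    𝓕 (DopS^[m] f) w = (4 * Real.pi ^ 2 : ℂ) ^ m • (Dsym n w ^ m * 𝓕 f w) := by
  induction m with
  | zero => simp
  | succ m ih => rw [Function.iterate_succ_apply', fourier_DopS, ih, mul_smul_comm, smul_smul,
      ← mul_assoc, ← pow_succ', ← pow_succ']

/-- Scalar functions as functions with values in the scalar matrices. -/
def scalarCLM (n : ℕ) : ℂ →L[ℂ] EndV n := ContinuousLinearMap.toSpanSingleton ℂ (1 : EndV n)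

/-- Both sides are Schwartz functions, so their transforms are compared term by term: the k-th term
carries (4π²)^k (4π²)^{l-k} = (2π)^{2l}. -/
lemma eq_homOp {l : ℕ} (hl : l ≤ n) {i : Fin (n + 1)} (hi : B n l i i ≠ 0)
    {F : 𝓢(C2, EndV n)} (hF : IsEquivariant F) (hW : ∀ z, F z ∈ W n l) (z : C2) :
    F z = homOp n l (qPoly n l) (potential n l i F) z := by
  set u : 𝓢(C2, EndV n) := postcompCLM (scalarCLM n) (potential n l i F) with hu
  have hu' : (fun w => potential n l i F w • (1 : EndV n)) = u := rfl
  set S : 𝓢(C2, EndV n) := ∑ k ∈ Finset.range (l + 1),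
    (qPoly n l).coeff k • DopS^[k] (lapS^[l - k] u) with hS
  have h1 : homOp n l (qPoly n l) (potential n l i F) z = S z := by
    rw [homOp, hu', hS, _root_.sum_apply]
    refine Finset.sum_congr rfl fun k _ => ?_
    rw [lap_iterate_coe, Dop_iterate_coe]; rfl
  have hfu : ∀ w, 𝓕 u w = 𝓕 (potential n l i F) w • (1 : EndV n) := fun w => by
    rw [fourier_coe]
    exact fourier_clm_apply (scalarCLM n) (potential n l i F) w
  have h2 : 𝓕 S = 𝓕 F := by
    ext1 w
    rw [← fourier_potential_smul_Q hl hi hF hW w, Q_eq_sum hl, Finset.smul_sum, Finset.smul_sum]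
    have h3 : 𝓕 S = ∑ k ∈ Finset.range (l + 1),
        (qPoly n l).coeff k • 𝓕 (DopS^[k] (lapS^[l - k] u)) := by
      change fourierTransformCLM ℂ _ = _
      rw [hS, map_sum]
      simp only [map_smul]; rfl
    rw [h3, _root_.sum_apply]
    refine Finset.sum_congr rfl fun k hk => ?_
    have hk' : k ≤ l := Nat.lt_succ_iff.1 (Finset.mem_range.1 hk)
    rw [_root_.smul_apply, fourier_DopS_iterate, fourier_lapS_iterate, hfu, mul_smul_comm,
      mul_smul_comm, mul_one]
    simp only [smul_smul]
    congr 1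
    rw [mul_pow _ (((‖w‖ ^ 2 : ℝ) : ℂ)), show ((2 * Real.pi : ℂ) ^ (2 * l)) =
      (4 * Real.pi ^ 2) ^ k * (4 * Real.pi ^ 2) ^ (l - k) by
        rw [← pow_add, show k + (l - k) = l by omega, pow_mul]; ring]
    push_cast
    ring
  have h4 : S = F := by
    have := congrArg (fun f : 𝓢(C2, EndV n) => (𝓕⁻ f : 𝓢(C2, EndV n))) h2
    simpa only [FourierTransform.fourierInv_fourier_eq] using this
  rw [h1, h4]

end
end MotionGroup
-- Quantitative bounds by the norms of F.
namespace MotionGroup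

open scoped FourierTransform LineDeriv

noncomputable section

/-! ### Estimates by the norms `normC2` -/

lemma normC2_mono {E : Type*} [NormedAddCommGroup E] [NormedSpace ℝ E] [NormedSpace ℂ E]
    {M N : ℕ} (h : M ≤ N) (u : C2 → E) : normC2 M u ≤ normC2 N u := by
  refine Finset.sup_le fun q hq => ?_
  have hq' : q ∈ Finset.range (N + 1) := Finset.mem_range.2 ((Finset.mem_range.1 hq).trans_le
    (by omega))
  refine le_trans (eLpNorm_mono fun z => ?_) (Finset.le_sup (f := fun q => eLpNorm
    (fun z => (((1 + ‖z‖ ^ 2) ^ N : ℝ) : ℂ) • lap^[q] u z) 2 leb) hq')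
  rw [norm_smul, norm_smul, Complex.norm_real, Complex.norm_real,
    Real.norm_of_nonneg (by positivity), Real.norm_of_nonneg (by positivity)]
  exact mul_le_mul_of_nonneg_right (pow_le_pow_right₀ (by nlinarith [sq_nonneg ‖z‖]) h)
    (norm_nonneg _)

variable {n : ℕ}

/-- A family of quantities which is bounded by one of the norms `normC2`. -/
def NormBounded (b : 𝓢(C2, EndV n) → ℝ → ℝ) : Prop :=
  ∃ (N : ℕ) (C : ℝ), 0 ≤ C ∧ ∀ (F : 𝓢(C2, EndV n)) (A : ℝ), 0 ≤ A →
    normC2 N F ≤ ENNReal.ofReal A → ∀ r, b F r ≤ C * A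

namespace NormBounded

variable {b c : 𝓢(C2, EndV n) → ℝ → ℝ}

lemma add (hb : NormBounded b) (hc : NormBounded c) : NormBounded fun F r => b F r + c F r := by
  obtain ⟨N, C, hC, h⟩ := hb
  obtain ⟨N', C', hC', h'⟩ := hc
  refine ⟨max N N', C + C', add_nonneg hC hC', fun F A hA hF r => ?_⟩
  rw [add_mul]
  exact add_le_add (h F A hA ((normC2_mono (le_max_left _ _) _).trans hF) r)
    (h' F A hA ((normC2_mono (le_max_right _ _) _).trans hF) r)

lemma const_mul (hb : NormBounded b) {K : ℝ} (hK : 0 ≤ K) :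
    NormBounded fun F r => K * b F r := by
  obtain ⟨N, C, hC, h⟩ := hb
  refine ⟨N, K * C, mul_nonneg hK hC, fun F A hA hF r => ?_⟩
  rw [mul_assoc]
  exact mul_le_mul_of_nonneg_left (h F A hA hF r) hK

lemma mono (hb : NormBounded b) (h : ∀ F r, c F r ≤ b F r) : NormBounded c := by
  obtain ⟨N, C, hC, h'⟩ := hb
  exact ⟨N, C, hC, fun F A hA hF r => (h F r).trans (h' F A hA hF r)⟩

lemma sum {ι : Type*} (t : Finset ι) {b : ι → 𝓢(C2, EndV n) → ℝ → ℝ}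
    (hb : ∀ i ∈ t, NormBounded (b i)) : NormBounded fun F r => ∑ i ∈ t, b i F r := by
  classical
  induction t using Finset.induction_on with
  | empty => exact ⟨0, 0, le_rfl, fun F A _ _ r => by simp⟩
  | insert i t hi ih =>
    refine ((hb i (by simp)).add (ih fun j hj => hb j (by simp [hj]))).mono fun F r => ?_
    rw [Finset.sum_insert hi]

end NormBounded

/-- The operator on Schwartz functions which corresponds, under the Fourier transform, to the
derivative along the axis. -/
def axisMul (u : 𝓢(C2, ℂ)) : 𝓢(C2, ℂ) :=
  -(2 * Real.pi * Complex.I) • smulLeftCLM ℂ (inner ℝ · (axis 1)) u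

lemma norm_axisMul_le (u : 𝓢(C2, ℂ)) (z : C2) : ‖axisMul u z‖ ≤ 2 * Real.pi * ‖z‖ * ‖u z‖ := by
  rw [axisMul, _root_.smul_apply, smulLeftCLM_apply_apply
    (Function.hasTemperateGrowth_inner_left (axis 1)), norm_smul, norm_smul]
  have h1 : ‖-(2 * Real.pi * Complex.I)‖ = 2 * Real.pi := by
    simp [abs_of_nonneg Real.pi_pos.le]
  have h2 : ‖(inner ℝ z (axis 1) : ℝ)‖ ≤ ‖z‖ := by
    have := norm_inner_le_norm (𝕜 := ℝ) z (axis 1)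
    rwa [LinearIsometry.norm_map, norm_one, mul_one] at this
  rw [h1]
  calc 2 * Real.pi * (‖(inner ℝ z (axis 1) : ℝ)‖ * ‖u z‖) ≤ 2 * Real.pi * (‖z‖ * ‖u z‖) :=
        mul_le_mul_of_nonneg_left (mul_le_mul_of_nonneg_right h2 (norm_nonneg _)) (by positivity)
    _ = _ := by ring

lemma norm_axisMul_iterate_le (m : ℕ) (u : 𝓢(C2, ℂ)) (z : C2) :
    ‖axisMul^[m] u z‖ ≤ (2 * Real.pi) ^ m * ‖z‖ ^ m * ‖u z‖ := by
  induction m with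
  | zero => simp
  | succ m ih =>
    rw [Function.iterate_succ_apply']
    refine (norm_axisMul_le _ z).trans ?_
    calc 2 * Real.pi * ‖z‖ * ‖axisMul^[m] u z‖
        ≤ 2 * Real.pi * ‖z‖ * ((2 * Real.pi) ^ m * ‖z‖ ^ m * ‖u z‖) :=
          mul_le_mul_of_nonneg_left ih (by positivity)
      _ = (2 * Real.pi) ^ (m + 1) * ‖z‖ ^ (m + 1) * ‖u z‖ := by ring

lemma iteratedDeriv_restrictAxis_fourier (m : ℕ) (u : 𝓢(C2, ℂ)) (r : ℝ) :
    iteratedDeriv m (restrictAxis (𝓕 u)) r = 𝓕 (axisMul^[m] u) (axis r) := by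
  induction m generalizing u with
  | zero => rfl
  | succ m ih =>
    have hd : deriv (restrictAxis (𝓕 u)) = restrictAxis (𝓕 (axisMul u)) := by
      funext t
      have h1 : HasDerivAt (fun t : ℝ => axis t) (axis 1) t := by
        simpa using axis.toContinuousLinearMap.hasDerivAt (x := t)
      have h2 := ((𝓕 u : 𝓢(C2, ℂ)).hasFDerivAt (axis t)).comp_hasDerivAt t h1
      refine h2.deriv.trans ?_
      rw [restrictAxis_apply, axisMul, ← lineDerivOp_fourier_eq, lineDerivOp_apply_eq_fderiv]
    rw [iteratedDeriv_succ', hd, ih, Function.iterate_succ_apply]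

/-- The supremum of the transform is at most the L¹ norm, and Cauchy–Schwarz with a
square-integrable weight bounds that by a weighted L² norm. -/
lemma norm_fourier_le {k : ℕ} {K : ℝ} (hK0 : 0 ≤ K)
    (hK : eLpNorm (fun z : C2 => (1 + ‖z‖) ^ (-k : ℝ)) 2 volume ≤ ENNReal.ofReal K)
    (v : 𝓢(C2, ℂ)) {A : ℝ} (hA : 0 ≤ A)
    (hv : eLpNorm (fun z => ((1 + ‖z‖) ^ k : ℝ) • v z) 2 volume ≤ ENNReal.ofReal A) (w : C2) :
    ‖𝓕 v w‖ ≤ K * A := by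
  have h1 : ‖𝓕 v w‖ ≤ ∫ z, ‖v z‖ := by
    rw [fourier_coe, Real.fourier_eq']
    refine (norm_integral_le_integral_norm _).trans (le_of_eq ?_)
    refine integral_congr_ae (.of_forall fun z => ?_)
    simp only [norm_smul, Complex.norm_exp_ofReal_mul_I, one_mul]
  refine h1.trans ?_
  rw [integral_norm_eq_lintegral_enorm v.continuous.aestronglyMeasurable,
    ← eLpNorm_one_eq_lintegral_enorm]
  refine ENNReal.toReal_le_of_le_ofReal (mul_nonneg hK0 hA) ?_
  have hv' : (⇑v : C2 → ℂ) = (fun z : C2 => (1 + ‖z‖) ^ (-k : ℝ)) •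
      fun z => ((1 + ‖z‖) ^ k : ℝ) • v z := by
    funext z
    have hz : 0 < 1 + ‖z‖ := by positivity
    rw [Pi.smul_apply', smul_smul, Real.rpow_neg hz.le, Real.rpow_natCast,
      inv_mul_cancel₀ (pow_ne_zero _ hz.ne'), one_smul]
  have hc1 : Continuous fun z : C2 => (1 + ‖z‖) ^ (-k : ℝ) :=
    (continuous_const.add continuous_norm).rpow_const
      fun z => Or.inl (by positivity : (0 : ℝ) < 1 + ‖z‖).ne'
  have hc2 : Continuous fun z : C2 => ((1 + ‖z‖) ^ k : ℝ) • v z :=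
    ((continuous_const.add continuous_norm).pow k).smul v.continuous
  rw [hv', ENNReal.ofReal_mul hK0]
  exact (eLpNorm_smul_le_mul_eLpNorm (p := 2) (q := 2) hc2.aestronglyMeasurable
    hc1.aestronglyMeasurable).trans (mul_le_mul' hK hv)

lemma norm_entry_le (A : EndV n) (i j : Fin (n + 1)) : ‖A i j‖ ≤ ‖A‖ := by
  rw [Matrix.frobenius_norm_def]
  calc ‖A i j‖ = (‖A i j‖ ^ (2 : ℝ)) ^ (1 / 2 : ℝ) := by
        rw [← Real.rpow_mul (norm_nonneg _)]; norm_num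
    _ ≤ _ := by
        refine Real.rpow_le_rpow (by positivity) ?_ (by norm_num)
        refine le_trans ?_ (Finset.single_le_sum (f := fun i => ∑ j, ‖A i j‖ ^ (2 : ℝ))
          (fun i _ => by positivity) (Finset.mem_univ i))
        exact Finset.single_le_sum (f := fun j => ‖A i j‖ ^ (2 : ℝ)) (fun j _ => by positivity)
          (Finset.mem_univ j)

/-- Differentiating along the axis multiplies by a coordinate before the transform, which costs at
most |z|^m; only powers of Δ fall on F. -/
lemma normBounded_fourier (i : Fin (n + 1)) (q m : ℕ) : NormBounded fun (F : 𝓢(C2, EndV n)) r =>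
    ‖iteratedDeriv m (restrictAxis (𝓕 (postcompCLM (entryCLM n i i) (lapS^[q] F)))) r‖ := by
  obtain ⟨k, hk⟩ := Measure.HasTemperateGrowth.exists_eLpNorm_lt_top (E := C2) 2
    (μ := volume) inferInstance
  set K := (eLpNorm (fun z : C2 => (1 + ‖z‖) ^ (-k : ℝ)) 2 volume).toReal with hK
  set c := (2 * Real.pi) ^ m * 2 ^ k with hc
  -- The exponent absorbs the weight k of Cauchy–Schwarz and the m coordinate factors; being at
  -- least q, it also admits the power Δ^q in the norm.
  refine ⟨q + (k + m), K * c, by positivity, fun F A hA hF r => ?_⟩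
  change ‖iteratedDeriv m (restrictAxis (𝓕 (postcompCLM (entryCLM n i i) (lapS^[q] F)))) r‖ ≤ _
  rw [iteratedDeriv_restrictAxis_fourier, mul_assoc]
  refine norm_fourier_le ENNReal.toReal_nonneg (ENNReal.ofReal_toReal hk.ne).ge _
    (by positivity) ?_ _
  have h2 : eLpNorm (fun z => (((1 + ‖z‖ ^ 2) ^ (q + (k + m)) : ℝ) : ℂ) • lap^[q] F z) 2 volume ≤
      ENNReal.ofReal A := by
    rw [← leb_eq_volume]
    exact (Finset.le_sup (f := fun j => eLpNorm (fun z =>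
      (((1 + ‖z‖ ^ 2) ^ (q + (k + m)) : ℝ) : ℂ) • lap^[j] F z) 2 leb)
      (Finset.mem_range.2 (by omega))).trans hF
  rw [ENNReal.ofReal_mul (by positivity)]
  refine le_trans (eLpNorm_le_mul_eLpNorm_of_ae_le_mul (.of_forall fun z => ?_) 2)
    (mul_le_mul_right h2 _)
  rw [lap_iterate_coe, norm_smul, norm_smul, Complex.norm_real,
    Real.norm_of_nonneg (by positivity), Real.norm_of_nonneg (by positivity)]
  have h3 := norm_axisMul_iterate_le m (postcompCLM (entryCLM n i i) (lapS^[q] F)) z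
  have h4 : ‖postcompCLM (entryCLM n i i) (lapS^[q] F) z‖ ≤ ‖lapS^[q] F z‖ :=
    norm_entry_le _ i i
  have ht := norm_nonneg z
  have h5 : (1 + ‖z‖) ^ k * ‖z‖ ^ m ≤ 2 ^ k * (1 + ‖z‖ ^ 2) ^ (q + (k + m)) := by
    have a1 : 1 + ‖z‖ ≤ 2 * (1 + ‖z‖ ^ 2) := by nlinarith [sq_nonneg (‖z‖ - 1)]
    have a2 : ‖z‖ ≤ 1 + ‖z‖ ^ 2 := by nlinarith [sq_nonneg (‖z‖ - 1)]
    have a3 : 1 ≤ 1 + ‖z‖ ^ 2 := by nlinarith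
    calc (1 + ‖z‖) ^ k * ‖z‖ ^ m ≤ (2 * (1 + ‖z‖ ^ 2)) ^ k * (1 + ‖z‖ ^ 2) ^ m := by gcongr
      _ = 2 ^ k * (1 + ‖z‖ ^ 2) ^ (k + m) := by rw [mul_pow, pow_add]; ring
      _ ≤ 2 ^ k * (1 + ‖z‖ ^ 2) ^ (q + (k + m)) :=
        mul_le_mul_of_nonneg_left (pow_le_pow_right₀ a3 (by omega)) (by positivity)
  calc (1 + ‖z‖) ^ k * ‖axisMul^[m] (postcompCLM (entryCLM n i i) (lapS^[q] F)) z‖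
      ≤ (1 + ‖z‖) ^ k * ((2 * Real.pi) ^ m * ‖z‖ ^ m * ‖lapS^[q] F z‖) := by
        gcongr
        exact h3.trans (mul_le_mul_of_nonneg_left h4 (by positivity))
    _ = (2 * Real.pi) ^ m * ((1 + ‖z‖) ^ k * ‖z‖ ^ m) * ‖lapS^[q] F z‖ := by
        ring
    _ ≤ (2 * Real.pi) ^ m * (2 ^ k * (1 + ‖z‖ ^ 2) ^ (q + (k + m))) *
        ‖lapS^[q] F z‖ := by gcongr
    _ = c * ((1 + ‖z‖ ^ 2) ^ (q + (k + m)) * ‖lapS^[q] F z‖) := by rw [hc]; ring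

/-! ### Seminorms of the profile -/

lemma exists_norm_iteratedDeriv_pow_le (i p : ℕ) : ∃ K : ℝ, 0 ≤ K ∧ ∀ x : ℝ,
    ‖iteratedDeriv i (fun x : ℝ => (x : ℂ) ^ p) x‖ ≤ K * (1 + |x|) ^ p := by
  induction i generalizing p with
  | zero =>
    refine ⟨1, zero_le_one, fun x => ?_⟩
    rw [iteratedDeriv_zero, norm_pow, Complex.norm_real, one_mul, Real.norm_eq_abs]
    exact pow_le_pow_left₀ (abs_nonneg _) (by linarith) _
  | succ i ih =>
    obtain ⟨K, hK0, hK⟩ := ih (p - 1)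
    refine ⟨p * K, by positivity, fun x => ?_⟩
    have hd : deriv (fun x : ℝ => (x : ℂ) ^ p) = fun x : ℝ => (p : ℂ) * (x : ℂ) ^ (p - 1) := by
      funext t
      simpa using ((hasDerivAt_id t).ofReal_comp.fun_pow p).deriv
    rw [iteratedDeriv_succ', hd, iteratedDeriv_const_mul_field, norm_mul, Complex.norm_natCast,
      mul_assoc]
    have h1 : (1 : ℝ) ≤ 1 + |x| := by linarith [abs_nonneg x]
    exact mul_le_mul_of_nonneg_left ((hK x).trans (mul_le_mul_of_nonneg_left
      (pow_le_pow_right₀ h1 (Nat.sub_le _ _)) hK0)) (by positivity)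

lemma one_add_abs_pow_le (x : ℝ) (p : ℕ) : (1 + |x|) ^ p ≤ 2 ^ p * (x ^ (2 * 0) + x ^ (2 * p)) := by
  have h : (1 + |x|) ^ p ≤ (2 * max 1 |x|) ^ p :=
    pow_le_pow_left₀ (by positivity) (by linarith [le_max_left 1 |x|, le_max_right 1 |x|]) p
  refine h.trans ?_
  rw [mul_pow]
  refine mul_le_mul_of_nonneg_left ?_ (by positivity)
  rw [mul_zero, pow_zero, pow_mul, ← sq_abs, ← pow_mul]
  rcases le_total |x| 1 with h1 | h1
  · rw [max_eq_left h1, one_pow]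
    exact le_add_of_nonneg_right (by positivity)
  · rw [max_eq_right h1]
    exact (pow_le_pow_right₀ h1 (by omega)).trans (le_add_of_nonneg_left zero_le_one)

/-- On the axis Δ has symbol 4π²r², so r^{2q} times the profile of F̂ is a constant multiple of a
diagonal entry of the transform of Δ^q F. -/
lemma normBounded_pow_mul_profile (l : ℕ) (i : Fin (n + 1)) (q m : ℕ) :
    NormBounded fun (F : 𝓢(C2, EndV n)) r =>
      ‖iteratedDeriv m (fun r : ℝ => (r : ℂ) ^ (2 * q) * profile n l i (𝓕 F) r) r‖ := by
  have hpi : (4 * Real.pi ^ 2 : ℂ) ^ q ≠ 0 :=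
    pow_ne_zero _ (mul_ne_zero (by norm_num) (pow_ne_zero _ (by exact_mod_cast Real.pi_ne_zero)))
  refine ((normBounded_fourier i q m).const_mul
    (norm_nonneg (((4 * Real.pi ^ 2 : ℂ) ^ q)⁻¹ * (B n l i i)⁻¹))).mono fun F r => le_of_eq ?_
  have h : (fun r : ℝ => (r : ℂ) ^ (2 * q) * profile n l i (𝓕 F) r) = fun r =>
      (((4 * Real.pi ^ 2 : ℂ) ^ q)⁻¹ * (B n l i i)⁻¹) *
        restrictAxis (𝓕 (postcompCLM (entryCLM n i i) (lapS^[q] F))) r := by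
    funext r
    have h1 : restrictAxis (𝓕 (postcompCLM (entryCLM n i i) (lapS^[q] F))) r =
        entryCLM n i i (𝓕 (lapS^[q] F) (axis r)) := by
      rw [restrictAxis_apply, fourier_coe]
      exact fourier_clm_apply (entryCLM n i i) (lapS^[q] F) (axis r)
    rw [h1, fourier_lapS_iterate, LinearIsometry.norm_map, Real.norm_eq_abs, sq_abs, map_smul,
      entryCLM_apply, profile_apply, mul_pow (4 * (Real.pi : ℂ) ^ 2), smul_eq_mul,
      pow_mul, Complex.ofReal_pow]
    generalize (4 * Real.pi ^ 2 : ℂ) ^ q = X at hpi ⊢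
    field_simp
  rw [h, iteratedDeriv_const_mul_field, norm_mul]

/-- Strong induction on m: by Leibniz, r^{2q} φ^{(m)} differs from (r^{2q} φ)^{(m)} by terms with
fewer derivatives on φ and polynomial weights. -/
lemma normBounded_profile (l : ℕ) (i : Fin (n + 1)) (m p : ℕ) :
    NormBounded fun (F : 𝓢(C2, EndV n)) r =>
      (1 + |r|) ^ p * ‖iteratedDeriv m (profile n l i (𝓕 F)) r‖ := by
  induction m using Nat.strong_induction_on generalizing p with
  | _ m ih =>
    have key : ∀ q, NormBounded fun (F : 𝓢(C2, EndV n)) r =>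
        r ^ (2 * q) * ‖iteratedDeriv m (profile n l i (𝓕 F)) r‖ := fun q => by
      choose K hK0 hK using fun j => exists_norm_iteratedDeriv_pow_le j (2 * q)
      refine ((normBounded_pow_mul_profile l i q m).add (NormBounded.sum (Finset.range m)
        (b := fun j F r => (m.choose (j + 1) * K (j + 1)) *
          ((1 + |r|) ^ (2 * q) * ‖iteratedDeriv (m - (j + 1)) (profile n l i (𝓕 F)) r‖))
        fun j hj => (ih (m - (j + 1)) (by have := Finset.mem_range.1 hj; omega) (2 * q)).const_mul
          (mul_nonneg (by positivity) (hK0 _)))).mono fun F r => ?_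
      set φ := profile n l i (𝓕 F) with hφ
      have hL := iteratedDeriv_fun_mul (n := m) (x := r) (f := fun x : ℝ => (x : ℂ) ^ (2 * q))
        (g := φ) ((Complex.ofRealCLM.contDiff.pow _).contDiffAt) (φ.smooth m).contDiffAt
      rw [Finset.sum_range_succ'] at hL
      simp only [Nat.choose_zero_right, Nat.cast_one, one_mul, iteratedDeriv_zero, Nat.sub_zero]
        at hL
      have h1 : r ^ (2 * q) * ‖iteratedDeriv m φ r‖ = ‖(r : ℂ) ^ (2 * q) * iteratedDeriv m φ r‖ := by
        rw [norm_mul, norm_pow, Complex.norm_real, Real.norm_eq_abs, pow_mul, pow_mul, sq_abs]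
      rw [h1, ← sub_eq_of_eq_add' hL]
      refine (norm_sub_le _ _).trans (add_le_add le_rfl ((norm_sum_le _ _).trans
        (Finset.sum_le_sum fun j _ => ?_)))
      rw [norm_mul, norm_mul, Complex.norm_natCast]
      calc _ ≤ (m.choose (j + 1) : ℝ) * (K (j + 1) * (1 + |r|) ^ (2 * q)) *
            ‖iteratedDeriv (m - (j + 1)) φ r‖ := by
              gcongr
              exact hK _ _
        _ = _ := by ring
    refine (((key 0).add (key p)).const_mul (K := 2 ^ p) (by positivity)).mono fun F r => ?_
    rw [← add_mul, ← mul_assoc]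
    exact mul_le_mul_of_nonneg_right (one_add_abs_pow_le r p) (norm_nonneg _)

lemma normBounded_seminorm_profile (l : ℕ) (i : Fin (n + 1)) (k m : ℕ) :
    NormBounded fun (F : 𝓢(C2, EndV n)) _ =>
      SchwartzMap.seminorm ℂ k m (profile n l i (𝓕 F)) := by
  obtain ⟨N, C, hC, h⟩ := normBounded_profile l i m k
  refine ⟨N, C, hC, fun F A hA hF _ =>
    SchwartzMap.seminorm_le_bound' ℂ k m _ (by positivity) fun x => le_trans
      (mul_le_mul_of_nonneg_right (pow_le_pow_left₀ (abs_nonneg _) (by linarith [abs_nonneg x]) _)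
        (norm_nonneg _)) (h F A hA hF x)⟩

lemma seminorm_sum_apply {ι : Type*} (p : ι → Seminorm ℂ 𝓢(ℝ, ℂ)) (s : Finset ι) (f : 𝓢(ℝ, ℂ)) :
    (∑ i ∈ s, p i) f = ∑ i ∈ s, p i f := by
  classical
  induction s using Finset.induction_on with
  | empty => rfl
  | insert i s hi ih => rw [Finset.sum_insert hi, Finset.sum_insert hi, _root_.add_apply, ih]

lemma normBounded_of_continuous (l : ℕ) (i : Fin (n + 1)) {p : Seminorm ℂ 𝓢(ℝ, ℂ)}
    (hp : Continuous p) : NormBounded fun (F : 𝓢(C2, EndV n)) _ => p (profile n l i (𝓕 F)) := by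
  obtain ⟨s, C, _, hC⟩ := Seminorm.bound_of_continuous (schwartz_withSeminorms ℂ ℝ ℂ) p hp
  refine ((NormBounded.sum s fun x _ => normBounded_seminorm_profile l i x.1 x.2).const_mul
    C.coe_nonneg).mono fun F _ => (hC _).trans ?_
  change (C : ℝ) * _ ≤ _
  refine mul_le_mul_of_nonneg_left ?_ C.coe_nonneg
  refine (Seminorm.finset_sup_le_sum (schwartzSeminormFamily ℂ ℝ ℂ) s
    (profile n l i (𝓕 F))).trans (le_of_eq ?_)
  exact seminorm_sum_apply _ _ _

/-! ### The norms `normR` -/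

/-- Each weighted L² norm is a continuous seminorm, since differentiation, polynomial weights and
the map to L² are continuous on Schwartz functions. -/
lemma exists_seminorm_normR_le (M : ℕ) : ∃ p : Seminorm ℂ 𝓢(ℝ, ℂ), Continuous p ∧
    ∀ g : 𝓢(ℝ, ℂ), normR M g ≤ ENNReal.ofReal (p g) := by
  have hgrow : (fun t : ℝ => (((1 + t ^ 2) ^ M : ℝ) : ℂ)).HasTemperateGrowth := by fun_prop
  let T : ℕ → 𝓢(ℝ, ℂ) →L[ℂ] Lp ℂ 2 (volume : Measure ℝ) := fun q =>
    (toLpCLM ℂ ℂ 2 volume).comp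
      ((smulLeftCLM ℂ fun t : ℝ => (((1 + t ^ 2) ^ M : ℝ) : ℂ)).comp (sderiv ^ (2 * q)))
  let P : ℕ → Seminorm ℂ 𝓢(ℝ, ℂ) := fun q => (normSeminorm ℂ _).comp (T q).toLinearMap
  have hsum : ∀ g, (∑ q ∈ Finset.range (M + 1), P q) g =
      ∑ q ∈ Finset.range (M + 1), P q g := seminorm_sum_apply P _
  refine ⟨∑ q ∈ Finset.range (M + 1), P q, ?_, fun g => Finset.sup_le fun q hq => ?_⟩
  · have : ⇑(∑ q ∈ Finset.range (M + 1), P q) = fun g => ∑ q ∈ Finset.range (M + 1), P q g :=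
      funext hsum
    rw [this]
    exact continuous_finsetSum _ fun q _ => continuous_norm.comp (T q).continuous
  · have h1 : P q g = (eLpNorm (fun t : ℝ => (((1 + t ^ 2) ^ M : ℝ) : ℂ) •
        iteratedDeriv (2 * q) g t) 2 volume).toReal := by
      change ‖toLp _ 2 volume‖ = _
      rw [norm_toLp]
      congr 2
      funext t
      rw [iteratedDeriv_schwartz]
      exact smulLeftCLM_apply_apply hgrow _ t
    have h2 : eLpNorm (fun t : ℝ => (((1 + t ^ 2) ^ M : ℝ) : ℂ) •
        iteratedDeriv (2 * q) g t) 2 volume < ⊤ := by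
      have := (smulLeftCLM ℂ (fun t : ℝ => (((1 + t ^ 2) ^ M : ℝ) : ℂ))
        ((sderiv ^ (2 * q)) g)).eLpNorm_lt_top 2 volume
      refine lt_of_eq_of_lt (congrArg (fun f => eLpNorm f 2 volume) (funext fun t => ?_)) this
      rw [iteratedDeriv_schwartz]
      exact (smulLeftCLM_apply_apply hgrow _ t).symm
    rw [hsum, ← ENNReal.ofReal_toReal h2.ne, ← h1]
    exact ENNReal.ofReal_le_ofReal (Finset.single_le_sum (f := fun q => P q g)
      (fun q _ => apply_nonneg _ _) hq)

/-- The map from the profile of the Fourier transform of `F` to `g`. -/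
def profileToRadial (l : ℕ) : 𝓢(ℝ, ℂ) →L[ℂ] 𝓢(ℝ, ℂ) :=
  (whitney.comp restrictAxis).comp
    (((FourierTransform.fourierCLE ℂ 𝓢(C2, ℂ)).symm.toContinuousLinearMap).comp
      ((((2 * Real.pi) ^ (2 * l) : ℂ)⁻¹ • compNormSq).comp (whitney.comp (divX ^ (2 * l)))))

lemma exists_normR_radialPart_le (n l : ℕ) (i : Fin (n + 1)) (M : ℕ) :
    ∃ (N : ℕ) (C : NNReal), M + l ≤ N ∧ ∀ F : 𝓢(C2, EndV n),
      normR M (radialPart n l i F) ≤ C * normC2 N F := by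
  obtain ⟨p, hp, hpM⟩ := exists_seminorm_normR_le M
  obtain ⟨N, C, hC, h⟩ := normBounded_of_continuous (n := n) l i
    (p := p.comp (profileToRadial l).toLinearMap) (hp.comp (profileToRadial l).continuous)
  -- The maximum secures N ≥ M + l, harmless as the norms increase with the index. The constant C +
  -- 1 is positive, so the bound stays trivial if the norm of F is infinite.
  refine ⟨max N (M + l), (C + 1).toNNReal, le_max_right _ _, fun F => ?_⟩
  by_cases htop : normC2 (max N (M + l)) F = ⊤
  · rw [htop, ENNReal.mul_top]
    · exact le_top
    · exact ENNReal.coe_ne_zero.2 (Real.toNNReal_pos.2 (by linarith)).ne'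
  · set A := (normC2 (max N (M + l)) F).toReal with hA
    have hA' : normC2 (max N (M + l)) F = ENNReal.ofReal A := (ENNReal.ofReal_toReal htop).symm
    have h1 := h F A ENNReal.toReal_nonneg ((normC2_mono (le_max_left _ _) _).trans hA'.le) 0
    refine (hpM _).trans ?_
    rw [hA', ← ENNReal.ofReal, ← ENNReal.ofReal_mul (by linarith)]
    refine ENNReal.ofReal_le_ofReal (le_trans h1 ?_)
    nlinarith [ENNReal.toReal_nonneg (a := normC2 (max N (M + l)) F)]

end
end MotionGroup

theorem mainTheorem7 (n l : ℕ) (hl : l ≤ n) :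
    MotionGroup.IsDiagPoly n l (MotionGroup.qPoly n l) ∧
    ∃ (M' : ℕ → ℕ) (C : ℕ → NNReal), (∀ M, M + l ≤ M' M) ∧
      ∀ F : SchwartzMap MotionGroup.C2 (MotionGroup.EndV n),
        MotionGroup.IsEquivariant F → (∀ z, F z ∈ MotionGroup.W n l) →
        ∃ (g₀ : SchwartzMap MotionGroup.C2 ℂ) (g : SchwartzMap ℝ ℂ),
          (∀ z, F z = MotionGroup.multiplier (MotionGroup.Q n l) g₀ z) ∧
          (∀ z, F z = MotionGroup.homOp n l (MotionGroup.qPoly n l) g₀ z) ∧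
          (∀ z, g₀ z = g (‖z‖ ^ 2)) ∧
          ∀ M, MotionGroup.normR M g ≤ C M * MotionGroup.normC2 (M' M) F := by
  -- The index used to read off the profile depends on n and l only, so the constants are uniform in
  -- F, and one pair g₀, g serves every M.
  obtain ⟨i, hi⟩ := MotionGroup.exists_B_apply_ne_zero hl
  choose M' C hM' hC using MotionGroup.exists_normR_radialPart_le n l i
  exact ⟨MotionGroup.isDiagPoly_qPoly hl, M', C, hM', fun F hF hW =>
    ⟨MotionGroup.potential n l i F, MotionGroup.radialPart n l i F,
      MotionGroup.eq_multiplier hl hi hF hW, MotionGroup.eq_homOp hl hi hF hW,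
      MotionGroup.potential_eq i F, fun M => hC M F⟩⟩
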